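/- Let $p$ be a prime. **Witt vectors with coefficients.** For a ring $R$ and an $R$-bimodule $M$ let $M^{\otimes_R^{\mathrm{cyc}}k}=M^{\otimes_Rk}/[R,M^{\otimes_Rk}]$ be the cyclic tensor power, with its action of the cyclic group $C_k$ by rotation of the tensor factors. For $0\le j<n$ the ghost map is $$w_j\colon \prod_{i=0}^{n-1}M^{\otimes_Rp^i}\to (M^{\otimes_R^{\mathrm{cyc}}p^j})^{C_{p^j}},\qquad w_j(m_0,\dots,m_{n-1})=\sum_{i=0}^{j}\mathrm{tr}_{C_{p^{j-i}}}^{C_{p^j}}\big(m_i^{\otimes p^{j-i}}\big).$$ Let $FUFU(R;M)\rightrightarrows FU(R;M)\xrightarrow{\varepsilon}(R;M)$ be the canonical free resolution given by the free--forgetful adjunction between pairs (ring; bimodule) and pairs of sets, with parallel maps $f,g$. Then $W_{n,p}(R;M)$ is the quotient of $\prod_{i<n}M^{\otimes_Rp^i}$ by the equivalence relation generated by: $a\sim b$ if there are $q,u$ over $FU(R;M)$ and $z$ over $FUFU(R;M)$ with $\varepsilon_*q=a$, $\varepsilon_*u=b$, $w(q)=w(f_*z)$, $w(u)=w(g_*z)$.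 The ghost maps descend to $W_{n,p}(R;M)$. Now consider pairs $(R;M)$ of a commutative ring $R$ and a commutative $R$-algebra $M$ (a morphism is a pair of compatible ring homomorphisms); then $w_j$ takes values in the commutative ring $M^{\otimes_Rp^j}$. Write $\sigma_{j}$ for the rotation generating the action of $C_{p^j}$ on $M^{\otimes_Rp^j}$, and identify the target of the ghost map $w_j$ of $W_{n,p}(R;M^{\otimes_Rp})$ with $M^{\otimes_Rp^{j+1}}$ by concatenation. On such pairs there are: a unique natural product on $W_{n,p}(R;M)$ with $w_j(xy)=w_j(x)w_j(y)$, which is commutative and associative with unit $1=(1,0,\dots,0)$; the restriction $R\colon W_{n+1,p}(R;M)\to W_{n,p}(R;M)$ that drops the last entry; a unique natural map $F\colon W_{n+1,p}(R;M)\to W_{n,p}(R;M^{\otimes_Rp})$ with $w_jF=w_{j+1}$; and a unique natural self-map $\sigma$ of $W_{n,p}(R;M^{\otimes_Rp})$ with $w_j\sigma=\sigma_{j+1}w_j$ (the generator of the Weyl action of $C_p$). For $n\ge1$ let $$N_w\colon \prod_{j=0}^{n-1}(M^{\otimes_Rp^{j+1}})^{C_{p^j}}\to\prod_{j=0}^{n}(M^{\otimes_Rp^j})^{C_{p^j}},\qquad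 N_w(y_0,\dots,y_{n-1})=\Big(\mu_p y_0,\prod_{\sigma\in C_p}\sigma y_0,\prod_{\sigma\in C_{p^2}/C_p}\sigma y_1,\dots,\prod_{\sigma\in C_{p^n}/C_{p^{n-1}}}\sigma y_{n-1}\Big),$$ where $\mu_p\colon M^{\otimes_Rp}\to M$ is the multiplication; $N_w$ is multiplicative and unital. **Proposition.** For every $n\ge 1$ there is a unique map of sets $N\colon W_{n,p}(R;M^{\otimes_Rp})\to W_{n+1,p}(R;M)$, natural in the pairs $(R;M)$ as above, such that $wN=N_ww$. It satisfies $N(xy)=N(x)N(y)$ and $N(1)=1$, and $$FN(x)=\prod_{\sigma\in C_p}\sigma x\quad\text{for } x\in W_{n,p}(R;M^{\otimes_Rp}),\ n\ge1,\qquad RN(x)=NR(x)\quad\text{for } x\in W_{n,p}(R;M^{\otimes_Rp}),\ n\ge2.$$ Moreover $N$ extends the norm of classical Witt vectors: for $M=R$ commutative, the maps $(a_i)_i\mapsto[(a_i\cdot 1^{\otimes p^i})_i]$ from the classical $p$-typical Witt vectors $W_n(R)$ to $W_{n,p}(R;R)$ and to $W_{n,p}(R;R^{\otimes_Rp})$ are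 bijections, and under them $N$ corresponds to the unique natural map $W_n(R)\to W_{n+1}(R)$ which is $(x_0,\dots,x_{n-1})\mapsto(x_0,x_0^p,\dots,x_{n-1}^p)$ on ghost components (Angeltveit's norm). -/

import Mathlib

open scoped TensorProduct

universe u

noncomputable section

namespace WittCoeff

/-! ### Bimodules and their tensor powers -/

/-- A pair `(R; M)` of a ring `R` (not necessarily commutative) and an `R`-bimodule `M`; the right
action of `r` is the scalar action of `MulOpposite.op r`. -/
structure Bimod : Type (u + 1) where
  R : Type u
  M : Type u
  [ring : Ring R]
  [addCommGroup : AddCommGroup M]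
  [left : Module R M]
  [right : Module Rᵐᵒᵖ M]
  [smulComm : SMulCommClass R Rᵐᵒᵖ M]

attribute [instance] Bimod.ring Bimod.addCommGroup Bimod.left Bimod.right Bimod.smulComm

/-- A morphism `(R; M) → (R'; M')` of bimodules over varying rings. -/
@[ext]
structure Bimod.Hom (B C : Bimod.{u}) where
  base : B.R →+* C.R
  map : B.M →+ C.M
  map_left : ∀ (r : B.R) (m : B.M), map (r • m) = base r • map m
  map_right : ∀ (r : B.R) (m : B.M),
    map (MulOpposite.op r • m) = MulOpposite.op (base r) • map m

def Bimod.Hom.comp {B C D : Bimod.{u}} (ψ : Bimod.Hom C D) (φ : Bimod.Hom B C) :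
    Bimod.Hom B D where
  base := ψ.base.comp φ.base
  map := ψ.map.comp φ.map
  map_left r m := by simp [φ.map_left, ψ.map_left]
  map_right r m := by simp [φ.map_right, ψ.map_right]

/-- The `k`-fold tensor power over the integers of the abelian group `M`. -/
abbrev Bimod.IntPow (B : Bimod.{u}) (k : ℕ) : Type u := ⨂[ℤ] _ : Fin k, B.M

/-- The subgroup of `M^{⊗_ℤ k}` generated by the elements
`(… ⊗ mᵢ r ⊗ …) - (… ⊗ r mⱼ ⊗ …)` for all pairs of positions `i, j` with `adj i j`. -/
def Bimod.balance (B : Bimod.{u}) {k : ℕ} (adj : Fin k → Fin k → Prop) :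
    AddSubgroup (B.IntPow k) :=
  AddSubgroup.closure {x | ∃ (m : Fin k → B.M) (r : B.R) (i j : Fin k), adj i j ∧
    x = PiTensorProduct.tprod ℤ (Function.update m i (MulOpposite.op r • m i)) -
      PiTensorProduct.tprod ℤ (Function.update m j (r • m j))}

/-- `j` is the position directly after `i`. -/
def linAdj {k : ℕ} (i j : Fin k) : Prop := (i : ℕ) + 1 = j

/-- `j` is the position directly after `i` in the cyclic order (the last is followed by the
first). -/
def cycAdj {k : ℕ} (i j : Fin k) : Prop := finRotate k i = j

/-- The tensor power `M^{⊗_R k}` over `R` (for `k ≥ 1`). -/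
abbrev Bimod.TPow (B : Bimod.{u}) (k : ℕ) : Type u := B.IntPow k ⧸ B.balance (k := k) linAdj

/-- The cyclic tensor power `M^{⊗_R k} / [R, M^{⊗_R k}]` (for `k ≥ 1`). -/
abbrev Bimod.CycPow (B : Bimod.{u}) (k : ℕ) : Type u := B.IntPow k ⧸ B.balance (k := k) cycAdj

/-- The map induced on integral tensor powers by a bimodule morphism. -/
def Bimod.Hom.intPow {B C : Bimod.{u}} (φ : Bimod.Hom B C) (k : ℕ) : B.IntPow k →+ C.IntPow k :=
  (PiTensorProduct.map (fun _ : Fin k => φ.map.toIntLinearMap)).toAddMonoidHom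

theorem Bimod.Hom.intPow_tprod {B C : Bimod.{u}} (φ : Bimod.Hom B C) {k : ℕ} (m : Fin k → B.M) :
    φ.intPow k (PiTensorProduct.tprod ℤ m) = PiTensorProduct.tprod ℤ (fun i => φ.map (m i)) := by
  simp [Bimod.Hom.intPow]

theorem map_update' {ι X Y : Type*} [DecidableEq ι] (f : X → Y) (m : ι → X) (i : ι) (x : X) :
    (fun l => f (Function.update m i x l)) = Function.update (fun l => f (m l)) i (f x) := by
  funext l
  by_cases h : l = i
  · subst h; simp
  · simp [h]

theorem Bimod.Hom.balance_le {B C : Bimod.{u}} (φ : Bimod.Hom B C) {k : ℕ}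
    (adj : Fin k → Fin k → Prop) :
    B.balance adj ≤ (C.balance adj).comap (φ.intPow k) := by
  refine (AddSubgroup.closure_le _).2 ?_
  rintro _ ⟨m, r, i, j, hij, rfl⟩
  refine AddSubgroup.subset_closure ⟨fun l => φ.map (m l), φ.base r, i, j, hij, ?_⟩
  rw [map_sub, φ.intPow_tprod, φ.intPow_tprod, map_update', map_update', φ.map_left, φ.map_right]

/-- Functoriality of the tensor power. -/
def Bimod.Hom.tPow {B C : Bimod.{u}} (φ : Bimod.Hom B C) (k : ℕ) : B.TPow k →+ C.TPow k :=
  QuotientAddGroup.map _ _ (φ.intPow k) (φ.balance_le linAdj)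

/-- Functoriality of the cyclic tensor power. -/
def Bimod.Hom.cycPow {B C : Bimod.{u}} (φ : Bimod.Hom B C) (k : ℕ) : B.CycPow k →+ C.CycPow k :=
  QuotientAddGroup.map _ _ (φ.intPow k) (φ.balance_le cycAdj)

/-! ### Cyclic rotation and concatenation of tensors -/

/-- The generator `m₁ ⊗ … ⊗ m_k ↦ m_k ⊗ m₁ ⊗ … ⊗ m_{k-1}` of the cyclic action on a `k`-fold tensor
power. -/
def rotate (A : Type*) {X : Type*} [CommRing A] [AddCommGroup X] [Module A X] (k : ℕ) :
    (⨂[A] _ : Fin k, X) →+ (⨂[A] _ : Fin k, X) :=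
  (PiTensorProduct.reindex A (fun _ : Fin k => X) (finRotate k)).toLinearMap.toAddMonoidHom

theorem rotate_tprod (A : Type*) {X : Type*} [CommRing A] [AddCommGroup X] [Module A X] {k : ℕ}
    (m : Fin k → X) : rotate A k (PiTensorProduct.tprod A m) =
      PiTensorProduct.tprod A (fun i => m ((finRotate k).symm i)) := by
  simp [rotate]

theorem update_comp_symm {k : ℕ} {X : Type*} (e : Fin k ≃ Fin k) (m : Fin k → X) (i : Fin k)
    (x : X) : (fun l => Function.update m i x (e.symm l)) =
      Function.update (fun l => m (e.symm l)) (e i) x := by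
  funext l
  by_cases h : l = e i
  · subst h; simp
  · have h' : e.symm l ≠ i := fun hh => h (by rw [← hh]; simp)
    simp [h, h']

theorem Bimod.rotate_balance_le (B : Bimod.{u}) (k : ℕ) :
    B.balance (k := k) cycAdj ≤ (B.balance (k := k) cycAdj).comap (rotate ℤ k) := by
  refine (AddSubgroup.closure_le _).2 ?_
  rintro _ ⟨m, r, i, j, hij, rfl⟩
  refine AddSubgroup.subset_closure
    ⟨fun l => m ((finRotate k).symm l), r, finRotate k i, finRotate k j, ?_, ?_⟩
  · rw [cycAdj] at hij ⊢
    rw [hij]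
  · rw [map_sub, rotate_tprod, rotate_tprod, update_comp_symm, update_comp_symm]
    simp only [Equiv.symm_apply_apply]

/-- The cyclic action on the cyclic tensor power. -/
def Bimod.cycRotate (B : Bimod.{u}) (k : ℕ) : B.CycPow k →+ B.CycPow k :=
  QuotientAddGroup.map _ _ (rotate ℤ k) (B.rotate_balance_le k)

/-- Concatenation `(X^{⊗k})^N → X^{⊗Nk}` of `N` tensors of length `k`, as a multilinear map: it is the
product of the tensor algebra, followed by the projection to degree `Nk`; see `concat_tprod`. -/
def concat (A : Type*) (X : Type*) [CommRing A] [AddCommGroup X] [Module A X] (N k : ℕ) :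
    MultilinearMap A (fun _ : Fin N => ⨂[A] _ : Fin k, X) (⨂[A] _ : Fin (N * k), X) :=
  ((DirectSum.component A ℕ (fun n => TensorPower A n X) (N * k)).comp
      (TensorAlgebra.equivDirectSum (R := A) (M := X)).toLinearMap).compMultilinearMap
    ((MultilinearMap.mkPiAlgebraFin A N (TensorAlgebra A X)).compLinearMap
      (fun _ => TensorPower.toTensorAlgebra (R := A) (M := X) (n := k)))

theorem concat_tprod (A : Type*) {X : Type*} [CommRing A] [AddCommGroup X] [Module A X] {N k : ℕ}
    (v : Fin N → Fin k → X) :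
    concat A X N k (fun a => PiTensorProduct.tprod A (v a)) =
      PiTensorProduct.tprod A
        (fun c : Fin (N * k) => v (finProdFinEquiv.symm c).1 (finProdFinEquiv.symm c).2) := by
  have key : (List.ofFn fun a => TensorAlgebra.tprod A X k (v a)).prod =
      TensorAlgebra.tprod A X (N * k)
        (fun c : Fin (N * k) => v (finProdFinEquiv.symm c).1 (finProdFinEquiv.symm c).2) := by
    rw [TensorAlgebra.tprod_apply, List.ofFn_mul, List.prod_flatten, List.map_ofFn]
    congr 2
    funext a
    simp only [Function.comp, TensorAlgebra.tprod_apply]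
    congr 2
    funext b
    have hc : (⟨(a : ℕ) * k + b, by
        calc (a : ℕ) * k + b < a * k + k := Nat.add_lt_add_left b.2 _
          _ = (a + 1) * k := by ring
          _ ≤ N * k := Nat.mul_le_mul_right _ a.2⟩ : Fin (N * k)) = finProdFinEquiv (a, b) := by
      ext
      simp [finProdFinEquiv, mul_comm, add_comm]
    rw [hc, Equiv.symm_apply_apply]
  simp only [concat, LinearMap.compMultilinearMap_apply, MultilinearMap.compLinearMap_apply,
    MultilinearMap.mkPiAlgebraFin_apply, TensorPower.toTensorAlgebra_tprod, key]
  simp only [LinearMap.comp_apply, AlgEquiv.toLinearMap_apply]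
  have : TensorAlgebra.equivDirectSum (R := A) (M := X) (TensorAlgebra.tprod A X (N * k)
        (fun c : Fin (N * k) => v (finProdFinEquiv.symm c).1 (finProdFinEquiv.symm c).2)) = _ :=
    TensorAlgebra.toDirectSum_tensorPower_tprod _
  rw [this]
  exact DirectSum.component.lof_self A _ _

theorem concat_update_balance (B : Bimod.{u}) {N k : ℕ} (a : Fin N) (g : B.IntPow k)
    (hg : g ∈ B.balance (k := k) linAdj) (x : Fin N → B.IntPow k) :
    concat ℤ B.M N k (Function.update x a g) ∈ B.balance (k := N * k) cycAdj := by
  classical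
  suffices H : ∀ (s : Finset (Fin N)) (x : Fin N → B.IntPow k),
      (∀ b, b ∉ s → b ≠ a → x b ∈ Set.range (PiTensorProduct.tprod ℤ (s := fun _ : Fin k => B.M))) →
      concat ℤ B.M N k (Function.update x a g) ∈ B.balance (k := N * k) cycAdj from
    H Finset.univ x (fun b hb => absurd (Finset.mem_univ b) hb)
  intro s
  induction s using Finset.induction_on with
  | empty =>
    intro x hx
    have hx' : ∀ b, ∃ w : Fin k → B.M, b ≠ a → PiTensorProduct.tprod ℤ w = x b := by
      intro b
      by_cases hb : b = a
      · exact ⟨0, fun h => absurd hb h⟩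
      · obtain ⟨w, hw⟩ := hx b (by simp) hb
        exact ⟨w, fun _ => hw⟩
    choose w hw using hx'
    have hpure : ∀ y : Fin k → B.M,
        Function.update x a (PiTensorProduct.tprod ℤ y) =
          fun b => PiTensorProduct.tprod ℤ (Function.update w a y b) := by
      intro y
      funext b
      by_cases hb : b = a
      · subst hb; simp
      · simp [hb, hw b hb]
    have hupd : ∀ (y : Fin k → B.M) (i : Fin k) (z : B.M),
        concat ℤ B.M N k (Function.update x a (PiTensorProduct.tprod ℤ (Function.update y i z))) =
          PiTensorProduct.tprod ℤ (Function.update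
            (fun c : Fin (N * k) => Function.update w a y (finProdFinEquiv.symm c).1
              (finProdFinEquiv.symm c).2) (finProdFinEquiv (a, i)) z) := by
      intro y i z
      rw [hpure, concat_tprod]
      congr 1
      funext c
      obtain ⟨⟨b, l⟩, rfl⟩ := finProdFinEquiv.surjective c
      rw [Equiv.symm_apply_apply]
      by_cases hb : b = a
      · subst hb
        by_cases hl : l = i
        · subst hl; simp
        · have : finProdFinEquiv (b, l) ≠ finProdFinEquiv (b, i) := by simp [hl]
          rw [Function.update_of_ne this]
          simp [hl]
      · have : finProdFinEquiv (b, l) ≠ finProdFinEquiv (a, i) := by simp [hb]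
        rw [Function.update_of_ne this]
        simp [hb]
    induction hg using AddSubgroup.closure_induction with
    | mem g hg =>
      obtain ⟨m, r, i, j, hij, rfl⟩ := hg
      rw [MultilinearMap.map_update_sub, hupd, hupd]
      refine AddSubgroup.subset_closure
        ⟨fun c : Fin (N * k) => Function.update w a m (finProdFinEquiv.symm c).1
          (finProdFinEquiv.symm c).2, r, finProdFinEquiv (a, i), finProdFinEquiv (a, j), ?_,
          by simp only [Equiv.symm_apply_apply, Function.update_self]⟩
      have h1 : ((finProdFinEquiv (a, i) : Fin (N * k)) : ℕ) + 1 = finProdFinEquiv (a, j) := by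
        have : (i : ℕ) + 1 = j := hij
        simp [finProdFinEquiv, ← this]
        ring
      generalize (finProdFinEquiv (a, i) : Fin (N * k)) = c at h1
      generalize (finProdFinEquiv (a, j) : Fin (N * k)) = d at h1
      generalize N * k = q at c d h1
      rw [cycAdj]
      cases q with
      | zero => exact c.elim0
      | succ q =>
        ext
        rw [coe_finRotate_of_ne_last, h1]
        rintro rfl
        have := d.2
        simp at h1
        omega
    | zero =>
      rw [MultilinearMap.map_update_zero]
      exact zero_mem _
    | add g h _ _ hg hh =>
      rw [MultilinearMap.map_update_add]
      exact add_mem hg hh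
    | neg g _ hg =>
      rw [MultilinearMap.map_update_neg]
      exact neg_mem hg
  | insert c s hc ih =>
    intro x hx
    by_cases hca : c = a
    · refine ih x fun b hb hba => hx b ?_ hba
      simp only [Finset.mem_insert, not_or]
      exact ⟨fun h => hba (h.trans hca), hb⟩
    have hswap : ∀ y, Function.update (Function.update x c y) a g =
        Function.update (Function.update x a g) c y := fun y =>
      Function.update_comm hca _ _ _
    have hgen : ∀ y : B.IntPow k,
        concat ℤ B.M N k (Function.update (Function.update x c y) a g) ∈
          B.balance (k := N * k) cycAdj := by
      intro y
      induction y using PiTensorProduct.induction_on with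
      | smul_tprod r f =>
        rw [hswap, MultilinearMap.map_update_smul, ← hswap]
        have := ih (Function.update x c (PiTensorProduct.tprod ℤ f)) (by
          intro b hb hba
          by_cases hbc : b = c
          · subst hbc; simp
          · rw [Function.update_of_ne hbc]
            exact hx b (by simp [hbc, hb]) hba)
        convert zsmul_mem this r using 1
      | add y z hy hz =>
        rw [hswap, MultilinearMap.map_update_add, ← hswap, ← hswap]
        exact add_mem hy hz
    simpa using hgen (x c)

theorem concat_const_congr (B : Bimod.{u}) {N k : ℕ} (x y : B.IntPow k)
    (h : x - y ∈ B.balance (k := k) linAdj) :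
    concat ℤ B.M N k (fun _ => x) - concat ℤ B.M N k (fun _ => y) ∈
      B.balance (k := N * k) cycAdj := by
  classical
  suffices H : ∀ s : Finset (Fin N),
      concat ℤ B.M N k (fun a => if a ∈ s then x else y) - concat ℤ B.M N k (fun _ => y) ∈
        B.balance (k := N * k) cycAdj by
    simpa using H Finset.univ
  intro s
  induction s using Finset.induction_on with
  | empty => simp
  | insert c s hc ih =>
    have e1 : (fun a => if a ∈ insert c s then x else y) =
        Function.update (fun a => if a ∈ s then x else y) c x := by
      funext a
      by_cases h : a = c
      · subst h; simp
      · simp [h]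
    have e2 : (fun a => if a ∈ s then x else y) =
        Function.update (fun a => if a ∈ s then x else y) c y := by
      funext a
      by_cases h : a = c
      · subst h; simp [hc]
      · simp [h]
    have h3 := concat_update_balance B c (x - y) h (fun a => if a ∈ s then x else y)
    rw [MultilinearMap.map_update_sub, ← e1, ← e2] at h3
    have := add_mem h3 ih
    simpa using this

/-- The power `x ↦ x^{⊗N}` from `M^{⊗_R k}` to the cyclic tensor power of length `Nk`. -/
def Bimod.power' (B : Bimod.{u}) (N k : ℕ) (x : B.TPow k) : B.CycPow (N * k) :=
  Quotient.liftOn' x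
    (fun y => (QuotientAddGroup.mk (concat ℤ B.M N k (fun _ => y)) : B.CycPow (N * k)))
    (fun y z h => by
      have h1 : y - z ∈ B.balance (k := k) linAdj := by
        have := neg_mem (QuotientAddGroup.leftRel_apply.1 h)
        simpa [sub_eq_add_neg, add_comm] using this
      have h2 := concat_const_congr B (N := N) y z h1
      refine QuotientAddGroup.eq.2 ?_
      simpa [sub_eq_add_neg, add_comm] using neg_mem h2)

/-- The power `x ↦ x^{⊗N}`, with a length `m` that is propositionally equal to `Nk`. -/
def Bimod.power (B : Bimod.{u}) {N k m : ℕ} (h : N * k = m) (x : B.TPow k) : B.CycPow m :=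
  h ▸ B.power' N k x

/-! ### Naturality of rotation and power -/

theorem Bimod.intPow_hom_ext {B : Bimod.{u}} {k : ℕ} {G : Type*} [AddCommGroup G]
    {f g : B.IntPow k →+ G}
    (h : ∀ m, f (PiTensorProduct.tprod ℤ m) = g (PiTensorProduct.tprod ℤ m)) : f = g := by
  ext x
  induction x using PiTensorProduct.induction_on with
  | smul_tprod r m =>
    have e : ∀ q : B.IntPow k →+ G, q (r • PiTensorProduct.tprod ℤ m) =
        r • q (PiTensorProduct.tprod ℤ m) := fun q => by
      convert map_zsmul q r _
    rw [e, e, h]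
  | add y z hy hz => rw [map_add, map_add, hy, hz]

theorem Bimod.Hom.intPow_rotate {B C : Bimod.{u}} (φ : Bimod.Hom B C) {k : ℕ} (x : B.IntPow k) :
    φ.intPow k (rotate ℤ k x) = rotate ℤ k (φ.intPow k x) := by
  have : (φ.intPow k).comp (rotate ℤ k) = (rotate ℤ k).comp (φ.intPow k) := by
    refine Bimod.intPow_hom_ext fun m => ?_
    simp only [AddMonoidHom.comp_apply, rotate_tprod, φ.intPow_tprod]
  exact DFunLike.congr_fun this x

theorem Bimod.Hom.cycPow_rotate {B C : Bimod.{u}} (φ : Bimod.Hom B C) {k : ℕ} (x : B.CycPow k) :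
    φ.cycPow k (B.cycRotate k x) = C.cycRotate k (φ.cycPow k x) := by
  induction x using QuotientAddGroup.induction_on with
  | H y => exact congrArg QuotientAddGroup.mk (φ.intPow_rotate y)

theorem Bimod.Hom.intPow_concat {B C : Bimod.{u}} (φ : Bimod.Hom B C) {N k : ℕ}
    (x : Fin N → B.IntPow k) :
    φ.intPow (N * k) (concat ℤ B.M N k x) = concat ℤ C.M N k (fun a => φ.intPow k (x a)) := by
  classical
  suffices H : ∀ (s : Finset (Fin N)) (x : Fin N → B.IntPow k),
      (∀ b, b ∉ s → x b ∈ Set.range (PiTensorProduct.tprod ℤ (s := fun _ : Fin k => B.M))) →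
      φ.intPow (N * k) (concat ℤ B.M N k x) = concat ℤ C.M N k (fun a => φ.intPow k (x a)) from
    H Finset.univ x (fun b hb => absurd (Finset.mem_univ b) hb)
  intro s
  induction s using Finset.induction_on with
  | empty =>
    intro x hx
    choose w hw using fun b => hx b (by simp)
    obtain rfl : (fun b => PiTensorProduct.tprod ℤ (w b)) = x := funext hw
    rw [concat_tprod, φ.intPow_tprod]
    simp only [φ.intPow_tprod]
    rw [concat_tprod]
  | insert c s hc ih =>
    intro x hx
    have hgen : ∀ y : B.IntPow k,
        φ.intPow (N * k) (concat ℤ B.M N k (Function.update x c y)) =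
          concat ℤ C.M N k (Function.update (fun a => φ.intPow k (x a)) c (φ.intPow k y)) := by
      intro y
      induction y using PiTensorProduct.induction_on with
      | smul_tprod r f =>
        have e : ∀ (q : ℕ) (z : B.IntPow q), φ.intPow q (r • z) = r • φ.intPow q z := fun q z =>
          map_smul (PiTensorProduct.map (fun _ : Fin q => φ.map.toIntLinearMap)) r z
        rw [MultilinearMap.map_update_smul, e, e, MultilinearMap.map_update_smul]
        congr 1
        rw [ih]
        · congr 1
          funext a
          by_cases h : a = c
          · subst h; simp
          · simp [h]
        · intro b hb
          by_cases hbc : b = c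
          · subst hbc; simp
          · rw [Function.update_of_ne hbc]
            exact hx b (by simp [hbc, hb])
      | add y z hy hz =>
        rw [MultilinearMap.map_update_add, map_add, map_add, hy, hz,
          MultilinearMap.map_update_add]
    have := hgen (x c)
    rw [Function.update_eq_self] at this
    rw [this]
    congr 1
    exact Function.update_eq_self c (fun a => φ.intPow k (x a))

theorem Bimod.Hom.cycPow_power {B C : Bimod.{u}} (φ : Bimod.Hom B C) {N k m : ℕ} (h : N * k = m)
    (x : B.TPow k) : φ.cycPow m (B.power h x) = C.power h (φ.tPow k x) := by
  subst h
  induction x using QuotientAddGroup.induction_on with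
  | H y =>
    refine congrArg QuotientAddGroup.mk ?_
    exact φ.intPow_concat (fun _ => y)

theorem Bimod.Hom.tPow_comp {B C D : Bimod.{u}} (ψ : Bimod.Hom C D) (φ : Bimod.Hom B C) {k : ℕ}
    (x : B.TPow k) : (ψ.comp φ).tPow k x = ψ.tPow k (φ.tPow k x) := by
  have : (ψ.comp φ).intPow k = (ψ.intPow k).comp (φ.intPow k) :=
    Bimod.intPow_hom_ext fun m => by
      simp only [AddMonoidHom.comp_apply, Bimod.Hom.intPow_tprod]
      rfl
  induction x using QuotientAddGroup.induction_on with
  | H y => exact congrArg QuotientAddGroup.mk (DFunLike.congr_fun this y)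

/-! ### The ghost map on sequences -/

/-- The set `∏_{i < n} M^{⊗_R pⁱ}`. -/
abbrev Bimod.Seq (B : Bimod.{u}) (p n : ℕ) : Type u := ∀ i : Fin n, B.TPow (p ^ (i : ℕ))

/-- The map induced on sequences by a bimodule morphism. -/
def Bimod.Hom.seq {B C : Bimod.{u}} (φ : Bimod.Hom B C) {p n : ℕ} (a : B.Seq p n) : C.Seq p n :=
  fun i => φ.tPow _ (a i)

theorem ghost_exponent {p i j : ℕ} (h : i ≤ j) : p ^ (j - i) * p ^ i = p ^ j := by
  rw [← pow_add, Nat.sub_add_cancel h]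

/-- The `j`-th ghost component `w_j(m) = ∑_{i ≤ j} tr(mᵢ^{⊗ p^{j-i}})`, where `tr` is the transfer
from the subgroup of order `p^{j-i}` to the cyclic group of order `p^j`: the sum over the
translates by the coset representatives `σ^l`, `l < pⁱ`, with `σ` the rotation generator. -/
def Bimod.seqGhost (B : Bimod.{u}) {p n : ℕ} (a : B.Seq p n) (j : Fin n) :
    B.CycPow (p ^ (j : ℕ)) :=
  ∑ i : Fin ((j : ℕ) + 1), ∑ l ∈ Finset.range (p ^ (i : ℕ)),
    (B.cycRotate (p ^ (j : ℕ)))^[l]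
      (B.power (ghost_exponent (Nat.lt_succ_iff.1 i.2))
        (a ⟨i, lt_of_le_of_lt (Nat.lt_succ_iff.1 i.2) j.2⟩))

theorem Bimod.Hom.cycPow_seqGhost {B C : Bimod.{u}} (φ : Bimod.Hom B C) {p n : ℕ}
    (a : B.Seq p n) (j : Fin n) :
    φ.cycPow _ (B.seqGhost a j) = C.seqGhost (φ.seq a) j := by
  have hiter : ∀ (l : ℕ) (x : B.CycPow (p ^ (j : ℕ))),
      φ.cycPow _ ((B.cycRotate _)^[l] x) = (C.cycRotate _)^[l] (φ.cycPow _ x) := by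
    intro l
    induction l with
    | zero => intro x; rfl
    | succ l ih => intro x; rw [Function.iterate_succ_apply, ih, φ.cycPow_rotate]; rfl
  simp only [Bimod.seqGhost, map_sum, hiter, φ.cycPow_power]
  rfl

/-! ### Free bimodules and the canonical free resolution -/

/-- A left module over `R ⊗_ℤ Rᵒᵖ` as an `R`-bimodule. -/
def Bimod.ofEnveloping (R M : Type u) [Ring R] [AddCommGroup M] [Module (R ⊗[ℤ] Rᵐᵒᵖ) M] :
    Bimod.{u} :=
  letI l : Module R M := Module.compHom M (Algebra.TensorProduct.includeLeft :
      R →ₐ[ℤ] R ⊗[ℤ] Rᵐᵒᵖ).toRingHom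
  letI r : Module Rᵐᵒᵖ M := Module.compHom M (Algebra.TensorProduct.includeRight :
      Rᵐᵒᵖ →ₐ[ℤ] R ⊗[ℤ] Rᵐᵒᵖ).toRingHom
  { R := R
    M := M
    left := l
    right := r
    smulComm := ⟨fun a b m => by
      change (a ⊗ₜ[ℤ] (1 : Rᵐᵒᵖ)) • ((1 : R) ⊗ₜ[ℤ] b) • m =
        ((1 : R) ⊗ₜ[ℤ] b) • (a ⊗ₜ[ℤ] (1 : Rᵐᵒᵖ)) • m
      rw [smul_smul, smul_smul]
      simp⟩ }

/-- The free bimodule on a pair of sets `(X, Y)`: the ring is the free ring `S = ℤ{X}`, and the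
bimodule is the free module on `Y` over `S ⊗_ℤ Sᵒᵖ`. -/
def Bimod.free (X Y : Type u) : Bimod.{u} :=
  Bimod.ofEnveloping (FreeRing X) (Y →₀ FreeRing X ⊗[ℤ] (FreeRing X)ᵐᵒᵖ)

/-- The ring generator of the free bimodule attached to `x`. -/
def Bimod.free.var {X Y : Type u} (x : X) : (Bimod.free X Y).R := (FreeRing.of x : FreeRing X)

/-- The module generator of the free bimodule attached to `y`. -/
def Bimod.free.gen {X Y : Type u} (y : Y) : (Bimod.free X Y).M :=
  (Finsupp.single y 1 : Y →₀ FreeRing X ⊗[ℤ] (FreeRing X)ᵐᵒᵖ)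

/-- For `α : S → R` and `m` in an `R`-bimodule, the map `s ⊗ t ↦ α(s) m α(t)`. -/
def Bimod.act (B : Bimod.{u}) {S : Type u} [Ring S] (α : S →+* B.R) (m : B.M) :
    S ⊗[ℤ] Sᵐᵒᵖ →+ B.M :=
  (TensorProduct.lift (LinearMap.mk₂ ℤ
    (fun (s : S) (t : Sᵐᵒᵖ) => α s • MulOpposite.op (α t.unop) • m)
    (fun s s' t => by rw [map_add, add_smul])
    (fun c s t => by rw [map_zsmul, smul_assoc])
    (fun s t t' => by
      rw [MulOpposite.unop_add, map_add, MulOpposite.op_add, add_smul, smul_add])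
    (fun c s t => by
      rw [MulOpposite.unop_smul, map_zsmul, MulOpposite.op_smul, smul_assoc, smul_comm]))
    ).toAddMonoidHom

theorem Bimod.act_tmul (B : Bimod.{u}) {S : Type u} [Ring S] (α : S →+* B.R) (m : B.M) (s : S)
    (t : Sᵐᵒᵖ) : B.act α m (s ⊗ₜ t) = α s • MulOpposite.op (α t.unop) • m := rfl

theorem Bimod.act_left (B : Bimod.{u}) {S : Type u} [Ring S] (α : S →+* B.R) (m : B.M) (r : S)
    (x : S ⊗[ℤ] Sᵐᵒᵖ) : B.act α m ((r ⊗ₜ 1) * x) = α r • B.act α m x := by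
  induction x using TensorProduct.induction_on with
  | zero => simp
  | tmul s t =>
    rw [Algebra.TensorProduct.tmul_mul_tmul, one_mul, B.act_tmul, B.act_tmul, map_mul, mul_smul]
  | add x y hx hy => rw [mul_add, map_add, map_add, hx, hy, smul_add]

theorem Bimod.act_right (B : Bimod.{u}) {S : Type u} [Ring S] (α : S →+* B.R) (m : B.M) (r : S)
    (x : S ⊗[ℤ] Sᵐᵒᵖ) : B.act α m ((1 ⊗ₜ MulOpposite.op r) * x) =
      MulOpposite.op (α r) • B.act α m x := by
  induction x using TensorProduct.induction_on with
  | zero => simp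
  | tmul s t =>
    rw [Algebra.TensorProduct.tmul_mul_tmul, one_mul, B.act_tmul, B.act_tmul,
      MulOpposite.unop_mul, MulOpposite.unop_op, map_mul, MulOpposite.op_mul, mul_smul,
      smul_comm (α s)]
  | add x y hx hy => rw [mul_add, map_add, map_add, hx, hy, smul_add]

/-- The additive map `(Y →₀ S ⊗ Sᵒᵖ) → M` with `(s ⊗ t) · y ↦ α(s) h(y) α(t)`. -/
def Bimod.extend (B : Bimod.{u}) {S Y : Type u} [Ring S] (α : S →+* B.R) (h : Y → B.M) :
    (Y →₀ S ⊗[ℤ] Sᵐᵒᵖ) →+ B.M :=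
  Finsupp.liftAddHom (fun y => B.act α (h y))

theorem Bimod.extend_single (B : Bimod.{u}) {S Y : Type u} [Ring S] (α : S →+* B.R) (h : Y → B.M)
    (y : Y) (x : S ⊗[ℤ] Sᵐᵒᵖ) : B.extend α h (Finsupp.single y x) = B.act α (h y) x :=
  Finsupp.liftAddHom_apply_single _ _ _

theorem Bimod.extend_left (B : Bimod.{u}) {S Y : Type u} [Ring S] (α : S →+* B.R) (h : Y → B.M)
    (r : S) (m : Y →₀ S ⊗[ℤ] Sᵐᵒᵖ) :
    B.extend α h ((r ⊗ₜ[ℤ] (1 : Sᵐᵒᵖ)) • m) = α r • B.extend α h m := by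
  induction m using Finsupp.induction_linear with
  | zero => simp
  | add x y hx hy => rw [smul_add, map_add, map_add, hx, hy, smul_add]
  | single y x =>
    rw [Finsupp.smul_single, B.extend_single, B.extend_single, smul_eq_mul, B.act_left]

theorem Bimod.extend_right (B : Bimod.{u}) {S Y : Type u} [Ring S] (α : S →+* B.R) (h : Y → B.M)
    (r : S) (m : Y →₀ S ⊗[ℤ] Sᵐᵒᵖ) :
    B.extend α h (((1 : S) ⊗ₜ[ℤ] MulOpposite.op r) • m) =
      MulOpposite.op (α r) • B.extend α h m := by
  induction m using Finsupp.induction_linear with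
  | zero => simp
  | add x y hx hy => rw [smul_add, map_add, map_add, hx, hy, smul_add]
  | single y x =>
    rw [Finsupp.smul_single, B.extend_single, B.extend_single, smul_eq_mul, B.act_right]

/-- The universal property of the free bimodule. -/
def Bimod.free.lift {X Y : Type u} (B : Bimod.{u}) (g : X → B.R) (h : Y → B.M) :
    Bimod.Hom (Bimod.free X Y) B where
  base := (FreeRing.lift g : FreeRing X →+* B.R)
  map := B.extend (FreeRing.lift g) h
  map_left := B.extend_left (FreeRing.lift g) h
  map_right := B.extend_right (FreeRing.lift g) h

theorem Bimod.free.lift_base_var {X Y : Type u} (B : Bimod.{u}) (g : X → B.R) (h : Y → B.M)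
    (x : X) : (Bimod.free.lift B g h).base (Bimod.free.var x) = g x :=
  FreeRing.lift_of g x

theorem Bimod.free.lift_map_gen {X Y : Type u} (B : Bimod.{u}) (g : X → B.R) (h : Y → B.M)
    (y : Y) : (Bimod.free.lift B g h).map (Bimod.free.gen y) = h y := by
  refine (B.extend_single _ _ _ _).trans ?_
  rw [Algebra.TensorProduct.one_def, B.act_tmul]
  simp

theorem single_tmul_eq {S Y : Type u} [Ring S] (y : Y) (s : S) (t : Sᵐᵒᵖ) :
    (Finsupp.single y (s ⊗ₜ[ℤ] t) : Y →₀ S ⊗[ℤ] Sᵐᵒᵖ) =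
      (s ⊗ₜ[ℤ] (1 : Sᵐᵒᵖ)) • ((1 : S) ⊗ₜ[ℤ] MulOpposite.op t.unop) •
        (Finsupp.single y 1 : Y →₀ S ⊗[ℤ] Sᵐᵒᵖ) := by
  rw [Finsupp.smul_single, Finsupp.smul_single]
  simp

theorem Bimod.free.hom_ext {X Y : Type u} {B : Bimod.{u}} {φ ψ : Bimod.Hom (Bimod.free X Y) B}
    (h1 : ∀ x : X, φ.base (Bimod.free.var x) = ψ.base (Bimod.free.var x))
    (h2 : ∀ y : Y, φ.map (Bimod.free.gen y) = ψ.map (Bimod.free.gen y)) : φ = ψ := by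
  have hb : φ.base = ψ.base := FreeRing.hom_ext h1
  refine Bimod.Hom.ext hb ?_
  refine Finsupp.addHom_ext fun y t => ?_
  induction t using TensorProduct.induction_on with
  | zero => rw [Finsupp.single_zero]; exact (map_zero φ.map).trans (map_zero ψ.map).symm
  | tmul s t =>
    have key : ∀ θ : Bimod.Hom (Bimod.free X Y) B,
        θ.map (Finsupp.single y (s ⊗ₜ[ℤ] t) : Y →₀ FreeRing X ⊗[ℤ] (FreeRing X)ᵐᵒᵖ) =
          θ.base s • MulOpposite.op (θ.base t.unop) • θ.map (Bimod.free.gen y) := by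
      intro θ
      rw [single_tmul_eq]
      refine (θ.map_left s _).trans ?_
      congr 1
      exact θ.map_right t.unop _
    exact (key φ).trans (by rw [hb, h2]; exact (key ψ).symm)
  | add a b ha hb =>
    rw [Finsupp.single_add]
    exact (map_add φ.map _ _).trans ((congrArg₂ (· + ·) ha hb).trans (map_add ψ.map _ _).symm)

/-- `FU(R; M)`: the free bimodule on the underlying pair of sets of `(R; M)`. -/
def Bimod.cover (B : Bimod.{u}) : Bimod.{u} := Bimod.free B.R B.M

/-- The counit `ε : FU(R; M) → (R; M)`. -/
def Bimod.counit (B : Bimod.{u}) : Bimod.Hom B.cover B := Bimod.free.lift B id id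

/-- Functoriality of `FU`. -/
def Bimod.Hom.cover {B C : Bimod.{u}} (φ : Bimod.Hom B C) : Bimod.Hom B.cover C.cover :=
  Bimod.free.lift (Bimod.free C.R C.M) (fun r => Bimod.free.var (φ.base r))
    (fun m => Bimod.free.gen (φ.map m))

theorem Bimod.Hom.counit_comp {B C : Bimod.{u}} (φ : Bimod.Hom B C) :
    φ.comp B.counit = C.counit.comp φ.cover := by
  refine Bimod.free.hom_ext (fun x => ?_) (fun y => ?_)
  · have h1 : B.counit.base (Bimod.free.var x : (Bimod.free B.R B.M).R) = x :=
      Bimod.free.lift_base_var B id id x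
    have h2 : φ.cover.base (Bimod.free.var x : (Bimod.free B.R B.M).R) =
      (Bimod.free.var (φ.base x) : (Bimod.free C.R C.M).R) := Bimod.free.lift_base_var _ _ _ x
    have h3 : C.counit.base (Bimod.free.var (φ.base x) : (Bimod.free C.R C.M).R) = φ.base x :=
      Bimod.free.lift_base_var C id id _
    exact (congrArg φ.base h1).trans (h3.symm.trans (congrArg C.counit.base h2.symm))
  · have h1 : B.counit.map (Bimod.free.gen y : (Bimod.free B.R B.M).M) = y :=
      Bimod.free.lift_map_gen B id id y
    have h2 : φ.cover.map (Bimod.free.gen y : (Bimod.free B.R B.M).M) =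
      (Bimod.free.gen (φ.map y) : (Bimod.free C.R C.M).M) := Bimod.free.lift_map_gen _ _ _ y
    have h3 : C.counit.map (Bimod.free.gen (φ.map y) : (Bimod.free C.R C.M).M) = φ.map y :=
      Bimod.free.lift_map_gen C id id _
    exact (congrArg φ.map h1).trans (h3.symm.trans (congrArg C.counit.map h2.symm))

theorem Bimod.Hom.cover_comp {B C D : Bimod.{u}} (ψ : Bimod.Hom C D) (φ : Bimod.Hom B C) :
    (ψ.comp φ).cover = ψ.cover.comp φ.cover := by
  refine Bimod.free.hom_ext (fun x => ?_) (fun y => ?_)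
  · have h1 : φ.cover.base (Bimod.free.var x : (Bimod.free B.R B.M).R) =
      (Bimod.free.var (φ.base x) : (Bimod.free C.R C.M).R) := Bimod.free.lift_base_var _ _ _ x
    have h2 : ψ.cover.base (Bimod.free.var (φ.base x) : (Bimod.free C.R C.M).R) =
      (Bimod.free.var (ψ.base (φ.base x)) : (Bimod.free D.R D.M).R) :=
      Bimod.free.lift_base_var _ _ _ _
    have h3 : (ψ.comp φ).cover.base (Bimod.free.var x : (Bimod.free B.R B.M).R) =
      (Bimod.free.var (ψ.base (φ.base x)) : (Bimod.free D.R D.M).R) :=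
      Bimod.free.lift_base_var _ _ _ _
    exact h3.trans (h2.symm.trans (congrArg ψ.cover.base h1.symm))
  · have h1 : φ.cover.map (Bimod.free.gen y : (Bimod.free B.R B.M).M) =
      (Bimod.free.gen (φ.map y) : (Bimod.free C.R C.M).M) := Bimod.free.lift_map_gen _ _ _ y
    have h2 : ψ.cover.map (Bimod.free.gen (φ.map y) : (Bimod.free C.R C.M).M) =
      (Bimod.free.gen (ψ.map (φ.map y)) : (Bimod.free D.R D.M).M) :=
      Bimod.free.lift_map_gen _ _ _ _
    have h3 : (ψ.comp φ).cover.map (Bimod.free.gen y : (Bimod.free B.R B.M).M) =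
      (Bimod.free.gen (ψ.map (φ.map y)) : (Bimod.free D.R D.M).M) :=
      Bimod.free.lift_map_gen _ _ _ _
    exact h3.trans (h2.symm.trans (congrArg ψ.cover.map h1.symm))

/-! ### Witt vectors with coefficients -/

/-- The relation on `∏_{i < n} M^{⊗_R pⁱ}` defined by the canonical free resolution
`FUFU(R; M) ⇉ FU(R; M) → (R; M)`, whose two parallel maps `f, g` are the counit of `FU(R; M)` and
`FU` of the counit of `(R; M)`. -/
def Bimod.WittRel (B : Bimod.{u}) (p n : ℕ) (a b : B.Seq p n) : Prop :=
  ∃ (q u : B.cover.Seq p n) (z : B.cover.cover.Seq p n),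
    B.counit.seq q = a ∧ B.counit.seq u = b ∧
    (∀ j, B.cover.seqGhost q j = B.cover.seqGhost (B.cover.counit.seq z) j) ∧
    (∀ j, B.cover.seqGhost u j = B.cover.seqGhost (B.counit.cover.seq z) j)

/-- The Witt vectors `W_{n,p}(R; M)` of length `n` with coefficients: the quotient of
`∏_{i < n} M^{⊗_R pⁱ}` by the equivalence relation generated by `WittRel`. -/
def Bimod.Witt (p n : ℕ) (B : Bimod.{u}) : Type u := Quot (B.WittRel p n)

theorem Bimod.Hom.seq_comp {B C D : Bimod.{u}} (ψ : Bimod.Hom C D) (φ : Bimod.Hom B C) {p n : ℕ}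
    (a : B.Seq p n) : (ψ.comp φ).seq a = ψ.seq (φ.seq a) :=
  funext fun i => ψ.tPow_comp φ (a i)

theorem Bimod.Hom.wittRel {B C : Bimod.{u}} (φ : Bimod.Hom B C) {p n : ℕ} {a b : B.Seq p n}
    (h : B.WittRel p n a b) : C.WittRel p n (φ.seq a) (φ.seq b) := by
  obtain ⟨q, u, z, rfl, rfl, hq, hu⟩ := h
  refine ⟨φ.cover.seq q, φ.cover.seq u, φ.cover.cover.seq z, ?_, ?_, fun j => ?_, fun j => ?_⟩
  · rw [← Bimod.Hom.seq_comp, ← Bimod.Hom.seq_comp, φ.counit_comp]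
  · rw [← Bimod.Hom.seq_comp, ← Bimod.Hom.seq_comp, φ.counit_comp]
  · rw [← φ.cover.cycPow_seqGhost, hq, φ.cover.cycPow_seqGhost, ← Bimod.Hom.seq_comp,
      ← Bimod.Hom.seq_comp, φ.cover.counit_comp]
  · rw [← φ.cover.cycPow_seqGhost, hu, φ.cover.cycPow_seqGhost, ← Bimod.Hom.seq_comp,
      ← Bimod.Hom.seq_comp, ← Bimod.Hom.cover_comp, φ.counit_comp, Bimod.Hom.cover_comp]

/-- Functoriality of the Witt vectors, induced by the product map on sequences. -/
def Bimod.Hom.witt {B C : Bimod.{u}} (φ : Bimod.Hom B C) (p n : ℕ) :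
    Bimod.Witt p n B → Bimod.Witt p n C :=
  Quot.map φ.seq fun _ _ h => φ.wittRel h

theorem Bimod.counit_comp_counit (B : Bimod.{u}) :
    B.counit.comp B.cover.counit = B.counit.comp B.counit.cover :=
  B.counit.counit_comp

/-- The ghost map on Witt vectors. -/
def Bimod.ghost {B : Bimod.{u}} {p n : ℕ} (j : Fin n) : Bimod.Witt p n B → B.CycPow (p ^ (j : ℕ)) :=
  Quot.lift (fun a => B.seqGhost a j) (by
    rintro _ _ ⟨q, u, z, rfl, rfl, hq, hu⟩
    rw [← B.counit.cycPow_seqGhost, ← B.counit.cycPow_seqGhost, hq, hu,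
      B.counit.cycPow_seqGhost, B.counit.cycPow_seqGhost, ← Bimod.Hom.seq_comp,
      ← Bimod.Hom.seq_comp, B.counit_comp_counit])

/-- Forgetting the last entry of a sequence. -/
def Bimod.Seq.init {B : Bimod.{u}} {p n : ℕ} (a : B.Seq p (n + 1)) : B.Seq p n :=
  fun i => a i.castSucc

/-- The restriction map `R(m₀, …, m_n) = (m₀, …, m_{n-1})`. -/
def Bimod.restrict {B : Bimod.{u}} {p n : ℕ} : Bimod.Witt p (n + 1) B → Bimod.Witt p n B :=
  Quot.map Bimod.Seq.init (by
    rintro _ _ ⟨q, u, z, rfl, rfl, hq, hu⟩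
    exact ⟨Bimod.Seq.init q, Bimod.Seq.init u, Bimod.Seq.init z, rfl, rfl,
      fun j => hq j.castSucc, fun j => hu j.castSucc⟩)

/-! ### Commutative algebras -/

/-- A pair `(R; M)` of a commutative ring `R` and a commutative `R`-algebra `M`. -/
structure AlgPair : Type (u + 1) where
  R : Type u
  M : Type u
  [ring : CommRing R]
  [commRing : CommRing M]
  [algebra : Algebra R M]

attribute [instance] AlgPair.ring AlgPair.commRing AlgPair.algebra

/-- A morphism of pairs: a ring homomorphism `R → R'` and a compatible ring homomorphism
`M → M'`. -/
structure AlgPair.Hom (A B : AlgPair.{u}) where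
  base : A.R →+* B.R
  map : A.M →+* B.M
  comm : ∀ r : A.R, map (algebraMap A.R A.M r) = algebraMap B.R B.M (base r)

/-- The symmetric bimodule underlying a commutative algebra: left and right actions agree. -/
def AlgPair.toBimod (A : AlgPair.{u}) : Bimod.{u} :=
  letI r : Module A.Rᵐᵒᵖ A.M := Module.compHom A.M (RingEquiv.toOpposite A.R).symm.toRingHom
  { R := A.R
    M := A.M
    right := r
    smulComm := ⟨fun a b m => by
      change a • (b.unop • m) = b.unop • (a • m)
      exact smul_comm a b.unop m⟩ }

theorem AlgPair.Hom.map_smul {A B : AlgPair.{u}} (φ : AlgPair.Hom A B) (r : A.R) (m : A.M) :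
    φ.map (r • m) = φ.base r • φ.map m := by
  rw [Algebra.smul_def, Algebra.smul_def, map_mul, φ.comm]

def AlgPair.Hom.toBimod {A B : AlgPair.{u}} (φ : AlgPair.Hom A B) :
    Bimod.Hom A.toBimod B.toBimod where
  base := φ.base
  map := φ.map.toAddMonoidHom
  map_left r m := φ.map_smul r m
  map_right r m := φ.map_smul r m

/-- The commutative ring `M^{⊗_R k}`. -/
abbrev AlgPair.Pow (A : AlgPair.{u}) (k : ℕ) : Type u := ⨂[A.R] _ : Fin k, A.M

/-- The pair `(R; M^{⊗_R k})`. -/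
abbrev AlgPair.tensor (A : AlgPair.{u}) (k : ℕ) : AlgPair.{u} where
  R := A.R
  M := A.Pow k

/-- The semilinear map `M^{⊗_R k} → M'^{⊗_{R'} k}` induced by a morphism of pairs; the target is an
`R`-module by restriction along `R → R'`. -/
def AlgPair.Hom.powLin {A B : AlgPair.{u}} (φ : AlgPair.Hom A B) (k : ℕ) :
    letI : Module A.R (B.Pow k) := Module.compHom _ φ.base
    A.Pow k →ₗ[A.R] B.Pow k :=
  letI : Module A.R (B.Pow k) := Module.compHom _ φ.base
  PiTensorProduct.lift
    { toFun := fun m : Fin k → A.M => PiTensorProduct.tprod B.R (fun i => φ.map (m i))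
      map_update_add' := fun m i x y => by
        rw [map_update', map_update', map_update', map_add, MultilinearMap.map_update_add]
      map_update_smul' := fun m i c x => by
        rw [map_update', map_update', φ.map_smul, MultilinearMap.map_update_smul]
        rfl }

def AlgPair.Hom.powAdd {A B : AlgPair.{u}} (φ : AlgPair.Hom A B) (k : ℕ) : A.Pow k →+ B.Pow k :=
  letI : Module A.R (B.Pow k) := Module.compHom _ φ.base
  (φ.powLin k).toAddMonoidHom

theorem AlgPair.Hom.powAdd_smul_tprod {A B : AlgPair.{u}} (φ : AlgPair.Hom A B) {k : ℕ} (r : A.R)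
    (m : Fin k → A.M) : φ.powAdd k (r • PiTensorProduct.tprod A.R m) =
      φ.base r • PiTensorProduct.tprod B.R (fun i => φ.map (m i)) := by
  let : Module A.R (B.Pow k) := Module.compHom _ φ.base
  change φ.powLin k (r • PiTensorProduct.tprod A.R m) = _
  rw [LinearMap.map_smul]
  change φ.base r • (φ.powLin k (PiTensorProduct.tprod A.R m) : B.Pow k) = _
  congr 1
  exact PiTensorProduct.lift.tprod _

/-- The ring homomorphism `M^{⊗_R k} → M'^{⊗_{R'} k}` induced by a morphism of pairs. -/
def AlgPair.Hom.powHom {A B : AlgPair.{u}} (φ : AlgPair.Hom A B) (k : ℕ) : A.Pow k →+* B.Pow k where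
  toFun := φ.powAdd k
  map_zero' := map_zero _
  map_add' := map_add _
  map_one' := by
    have := φ.powAdd_smul_tprod (k := k) 1 1
    rw [one_smul, φ.base.map_one, one_smul] at this
    refine this.trans ?_
    rw [PiTensorProduct.one_def]
    congr 1
    funext i
    exact map_one φ.map
  map_mul' x y := by
    induction x using PiTensorProduct.induction_on with
    | smul_tprod r m =>
      induction y using PiTensorProduct.induction_on with
      | smul_tprod s l =>
        rw [smul_mul_smul_comm, PiTensorProduct.tprod_mul_tprod, φ.powAdd_smul_tprod,
          φ.powAdd_smul_tprod, φ.powAdd_smul_tprod, smul_mul_smul_comm,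
          PiTensorProduct.tprod_mul_tprod, map_mul]
        congr 2
        funext i
        exact map_mul φ.map _ _
      | add y z hy hz => rw [mul_add, map_add, map_add, mul_add, hy, hz]
    | add x z hx hz => rw [add_mul, map_add, map_add, add_mul, hx, hz]

/-- Functoriality of `(R; M) ↦ (R; M^{⊗_R k})`. -/
def AlgPair.Hom.tensor {A B : AlgPair.{u}} (φ : AlgPair.Hom A B) (k : ℕ) :
    AlgPair.Hom (A.tensor k) (B.tensor k) where
  base := φ.base
  map := φ.powHom k
  comm (r : A.R) := by
    have h1 : algebraMap A.R (A.Pow k) r = r • PiTensorProduct.tprod A.R (fun _ => (1 : A.M)) := by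
      rw [Algebra.algebraMap_eq_smul_one]; rfl
    have h2 : algebraMap B.R (B.Pow k) (φ.base r) =
        φ.base r • PiTensorProduct.tprod B.R (fun _ => (1 : B.M)) := by
      rw [Algebra.algebraMap_eq_smul_one]; rfl
    refine (congrArg (φ.powAdd k) h1).trans ((φ.powAdd_smul_tprod r _).trans (Eq.trans ?_ h2.symm))
    simp only [map_one]

/-- The canonical map `M^{⊗_ℤ k} → M^{⊗_R k}`. -/
def fromIntLin (R M : Type*) [CommRing R] [AddCommGroup M] [Module R M] (k : ℕ) :
    (⨂[ℤ] _ : Fin k, M) →ₗ[ℤ] (⨂[R] _ : Fin k, M) :=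
  PiTensorProduct.lift
    { toFun := fun m : Fin k → M => PiTensorProduct.tprod R m
      map_update_add' := fun m i x y => MultilinearMap.map_update_add _ _ _ _ _
      map_update_smul' := fun m i c x => by
        rw [← Int.cast_smul_eq_zsmul R c x, MultilinearMap.map_update_smul,
          Int.cast_smul_eq_zsmul] }

def AlgPair.fromInt (A : AlgPair.{u}) (k : ℕ) : A.toBimod.IntPow k →+ A.Pow k :=
  (fromIntLin A.R A.M k).toAddMonoidHom

theorem AlgPair.fromInt_update_smul (A : AlgPair.{u}) {k : ℕ} (m : Fin k → A.M) (r : A.R)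
    (i : Fin k) : A.fromInt k (PiTensorProduct.tprod ℤ (Function.update m i (r • m i))) =
      r • PiTensorProduct.tprod A.R m := by
  refine Eq.trans (b := PiTensorProduct.tprod A.R (Function.update m i (r • m i)))
    (PiTensorProduct.lift.tprod (R := ℤ) (s := fun _ : Fin k => A.M) _) ?_
  refine (MultilinearMap.map_update_smul (PiTensorProduct.tprod A.R) m i r _).trans ?_
  rw [Function.update_eq_self]

/-- For a commutative algebra, the canonical map from the cyclic tensor power to the commutative
ring `M^{⊗_R k}` (an isomorphism for `k ≥ 1`, by which the two are identified). -/
def AlgPair.fromCyc (A : AlgPair.{u}) (k : ℕ) : A.toBimod.CycPow k →+ A.Pow k :=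
  QuotientAddGroup.lift _ (A.fromInt k) (by
    refine (AddSubgroup.closure_le _).2 ?_
    rintro _ ⟨m, r, i, j, -, rfl⟩
    refine (map_sub (A.fromInt k) _ _).trans (sub_eq_zero.2 ?_)
    exact (A.fromInt_update_smul m r i).trans (A.fromInt_update_smul m r j).symm)

/-- `W_{n,p}(R; M)` for a commutative `R`-algebra `M`. -/
abbrev AlgPair.W (p n : ℕ) (A : AlgPair.{u}) : Type u := Bimod.Witt p n A.toBimod

/-- Functoriality of `W_{n,p}`. -/
def AlgPair.Hom.W {A B : AlgPair.{u}} (φ : AlgPair.Hom A B) (p n : ℕ) :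
    AlgPair.W p n A → AlgPair.W p n B :=
  φ.toBimod.witt p n

/-- The ghost components `w_j : W_{n,p}(R; M) → M^{⊗_R p^j}`, `j < n`. -/
def AlgPair.ghost {A : AlgPair.{u}} {p n : ℕ} (x : A.W p n) (j : Fin n) : A.Pow (p ^ (j : ℕ)) :=
  A.fromCyc _ (Bimod.ghost j x)

/-- The associativity isomorphism `(M^{⊗_R p})^{⊗_R p^j} → M^{⊗_R p^{j+1}}` that concatenates
elementary tensors. -/
def AlgPair.assoc (A : AlgPair.{u}) (p j : ℕ) : (A.tensor p).Pow (p ^ j) →+ A.Pow (p ^ (j + 1)) :=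
  (PiTensorProduct.lift (concat A.R A.M (p ^ j) p)).toAddMonoidHom

/-- The ghost components `w_j : W_{n,p}(R; M^{⊗_R p}) → (M^{⊗_R p})^{⊗_R p^j} ≅ M^{⊗_R p^{j+1}}`. -/
def AlgPair.tensorGhost {A : AlgPair.{u}} {p n : ℕ} (x : (A.tensor p).W p n) (j : Fin n) :
    A.Pow (p ^ ((j : ℕ) + 1)) :=
  A.assoc p j (AlgPair.ghost x j)

/-- The iterated multiplication map `M^{⊗_R k} → M`. -/
def AlgPair.mulMap (A : AlgPair.{u}) (k : ℕ) : A.Pow k →ₗ[A.R] A.M :=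
  PiTensorProduct.lift (MultilinearMap.mkPiAlgebra A.R (Fin k) A.M)

/-- The class of a sequence in the Witt vectors. -/
def AlgPair.W.mk {A : AlgPair.{u}} {p n : ℕ} (a : A.toBimod.Seq p n) : A.W p n := Quot.mk _ a

/-- The class in `M^{⊗_R k}` of the elementary tensor with entries `m`. -/
def AlgPair.elem (A : AlgPair.{u}) {k : ℕ} (m : Fin k → A.M) : A.toBimod.TPow k :=
  QuotientAddGroup.mk (PiTensorProduct.tprod ℤ (s := fun _ : Fin k => A.toBimod.M) m)

/-- The Teichmüller map `τ(m) = (m, 0, …, 0)`. -/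
def AlgPair.teichmuller {A : AlgPair.{u}} (p n : ℕ) (m : A.M) : A.W p n :=
  AlgPair.W.mk fun i => if (i : ℕ) = 0 then A.elem (fun _ => m) else 0

instance (A : AlgPair.{u}) (p n : ℕ) : Nonempty (A.W p n) := ⟨AlgPair.W.mk 0⟩

/-- The restriction map `R`. -/
def AlgPair.restrict {A : AlgPair.{u}} {p n : ℕ} : A.W p (n + 1) → A.W p n := Bimod.restrict

/-! ### The operators

The product, the Frobenius and the Weyl action have no closed formula on representatives; each of
them is the natural transformation with the prescribed ghost components. -/

/-- A natural binary operation on `W_{n,p}(R; M)` that is multiplication on ghost components. -/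
structure IsProduct (p n : ℕ) (m : ∀ A : AlgPair.{u}, A.W p n → A.W p n → A.W p n) : Prop where
  natural : ∀ (A B : AlgPair.{u}) (φ : AlgPair.Hom A B) (x y : A.W p n),
    φ.W p n (m A x y) = m B (φ.W p n x) (φ.W p n y)
  ghost : ∀ (A : AlgPair.{u}) (x y : A.W p n) (j : Fin n),
    AlgPair.ghost (m A x y) j = AlgPair.ghost x j * AlgPair.ghost y j

/-- The product of `W_{n,p}(R; M)`. -/
def wittProduct (p n : ℕ) : ∀ A : AlgPair.{u}, A.W p n → A.W p n → A.W p n :=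
  Classical.epsilon (IsProduct p n)

/-- The unit `τ(1)` of `W_{n,p}(R; M)`. -/
def wittUnit (p n : ℕ) (A : AlgPair.{u}) : A.W p n := AlgPair.teichmuller p n 1

/-- A natural map `W_{n+1,p}(R; M) → W_{n,p}(R; M^{⊗_R p})` with `w_j F = w_{j+1}`. -/
structure IsFrobenius (p n : ℕ) (F : ∀ A : AlgPair.{u}, A.W p (n + 1) → (A.tensor p).W p n) :
    Prop where
  natural : ∀ (A B : AlgPair.{u}) (φ : AlgPair.Hom A B) (x : A.W p (n + 1)),
    (φ.tensor p).W p n (F A x) = F B (φ.W p (n + 1) x)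
  ghost : ∀ (A : AlgPair.{u}) (x : A.W p (n + 1)) (j : Fin n),
    AlgPair.tensorGhost (F A x) j = AlgPair.ghost x j.succ

/-- The Frobenius `F : W_{n+1,p}(R; M) → W_{n,p}(R; M^{⊗_R p})`. -/
def wittFrobenius (p n : ℕ) : ∀ A : AlgPair.{u}, A.W p (n + 1) → (A.tensor p).W p n :=
  Classical.epsilon (IsFrobenius p n)

/-- A natural self-map of `W_{n,p}(R; M^{⊗_R p})` that is, on the ghost components in
`M^{⊗_R p^{j+1}}`, the rotation generating the cyclic group of order `p^{j+1}`. -/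
structure IsWeyl (p n : ℕ) (s : ∀ A : AlgPair.{u}, (A.tensor p).W p n → (A.tensor p).W p n) :
    Prop where
  natural : ∀ (A B : AlgPair.{u}) (φ : AlgPair.Hom A B) (x : (A.tensor p).W p n),
    (φ.tensor p).W p n (s A x) = s B ((φ.tensor p).W p n x)
  ghost : ∀ (A : AlgPair.{u}) (x : (A.tensor p).W p n) (j : Fin n),
    AlgPair.tensorGhost (s A x) j = rotate A.R _ (AlgPair.tensorGhost x j)

/-- The action of the chosen generator of `C_p` on `W_{n,p}(R; M^{⊗_R p})`. -/
def wittWeyl (p n : ℕ) : ∀ A : AlgPair.{u}, (A.tensor p).W p n → (A.tensor p).W p n :=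
  Classical.epsilon (IsWeyl p n)

/-- The product `∏_{σ ∈ C_p} σ x` in `W_{n,p}(R; M^{⊗_R p})`. -/
def weylProduct (p n : ℕ) (A : AlgPair.{u}) (x : (A.tensor p).W p n) : (A.tensor p).W p n :=
  ((List.range p).map fun l => (wittWeyl p n A)^[l] x).foldr (wittProduct p n (A.tensor p))
    (wittUnit p n (A.tensor p))

/-- The map
`N_w(y₀, …, y_n) = (μ(y₀), ∏_{C_p} σ y₀, ∏_{C_{p²}/C_p} σ y₁, …, ∏_{C_{p^{n+1}}/C_{p^n}} σ y_n)`,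
where `y_j ∈ M^{⊗_R p^{j+1}}`. The powers `σ^l`, `l < p`, of the rotation generator `σ` of
`C_{p^{j+1}}` represent the cosets of `C_{p^j}`; for `C_{p^j}`-invariant `y_j` the product does not
depend on the choice of representatives. -/
def normGhost (p n : ℕ) (A : AlgPair.{u}) (y : ∀ j : Fin (n + 1), A.Pow (p ^ ((j : ℕ) + 1))) :
    ∀ j : Fin (n + 2), A.Pow (p ^ (j : ℕ)) :=
  Fin.cases (PiTensorProduct.tprod A.R fun _ => A.mulMap _ (y 0))
    (fun j => ∏ l ∈ Finset.range p, (rotate A.R (p ^ ((j : ℕ) + 1)))^[l] (y j))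

/-- A natural map of sets `N : W_{n+1,p}(R; M^{⊗_R p}) → W_{n+2,p}(R; M)` with `w N = N_w w`. -/
structure IsNorm (p n : ℕ) (N : ∀ A : AlgPair.{u}, (A.tensor p).W p (n + 1) → A.W p (n + 2)) :
    Prop where
  natural : ∀ (A B : AlgPair.{u}) (φ : AlgPair.Hom A B) (x : (A.tensor p).W p (n + 1)),
    φ.W p (n + 2) (N A x) = N B ((φ.tensor p).W p (n + 1) x)
  ghost : ∀ (A : AlgPair.{u}) (x : (A.tensor p).W p (n + 1)),
    AlgPair.ghost (N A x) = normGhost p n A (AlgPair.tensorGhost x)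

/-! ### The norm on classical Witt vectors -/

/-- The pair `(R; R)`. -/
abbrev AlgPair.self (R : Type u) [CommRing R] : AlgPair.{u} where
  R := R
  M := R

/-- The map `(a₀, …, a_{n-1}) ↦ (a₀, a₁ (1 ⊗ … ⊗ 1), …)` from classical truncated Witt vectors of `R`
to `W_{n,p}(R; M)`. -/
def AlgPair.ofClassical (A : AlgPair.{u}) (p n : ℕ) (a : TruncatedWittVector p n A.R) : A.W p n :=
  AlgPair.W.mk fun i => A.elem fun l : Fin (p ^ (i : ℕ)) =>
    if (l : ℕ) = 0 then algebraMap A.R A.M (a.coeff i) else 1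

/-- The norm of classical `p`-typical Witt vectors: a natural map from Witt vectors of length `n + 1`
to those of length `n + 2` that is `(x₀, …, x_n) ↦ (x₀, x₀^p, …, x_n^p)` on ghost components. -/
structure IsClassicalNorm (p n : ℕ) [Fact p.Prime]
    (N : ∀ (R : Type u) [CommRing R],
      TruncatedWittVector p (n + 1) R → TruncatedWittVector p (n + 2) R) : Prop where
  natural : ∀ (R S : Type u) [CommRing R] [CommRing S] (f : R →+* S)
    (a : TruncatedWittVector p (n + 1) R),
    TruncatedWittVector.mk p (fun i => f ((N R a).coeff i)) =
      N S (TruncatedWittVector.mk p fun i => f (a.coeff i))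
  ghost_zero : ∀ (R : Type u) [CommRing R] (a : TruncatedWittVector p (n + 1) R),
    WittVector.ghostComponent 0 (N R a).out = WittVector.ghostComponent 0 a.out
  ghost_succ : ∀ (R : Type u) [CommRing R] (a : TruncatedWittVector p (n + 1) R) (j : ℕ), j ≤ n →
    WittVector.ghostComponent (j + 1) (N R a).out = WittVector.ghostComponent j a.out ^ p

end WittCoeff

end

open WittCoeff

open scoped TensorProduct

noncomputable section

namespace WittCoeff

/-! The proof is an argument with ghost components. Call a pair polynomial if it has a
multiplicative basis in the sense of `MulBasis`: a `ℤ`-basis of `R` and an `R`-basis of `M`, both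
closed under products. For such a pair two things hold. The ghost map is injective, because
elementary tensors of basis elements are permuted by rotation, and on a permutation module over a
torsion-free ring the transfer kills only the elements `e - σ e` (`exists_sub_of_transfer_eq_zero`,
`mk_eq_of_seqGhost_eq`). And the image of the ghost map is known, by an analogue of Dwork's lemma:
repeating elementary tensors of basis elements `p` times defines a lift `ψ` of the Frobenius, and a
family `v` comes from a Witt vector exactly when every `v (j+1) - ψ (v j)` is a transfer from the
trivial group (`Tower.exists_transfer_infGhost`, `Tower.exists_infGhost_eq`).

A general pair is a reflexive coequalizer of polynomial pairs, and Witt vectors turn this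
presentation into a coequalizer of sets (`Presentation.eqvGen_of_witt_eq`), although they are
defined by a resolution by noncommutative free bimodules. Consequently a natural map is determined
by its ghost components, and a natural formula on ghost components comes from a natural map as soon
as it respects the congruences on polynomial pairs (`SetFunctor.Ghost.ext`,
`SetFunctor.Ghost.exists_lift`). Product, Frobenius, Weyl action and norm are all obtained in this
way, and the identities between them are read off from ghost components.

For the norm the congruences are `IsTensorGhost.norm`. In degree zero, `y ↦ ∏ σ^l y` and `y ↦ ψ (μ
y)` are both additive modulo transfers and agree on monomial tensors (`exists_normProd_sub`). In
higher degrees `∏ σ^l (x + tr t)` differs from `∏ σ^l x` by a transfer from the trivial group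
(`exists_normProd_add_transfer`): when the product is expanded, every term that involves `t` has a
free orbit.

When `R → M` is bijective, the defining relation is equality: the free cover maps to `(P; P)` for a
polynomial ring `P` over `ℤ`, where ghost components determine all entries (`eq_of_sim`). This gives
the comparison with classical Witt vectors. Scalar tensors have the classical ghost components, and
on them `∏ σ^l` is the `p`-th power. -/

/-! ### Transfers -/

section Transfer

variable {P : Type*} [AddCommGroup P]

/-- The iterate `σ^k` as an additive map. -/
def iter (σ : P →+ P) : ℕ → (P →+ P)
  | 0 => AddMonoidHom.id P
  | k + 1 => (iter σ k).comp σ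

theorem iter_apply (σ : P →+ P) (k : ℕ) (y : P) : iter σ k y = σ^[k] y := by
  induction k generalizing y with
  | zero => rfl
  | succ k ih => exact ih (σ y)

/-- The sum `1 + σ + … + σ^{M-1}`. -/
def transfer (σ : P →+ P) (M : ℕ) : P →+ P := ∑ l ∈ Finset.range M, iter σ l

theorem transfer_apply (σ : P →+ P) (M : ℕ) (y : P) :
    transfer σ M y = ∑ l ∈ Finset.range M, σ^[l] y := by
  rw [transfer, AddMonoidHom.finsetSum_apply]
  exact Finset.sum_congr rfl fun l _ => iter_apply σ l y

theorem iter_iterate (σ : P →+ P) (k l : ℕ) (y : P) : (iter σ k)^[l] y = σ^[k * l] y := by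
  rw [Function.iterate_mul]
  have : ⇑(iter σ k) = σ^[k] := funext (iter_apply σ k)
  rw [this]

theorem transfer_one (σ : P →+ P) (y : P) : transfer σ 1 y = y := by
  simp [transfer_apply]

/-- Transitivity: the powers `σ^l` with `l < k m` are `σ^a (σ^k)^b` with `a < k` and `b < m`, so a
transfer can be done in two stages along the subgroup generated by `σ^k`. -/
theorem transfer_mul (σ : P →+ P) (k m : ℕ) (y : P) :
    transfer σ (k * m) y = transfer σ k (transfer (iter σ k) m y) := by
  induction m with
  | zero => simp [transfer_apply]
  | succ m ih =>
    rw [Nat.mul_succ, transfer_apply, Finset.sum_range_add, ← transfer_apply, ih,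
      transfer_apply (iter σ k) (m + 1), Finset.sum_range_succ, ← transfer_apply, map_add]
    congr 1
    rw [transfer_apply]
    refine Finset.sum_congr rfl fun l _ => ?_
    rw [iter_iterate, ← Function.iterate_add_apply, add_comm]

theorem iterate_mul_eq_self {X : Type*} {σ : X → X} {d : ℕ} {z : X} (h : σ^[d] z = z) (e : ℕ) :
    σ^[d * e] z = z := by
  rw [Function.iterate_mul]
  exact Function.iterate_fixed h e

theorem transfer_mul_of_fixed (σ : P →+ P) {d : ℕ} {z : P} (h : σ^[d] z = z) (e : ℕ) :
    transfer σ (d * e) z = transfer σ d (e • z) := by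
  rw [transfer_mul, transfer_apply (iter σ d)]
  congr 1
  rw [Finset.sum_congr rfl fun l _ => (iter_iterate σ d l z).trans (iterate_mul_eq_self h l)]
  simp

theorem iterate_transfer (σ : P →+ P) (M l : ℕ) (y : P) :
    σ^[l] (transfer σ M y) = transfer σ M (σ^[l] y) := by
  have h : ∀ x, σ^[l] x = iter σ l x := fun x => (iter_apply σ l x).symm
  rw [h, transfer_apply, transfer_apply, map_sum]
  refine Finset.sum_congr rfl fun i _ => ?_
  rw [iter_apply, ← Function.iterate_add_apply, ← Function.iterate_add_apply, add_comm]

/-- The sum is cyclic once `σ^M` fixes `y`. Hence the elements `y - σ y` lie in the kernel of the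
transfer. -/
theorem transfer_fixed (σ : P →+ P) {M : ℕ} (y : P) (h : σ^[M] y = y) :
    transfer σ M (σ y) = transfer σ M y := by
  have h1 := Finset.sum_range_succ (fun l => σ^[l] y) M
  rw [Finset.sum_range_succ', h] at h1
  rw [transfer_apply, transfer_apply]
  exact add_right_cancel h1

theorem map_transfer {Q : Type*} [AddCommGroup Q] (σ : P →+ P) (σ' : Q →+ Q) (f : P →+ Q)
    (h : ∀ x, f (σ x) = σ' (f x)) (M : ℕ) (y : P) :
    f (transfer σ M y) = transfer σ' M (f y) := by
  rw [transfer_apply, transfer_apply, map_sum]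
  refine Finset.sum_congr rfl fun l _ => ?_
  exact Function.Semiconj.iterate_right (f := f) (ga := σ) (gb := σ') h l y

open Function in
/-- A sum over a finite set with a cyclic action of an equivariant function, each of whose values is
divisible by the order of the stabilizer, is a transfer from the trivial group. -/
theorem exists_sum_eq_transfer {E : Type*} [DecidableEq E] (σ : P →+ P) (τ : E → E) {M : ℕ}
    (hM : 0 < M) (hτ : ∀ e, τ^[M] e = e) (F : E → P) (s : Finset E) (hs : ∀ e ∈ s, τ e ∈ s)
    (hF : ∀ e ∈ s, F (τ e) = σ (F e))
    (hz : ∀ e ∈ s, ∃ z, σ^[minimalPeriod τ e] z = z ∧ F e = (M / minimalPeriod τ e) • z) :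
    ∃ y, ∑ e ∈ s, F e = transfer σ M y := by
  induction s using Finset.strongInduction with
  | H s ih =>
  rcases s.eq_empty_or_nonempty with rfl | ⟨e, he⟩
  · exact ⟨0, by simp⟩
  set d := minimalPeriod τ e with hd
  have hdM : d ∣ M := (show IsPeriodicPt τ M e from hτ e).minimalPeriod_dvd
  have hd0 : 0 < d := Nat.pos_of_dvd_of_pos hdM hM
  -- The orbit of `e` is split off, and the rest is treated by induction.
  set O := (Finset.range d).image (fun l => τ^[l] e) with hO
  have hOmem : ∀ l, τ^[l] e ∈ O := fun l => by
    refine Finset.mem_image.2 ⟨l % d, Finset.mem_range.2 (Nat.mod_lt _ hd0), ?_⟩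
    exact iterate_mod_minimalPeriod_eq
  have hOs : O ⊆ s := by
    intro x hx
    obtain ⟨l, -, rfl⟩ := Finset.mem_image.1 hx
    clear hx
    induction l with
    | zero => exact he
    | succ l ih => rw [iterate_succ_apply']; exact hs _ ih
  have hmaps : ∀ l, F (τ^[l] e) = σ^[l] (F e) := by
    intro l
    induction l with
    | zero => rfl
    | succ l ih =>
      rw [iterate_succ_apply', iterate_succ_apply', hF _ (hOs (hOmem l)), ih]
  obtain ⟨y, hy⟩ := ih (s \ O)
    (Finset.sdiff_ssubset hOs ⟨e, hOmem 0⟩)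
    (fun x hx => by
      rw [Finset.mem_sdiff] at hx ⊢
      refine ⟨hs x hx.1, fun h => hx.2 ?_⟩
      obtain ⟨l, -, hl⟩ := Finset.mem_image.1 h
      -- `τ^(M-1)` inverts `τ`, so a point whose image lies in the orbit lies in the orbit itself.
      have : x = τ^[M - 1 + l] e := by
        rw [iterate_add_apply, hl, ← iterate_succ_apply, Nat.succ_eq_add_one,
          Nat.sub_add_cancel hM, hτ]
      rw [this]
      exact hOmem _)
    (fun x hx => hF x (Finset.sdiff_subset hx)) (fun x hx => hz x (Finset.sdiff_subset hx))
  obtain ⟨z, hz1, hz2⟩ := hz e he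
  refine ⟨y + z, ?_⟩
  rw [← Finset.sum_sdiff hOs, hy, map_add]
  congr 1
  rw [hO, Finset.sum_image (fun a ha b hb hab => by
    have ha' : a < d := by simpa using ha
    have hb' : b < d := by simpa using hb
    exact (iterate_injOn_Iio_minimalPeriod (f := τ) (x := e)) ha' hb' hab)]
  -- The orbit contributes the sum of `σ^l (F e)` over `l < d`. As `F e` is `M / d` times the
  -- `σ^d`-fixed `z`, this is the full transfer of `z`.
  rw [Finset.sum_congr rfl fun l _ => hmaps l, ← transfer_apply, hz2, ← hd,
    ← transfer_mul_of_fixed σ hz1, Nat.mul_div_cancel' hdM]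

end Transfer

/-! ### Periodic functions on `Fin M` -/

section Periodic

variable {T : Type*}

/-- Rotation of the entries of a tuple. -/
def shift (M : ℕ) (T : Type*) : (Fin M → T) ≃ (Fin M → T) :=
  (finRotate M).arrowCongr (Equiv.refl T)

theorem shift_apply {M : ℕ} (f : Fin M → T) (i : Fin M) :
    shift M T f i = f ((finRotate M).symm i) := rfl

/-- The periodic extension of a tuple. -/
def rep {k : ℕ} (hk : 0 < k) (K : ℕ) (m : Fin k → T) : Fin K → T :=
  fun c => m ⟨c % k, Nat.mod_lt _ hk⟩

theorem finRotate_mod {M : ℕ} (hM : 0 < M) (n : ℕ) :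
    finRotate M ⟨n % M, Nat.mod_lt _ hM⟩ = ⟨(n + 1) % M, Nat.mod_lt _ hM⟩ := by
  obtain ⟨M, rfl⟩ := Nat.exists_eq_succ_of_ne_zero hM.ne'
  ext
  rw [finRotate_apply, Fin.val_add]
  simp

/-- Indices are written as residues modulo `M`, so that the wraparound of the rotation needs no case
distinction. -/
theorem shift_iterate_mod {M : ℕ} (hM : 0 < M) (f : Fin M → T) (l n : ℕ) :
    (shift M T)^[l] f ⟨(n + l) % M, Nat.mod_lt _ hM⟩ = f ⟨n % M, Nat.mod_lt _ hM⟩ := by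
  induction l with
  | zero => rfl
  | succ l ih =>
    rw [Function.iterate_succ_apply', shift_apply, ← add_assoc, ← finRotate_mod hM,
      Equiv.symm_apply_apply, ih]

theorem tuple_ext_mod {M : ℕ} (hM : 0 < M) {f g : Fin M → T} (a : ℕ)
    (h : ∀ n, f ⟨(n + a) % M, Nat.mod_lt _ hM⟩ = g ⟨(n + a) % M, Nat.mod_lt _ hM⟩) : f = g := by
  funext ⟨i, hi⟩
  -- Adding `M - a % M` cancels `a` modulo `M`.
  have := h (i + (M - a % M))
  have e : (i + (M - a % M) + a) % M = i := by
    have h1 := Nat.mod_add_div a M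
    have h2 := (Nat.mod_lt a hM).le
    have : i + (M - a % M) + a = i + M * (a / M + 1) := by
      rw [mul_add]; omega
    rw [this, Nat.add_mul_mod_self_left, Nat.mod_eq_of_lt hi]
  simp only [e] at this
  exact this

theorem shift_iterate_self {M : ℕ} (hM : 0 < M) (f : Fin M → T) : (shift M T)^[M] f = f := by
  refine tuple_ext_mod hM M fun n => ?_
  rw [shift_iterate_mod hM]
  simp

theorem periodic_of_shift {M : ℕ} (hM : 0 < M) {f : Fin M → T} {d : ℕ}
    (h : (shift M T)^[d] f = f) (n : ℕ) :
    f ⟨(n + d) % M, Nat.mod_lt _ hM⟩ = f ⟨n % M, Nat.mod_lt _ hM⟩ := by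
  rw [← shift_iterate_mod hM f d n, h]

theorem shift_rep {k K : ℕ} (hk : 0 < k) (h : k ∣ K) (m : Fin k → T) :
    shift K T (rep hk K m) = rep hk K (shift k T m) := by
  rcases K.eq_zero_or_pos with rfl | hK
  · funext i; exact i.elim0
  refine tuple_ext_mod hK 1 fun n => ?_
  rw [← Function.iterate_one (shift K T), shift_iterate_mod hK]
  simp only [rep]
  have e1 : n % K % k = n % k := Nat.mod_mod_of_dvd _ h
  have e2 : (n + 1) % K % k = (n + 1) % k := Nat.mod_mod_of_dvd _ h
  simp only [e1, e2]
  exact (shift_iterate_mod hk m 1 n).symm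

theorem eq_rep_of_shift {k K : ℕ} (hk : 0 < k) (hK : 0 < K) {f : Fin K → T} (hkK : k ≤ K)
    (h : (shift K T)^[k] f = f) : f = rep hk K (fun i => f (Fin.castLE hkK i)) := by
  funext ⟨i, hi⟩
  have key : ∀ e j, f ⟨(j + k * e) % K, Nat.mod_lt _ hK⟩ = f ⟨j % K, Nat.mod_lt _ hK⟩ := by
    intro e j
    induction e with
    | zero => rfl
    | succ e ih => rw [Nat.mul_succ, ← add_assoc, periodic_of_shift hK h, ih]
  have := key (i / k) (i % k)
  have e1 : (i % k + k * (i / k)) % K = i := by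
    rw [Nat.mod_add_div, Nat.mod_eq_of_lt hi]
  have e2 : i % k % K = i % k := Nat.mod_eq_of_lt (lt_of_lt_of_le (Nat.mod_lt _ hk) hkK)
  simp only [e1, e2] at this
  exact this

theorem rep_injective {k K : ℕ} (hk : 0 < k) (hkK : k ≤ K) :
    Function.Injective (rep (T := T) hk K) := by
  intro a b h
  funext i
  have := congrFun h (Fin.castLE hkK i)
  simpa [rep, Nat.mod_eq_of_lt i.2] using this

theorem rep_mul {k K L : ℕ} (hk : 0 < k) (hK : 0 < K) (h : k ∣ K) (m : Fin k → T) :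
    rep hK L (rep hk K m) = rep hk L m := by
  funext c
  simp only [rep]
  congr 2
  exact Nat.mod_mod_of_dvd _ h

theorem prod_range_mul_of_periodic {R : Type*} [CommMonoid R] (h : ℕ → R) (d : ℕ)
    (hd : ∀ n, h (n + d) = h n) (e : ℕ) :
    ∏ n ∈ Finset.range (d * e), h n = (∏ n ∈ Finset.range d, h n) ^ e := by
  induction e with
  | zero => simp
  | succ e ih =>
    rw [Nat.mul_succ, Finset.prod_range_add, ih, pow_succ]
    congr 1
    refine Finset.prod_congr rfl fun x _ => ?_
    have : ∀ e, h (x + d * e) = h x := by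
      intro e
      induction e with
      | zero => rfl
      | succ e ih => rw [Nat.mul_succ, ← add_assoc, hd, ih]
    rw [add_comm, this]

theorem prod_rep {R : Type*} [CommMonoid R] {k : ℕ} (hk : 0 < k) (e : ℕ) (m : Fin k → R) :
    ∏ c : Fin (k * e), rep hk (k * e) m c = (∏ i, m i) ^ e := by
  have h1 : ∀ (K : ℕ), ∏ c : Fin K, rep hk K m c =
      ∏ n ∈ Finset.range K, m ⟨n % k, Nat.mod_lt _ hk⟩ := fun K =>
    (Finset.prod_range fun n => m ⟨n % k, Nat.mod_lt _ hk⟩).symm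
  rw [h1, prod_range_mul_of_periodic _ k (fun n => by simp), ← h1]
  congr 1
  refine Finset.prod_congr rfl fun i _ => ?_
  simp [rep, Nat.mod_eq_of_lt i.2]

/-- Fermat's congruence `C ^ p ≡ C` modulo `p` gains one factor `p` with each further `p`-th power.
-/
theorem dvd_pow_prime_sub (p : ℕ) [Fact p.Prime] (C : ℤ) (s : ℕ) :
    ((p ^ (s + 1) : ℕ) : ℤ) ∣ C ^ p ^ (s + 1) - C ^ p ^ s := by
  have h : (p : ℤ) ∣ C ^ p - C := by
    rw [← ZMod.intCast_zmod_eq_zero_iff_dvd]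
    push_cast
    rw [ZMod.pow_card, sub_self]
  have := dvd_sub_pow_of_dvd_sub h s
  have e : C ^ p ^ (s + 1) = (C ^ p) ^ p ^ s := by rw [pow_succ' p s, pow_mul]
  rw [e]
  exact_mod_cast this

end Periodic

/-! ### Powers of sums modulo transfers -/

section Power

variable {P : Type*} [AddCommGroup P] (p : ℕ) [hp : Fact p.Prime]

theorem dvd_of_dvd_prime_pow_of_ne {d m : ℕ} (h : d ∣ p ^ (m + 1)) (hd : d ≠ p ^ (m + 1)) :
    d ∣ p ^ m := by
  obtain ⟨b, hb, rfl⟩ := (Nat.dvd_prime_pow hp.out).1 h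
  refine pow_dvd_pow _ ?_
  rcases hb.lt_or_eq with hb | rfl
  · omega
  · exact absurd rfl hd

open Function in
/-- The congruence `x^{⊗ p^{m+1}} ≡ ψ(x^{⊗ p^m})` modulo transfers, for an expanded sum `x`. -/
theorem exists_transfer_eq_power_sub {T : Type*} [Fintype T] [DecidableEq T] (σ : P →+ P) (m : ℕ)
    (c : T → ℤ) (I : (Fin (p ^ (m + 1)) → T) → P) (hI : ∀ f, I (shift _ T f) = σ (I f)) :
    ∃ y, ∑ f : Fin (p ^ (m + 1)) → T, (∏ a, c (f a)) • I f -
      ∑ g : Fin (p ^ m) → T, (∏ a, c (g a)) • I (rep (pow_pos hp.out.pos m) _ g) =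
        transfer σ (p ^ (m + 1)) y := by
  have hk : 0 < p ^ m := pow_pos hp.out.pos m
  have hK : 0 < p ^ (m + 1) := pow_pos hp.out.pos (m + 1)
  have hkK : p ^ m ∣ p ^ (m + 1) := pow_dvd_pow _ (Nat.le_succ m)
  have hle : p ^ m ≤ p ^ (m + 1) := Nat.le_of_dvd hK hkK
  have hlt : p ^ m < p ^ (m + 1) := Nat.pow_lt_pow_right hp.out.one_lt (Nat.lt_succ_self m)
  -- `D f` is the total coefficient with which the second sum contributes to `I f`. With it the
  -- difference becomes a single sum over all `f`.
  let D : (Fin (p ^ (m + 1)) → T) → ℤ := fun f =>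
    ∑ g with rep hk (p ^ (m + 1)) g = f, ∏ a, c (g a)
  have hsum : ∑ f : Fin (p ^ (m + 1)) → T, (∏ a, c (f a)) • I f -
      ∑ g : Fin (p ^ m) → T, (∏ a, c (g a)) • I (rep hk _ g) =
      ∑ f : Fin (p ^ (m + 1)) → T, (∏ a, c (f a) - D f) • I f := by
    simp only [sub_smul, Finset.sum_sub_distrib]
    congr 1
    rw [← Finset.sum_fiberwise (s := Finset.univ) (g := rep (T := T) hk (p ^ (m + 1)))]
    refine Finset.sum_congr rfl fun f _ => ?_
    simp only [D]
    rw [Finset.sum_smul]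
    refine Finset.sum_congr rfl fun g hg => ?_
    rw [(Finset.mem_filter.1 hg).2]
  rw [hsum]
  have hprod : ∀ {M : ℕ} (f : Fin M → T), ∏ a, c (shift M T f a) = ∏ a, c (f a) := fun {M} f =>
    Equiv.prod_comp (finRotate M).symm fun a => c (f a)
  have hD : ∀ f, D (shift _ T f) = D f := by
    intro f
    refine (Finset.sum_equiv (shift (p ^ m) T) (fun g => ?_) fun g _ => (hprod g).symm).symm
    simp only [Finset.mem_filter, Finset.mem_univ, true_and]
    rw [← shift_rep hk hkK, (shift _ T).injective.eq_iff]
  have hIl : ∀ l f, I ((shift _ T)^[l] f) = σ^[l] (I f) := fun l f =>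
    Function.Semiconj.iterate_right (f := I) (ga := shift _ T) (gb := σ) hI l f
  refine exists_sum_eq_transfer σ (shift _ T) hK (shift_iterate_self hK)
    (fun f => (∏ a, c (f a) - D f) • I f) Finset.univ (fun _ _ => Finset.mem_univ _)
    (fun f _ => ?_) fun f _ => ?_
  · rw [hI, map_zsmul, hprod, hD]
  · set d := minimalPeriod (shift _ T) f with hd
    have hdf : (shift _ T)^[d] f = f := iterate_minimalPeriod
    have hdM : d ∣ p ^ (m + 1) :=
      (show IsPeriodicPt (shift _ T) _ f from shift_iterate_self hK f).minimalPeriod_dvd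
    have hzσ : ∀ a : ℤ, σ^[d] (a • I f) = a • I f := fun a => by
      rw [← iter_apply, map_zsmul, iter_apply, ← hIl, hdf]
    -- A tuple of full period has a trivial stabilizer, so its coefficient may be arbitrary.
    by_cases hdeq : d = p ^ (m + 1)
    · refine ⟨(∏ a, c (f a) - D f) • I f, hzσ _, ?_⟩
      rw [hdeq, Nat.div_self hK, one_smul]
    -- Otherwise `d` divides `p ^ m`, so `f` repeats a tuple `θ` of length `d` and is the repetition
    -- of exactly one `g`. With `C = ∏ c (θ i)` the coefficient is `C ^ p ^ (s+1) - C ^ p ^ s`,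
    -- which is divisible by the order `p ^ (s+1)` of the stabilizer.
    · have hdk := dvd_of_dvd_prime_pow_of_ne p hdM hdeq
      have hd0 : 0 < d := Nat.pos_of_dvd_of_pos hdM hK
      set θ : Fin d → T := fun i => f (Fin.castLE (Nat.le_of_dvd hK hdM) i) with hθ
      have hf : f = rep hd0 _ θ := eq_rep_of_shift hd0 hK (Nat.le_of_dvd hK hdM) hdf
      set g : Fin (p ^ m) → T := rep hd0 _ θ with hg
      have hfg : rep hk (p ^ (m + 1)) g = f := by
        rw [hg, rep_mul hd0 hk hdk, ← hf]
      have hDf : D f = ∏ a, c (g a) := by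
        simp only [D]
        rw [Finset.sum_eq_single_of_mem g (by simp [hfg])]
        intro b hb hbg
        exact absurd (rep_injective hk hle (((Finset.mem_filter.1 hb).2).trans hfg.symm)) hbg
      obtain ⟨b, hb, hdb⟩ := (Nat.dvd_prime_pow hp.out).1 hdk
      obtain ⟨s, rfl⟩ := Nat.exists_eq_add_of_le hb
      have hprodrep : ∀ K e, K = d * e → ∏ a, c (rep hd0 K θ a) = (∏ i, c (θ i)) ^ e := by
        rintro _ e rfl
        exact prod_rep hd0 e fun i => c (θ i)
      have e1 : p ^ (b + s + 1) = d * p ^ (s + 1) := by rw [hdb, ← pow_add, add_assoc]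
      have e2 : p ^ (b + s) = d * p ^ s := by rw [hdb, ← pow_add]
      obtain ⟨q, hq⟩ := dvd_pow_prime_sub p (∏ i, c (θ i)) s
      refine ⟨q • I f, hzσ q, ?_⟩
      have hc : ∏ a, c (f a) - D f = ((p ^ (s + 1) : ℕ) : ℤ) * q := by
        rw [← hq, hDf, hg, hprodrep _ _ e2]
        congr 1
        conv_lhs => rw [hf]
        exact hprodrep _ _ e1
      rw [hc, e1, Nat.mul_div_cancel_left _ hd0, mul_smul, natCast_zsmul]

end Power

/-! ### Norms of sums -/

section Norm

/-- Rotation of the entries of a tuple, the last entry being twisted by `π`. -/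
def twist {I : Type*} (π : I → I) {q : ℕ} (s : Fin (q + 1) → I) : Fin (q + 1) → I :=
  Fin.cons (π (s (Fin.last q))) (fun l : Fin q => s l.castSucc)

/-- After `m ≤ q + 1` steps the last `m` entries have come to the front, and each of them has passed
the seam, and thus `π`, exactly once. -/
theorem twist_iterate {I : Type*} (π : I → I) {q : ℕ} (s : Fin (q + 1) → I) (m : ℕ)
    (hm : m ≤ q + 1) (l : Fin (q + 1)) : (twist π)^[m] s l =
      if h : (l : ℕ) < m then π (s ⟨l + (q + 1) - m, by omega⟩) else s ⟨l - m, by omega⟩ := by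
  induction m generalizing l with
  | zero => simp
  | succ m ih =>
    rw [Function.iterate_succ_apply', twist]
    induction l using Fin.cases with
    | zero =>
      rw [Fin.cons_zero, ih (by omega), dif_neg (by simp; omega), dif_pos (by simp)]
      congr 2
      ext
      simp
    | succ l =>
      rw [Fin.cons_succ, ih (by omega)]
      simp only [Fin.val_castSucc, Fin.val_succ, Nat.succ_lt_succ_iff]
      split_ifs
      · congr 2
        ext
        simp only
        omega
      · congr 1
        ext
        simp only
        omega

theorem twist_iterate_full {I : Type*} (π : I → I) {q : ℕ} (s : Fin (q + 1) → I) :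
    (twist π)^[q + 1] s = fun l => π (s l) := by
  funext l
  rw [twist_iterate π s _ le_rfl, dif_pos l.2]
  congr 2
  ext
  simp

theorem twist_iterate_full_mul {I : Type*} (π : I → I) {q : ℕ} (e : ℕ) (s : Fin (q + 1) → I) :
    (twist π)^[(q + 1) * e] s = fun l => π^[e] (s l) := by
  rw [Function.iterate_mul]
  induction e with
  | zero => rfl
  | succ e ih =>
    rw [Function.iterate_succ_apply', ih, twist_iterate_full]
    funext l
    rw [Function.iterate_succ_apply']

variable {P : Type*} [CommRing P] (σ : P →+ P)

/-- The product `∏_{l < p} σ^l y`. -/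
def normProd (p : ℕ) (y : P) : P := ∏ l ∈ Finset.range p, σ^[l] y

variable {σ} (hmul : ∀ x y, σ (x * y) = σ x * σ y) (hone : σ 1 = 1)
include hmul

theorem iterate_mul_hom (l : ℕ) (x y : P) : σ^[l] (x * y) = σ^[l] x * σ^[l] y := by
  induction l generalizing x y with
  | zero => rfl
  | succ l ih => rw [Function.iterate_succ_apply, hmul, ih]; rfl

theorem normProd_mul (p : ℕ) (x y : P) :
    normProd σ p (x * y) = normProd σ p x * normProd σ p y := by
  rw [normProd, Finset.prod_congr rfl fun l _ => iterate_mul_hom hmul l x y,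
    Finset.prod_mul_distrib]
  rfl

/-- The projection formula: multiples of transfers by invariant elements are transfers. -/
theorem transfer_mul_fixed (M : ℕ) (t : P) {v : P} (hv : σ v = v) :
    transfer σ M t * v = transfer σ M (t * v) := by
  rw [transfer_apply, transfer_apply, Finset.sum_mul]
  refine Finset.sum_congr rfl fun l _ => ?_
  rw [iterate_mul_hom hmul, Function.iterate_fixed hv]

include hone

theorem map_finset_prod_of_mul {ι : Type*} (s : Finset ι) (f : ι → P) :
    σ (∏ i ∈ s, f i) = ∏ i ∈ s, σ (f i) :=
  map_prod (⟨⟨σ, hone⟩, hmul⟩ : P →* P) f s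

theorem normProd_fixed {p : ℕ} {y : P} (hy : σ^[p] y = y) :
    σ (normProd σ p y) = normProd σ p y := by
  rcases p with _ | p
  · simp [normProd, hone]
  rw [normProd, map_finset_prod_of_mul hmul hone, Finset.prod_range_succ, Finset.prod_range_succ']
  congr 1
  · exact Finset.prod_congr rfl fun l _ => (Function.iterate_succ_apply' _ _ _).symm
  · rw [← Function.iterate_succ_apply' (⇑σ), hy]
    rfl

open Function in
/-- Expansion of the norm of a sum whose terms are permuted by the stabilizer: the terms indexed by
tuples with full period add up to a transfer. -/
theorem exists_normProd_sum {I : Type*} [Fintype I] [DecidableEq I] {q h : ℕ}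
    (hh : 0 < h) (Y : I → P) (π : I → I) (hπ : ∀ i, π^[h] i = i)
    (hY : ∀ i, σ^[q + 1] (Y i) = Y (π i)) (hσ : ∀ x : P, σ^[(q + 1) * h] x = x)
    (bad : Finset (Fin (q + 1) → I))
    (hbad : ∀ s, s ∉ bad → minimalPeriod (twist π) s = (q + 1) * h ∧ twist π s ∉ bad) :
    ∃ y, normProd σ (q + 1) (∑ i, Y i) -
      ∑ s ∈ bad, ∏ l : Fin (q + 1), σ^[(l : ℕ)] (Y (s l)) = transfer σ ((q + 1) * h) y := by
  -- On multiplying out, a tuple `s` selects the summand `Y (s l)` in the factor with number `l`.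
  have hexp : normProd σ (q + 1) (∑ i, Y i) =
      ∑ s : Fin (q + 1) → I, ∏ l : Fin (q + 1), σ^[(l : ℕ)] (Y (s l)) := by
    rw [normProd, Finset.prod_range]
    have : ∀ l : Fin (q + 1), σ^[(l : ℕ)] (∑ i, Y i) = ∑ i, σ^[(l : ℕ)] (Y i) := fun l => by
      rw [← iter_apply, map_sum]
      exact Finset.sum_congr rfl fun i _ => iter_apply _ _ _
    rw [Finset.prod_congr rfl fun l _ => this l, Finset.prod_univ_sum, Fintype.piFinset_univ]
  have hsplit : normProd σ (q + 1) (∑ i, Y i) -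
      ∑ s ∈ bad, ∏ l : Fin (q + 1), σ^[(l : ℕ)] (Y (s l)) =
      ∑ s ∈ badᶜ, ∏ l : Fin (q + 1), σ^[(l : ℕ)] (Y (s l)) := by
    rw [hexp, ← Finset.sum_add_sum_compl bad]
    simp
  have hτ : ∀ s : Fin (q + 1) → I, (twist π)^[(q + 1) * h] s = s := fun s => by
    rw [twist_iterate_full_mul]
    funext l
    exact hπ _
  have hM : 0 < (q + 1) * h := Nat.mul_pos q.succ_pos hh
  rw [hsplit]
  refine exists_sum_eq_transfer σ (twist π) hM hτ
    (fun s => ∏ l : Fin (q + 1), σ^[(l : ℕ)] (Y (s l))) badᶜ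
    (fun s hs => ?_) (fun s _ => ?_) fun s hs => ?_
  · rw [Finset.mem_compl] at hs ⊢
    exact (hbad s hs).2
  -- `σ` maps the term of `s` to the term of `twist π s`: the exponents move up by one, and the top
  -- factor `σ^(q+1) (Y i) = Y (π i)` becomes the new first factor.
  · rw [map_finset_prod_of_mul hmul hone, Fin.prod_univ_succ, Fin.prod_univ_castSucc, mul_comm]
    congr 1
    · refine Finset.prod_congr rfl fun l _ => ?_
      rw [twist, Fin.cons_succ, Fin.val_succ, Function.iterate_succ_apply']
      rfl
    · rw [twist, Fin.cons_zero, ← Function.iterate_succ_apply' (⇑σ), Fin.val_last, hY]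
      rfl
  · rw [(hbad s (Finset.mem_compl.1 hs)).1, Nat.div_self hM]
    exact ⟨_, hσ _, (one_smul _ _).symm⟩

/-- The norm is additive modulo transfers. Multiply out over tuples in two letters: since `p` is
prime, every non-constant tuple has `p` distinct rotations. -/
theorem exists_normProd_add {p : ℕ} (hp : p.Prime) (hσ : ∀ x : P, σ^[p] x = x) (x y : P) :
    ∃ t, normProd σ p (x + y) - (normProd σ p x + normProd σ p y) = transfer σ p t := by
  obtain ⟨q, rfl⟩ := Nat.exists_eq_add_one.2 hp.pos
  -- The letter `true` stands for `x` and `false` for `y`. Both are fixed by `σ^p`, so no twist is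
  -- needed.
  have h := exists_normProd_sum hmul hone (I := Bool) (q := q) one_pos (fun b => cond b x y) id
    (fun _ => rfl) (fun _ => hσ _) (fun _ => by rw [mul_one]; exact hσ _)
    {fun _ => true, fun _ => false} (by
      intro s hs
      have hs' : ∀ b : Bool, s ≠ fun _ => b := by
        rintro (_ | _) rfl <;> simp at hs
      have hfull : (twist id)^[q + 1] s = s := twist_iterate_full id s
      have hone : ∀ r : Fin (q + 1) → Bool, twist id r = r → ∃ b, r = fun _ => b := by
        intro r hr
        refine ⟨r (Fin.last q), funext fun l => ?_⟩
        induction l using Fin.induction with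
        | zero => conv_lhs => rw [← hr]
                  rfl
        | succ l ih =>
          conv_lhs => rw [← hr]
          exact ih
      constructor
      · rw [mul_one]
        rcases hp.eq_one_or_self_of_dvd _
          (show Function.IsPeriodicPt (twist id) (q + 1) s from hfull).minimalPeriod_dvd with h | h
        · obtain ⟨b, hb⟩ := hone s (Function.minimalPeriod_eq_one_iff_isFixedPt.1 h)
          exact absurd hb (hs' b)
        · exact h
      · intro hmem
        have : ∃ b, twist id s = fun _ => b := by
          rw [Finset.mem_insert, Finset.mem_singleton] at hmem
          rcases hmem with h | h
          exacts [⟨_, h⟩, ⟨_, h⟩]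
        obtain ⟨b, hb⟩ := this
        -- If the rotated tuple were constant, rotating it the remaining `q` times would show that
        -- `s` is constant.
        have hfix : ∀ l, (twist id)^[l] (twist id s) = twist id s := by
          intro l
          refine Function.iterate_fixed ?_ l
          rw [hb]
          funext i
          induction i using Fin.cases <;> rfl
        have := hfix q
        rw [← Function.iterate_succ_apply, Nat.succ_eq_add_one, hfull] at this
        exact hs' b (this.trans hb))
  obtain ⟨t, ht⟩ := h
  refine ⟨t, ?_⟩
  rw [mul_one] at ht
  rw [← ht, Finset.sum_pair (fun h => by
    have := congrFun h ⟨0, hp.pos⟩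
    simp at this)]
  simp [normProd, Finset.prod_range]

/-- The norm of `x + tr_e^H t` agrees with that of `x` up to transfers from the trivial group, for a
non-trivial subgroup `H` and an `H`-invariant `x`. -/
theorem exists_normProd_add_transfer {p j : ℕ} (hp : p.Prime)
    (hσ : ∀ x : P, σ^[p * p ^ (j + 1)] x = x) (x t : P) (hx : σ^[p] x = x) :
    ∃ u, normProd σ p (x + transfer (iter σ p) (p ^ (j + 1)) t) - normProd σ p x =
      transfer σ (p * p ^ (j + 1)) u := by
  classical
  have hh : 0 < p ^ (j + 1) := pow_pos hp.pos _
  have : NeZero (p ^ (j + 1)) := ⟨hh.ne'⟩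
  -- The summands: `none` stands for `x`, and a residue `i` for the translate `σ^(p i) t`. The
  -- subgroup generated by `σ^p` fixes the former and shifts the residues, which is `π`.
  let Y : Option (ZMod (p ^ (j + 1))) → P := fun o => o.elim x fun i => σ^[p * i.val] t
  let π : Option (ZMod (p ^ (j + 1))) → Option (ZMod (p ^ (j + 1))) := Option.map (· + 1)
  have hπl : ∀ l o, π^[l] o = Option.map (· + (l : ZMod (p ^ (j + 1)))) o := by
    intro l o
    induction l with
    | zero => cases o <;> simp
    | succ l ih =>
      rw [Function.iterate_succ_apply', ih]
      cases o
      · rfl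
      · simp [π, add_assoc]
  have hsum : x + transfer (iter σ p) (p ^ (j + 1)) t = ∑ o, Y o := by
    rw [Fintype.sum_option, transfer_apply]
    congr 1
    rw [Finset.sum_congr rfl fun l _ => iter_iterate σ p l t]
    refine (Finset.sum_bij (fun (i : ZMod (p ^ (j + 1))) _ => i.val)
      (fun i _ => Finset.mem_range.2 (ZMod.val_lt i))
      (fun a _ b _ h => ZMod.val_injective _ h)
      (fun b hb => ⟨(b : ZMod (p ^ (j + 1))), Finset.mem_univ _,
        ZMod.val_cast_of_lt (Finset.mem_range.1 hb)⟩) fun i _ => rfl).symm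
  obtain ⟨q, rfl⟩ := Nat.exists_eq_add_one.2 hp.pos
  have h := exists_normProd_sum hmul hone (q := q) hh Y π
    (fun o => by rw [hπl]; cases o <;> simp)
    (fun o => by
      cases o with
      | none => exact hx
      | some i =>
        -- Since `σ^(p * p^(j+1))` is the identity, the exponent matters only modulo `p ^ (j+1)`.
        have hmod : ∀ n, σ^[(q + 1) * n] t = σ^[(q + 1) * (n % (q + 1) ^ (j + 1))] t := by
          intro n
          conv_lhs => rw [← Nat.mod_add_div n ((q + 1) ^ (j + 1)), mul_add,
            Function.iterate_add_apply, ← mul_assoc, iterate_mul_eq_self (hσ t)]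
        change σ^[q + 1] (σ^[(q + 1) * i.val] t) = σ^[(q + 1) * (i + 1).val] t
        rw [← Function.iterate_add_apply, ZMod.val_add, ZMod.val_one_eq_one_mod, Nat.add_mod_mod,
          ← hmod, add_comm, Nat.mul_succ]) hσ {fun _ => none} (by
      intro s hs
      have hs' : ∃ l i, s l = some i := by
        by_contra hcon
        refine hs (Finset.mem_singleton.2 (funext fun l => ?_))
        cases hsl : s l with
        | none => rfl
        | some i => exact absurd ⟨l, i, hsl⟩ hcon
      have hfull : (twist π)^[(q + 1) * (q + 1) ^ (j + 1)] s = s := by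
        rw [twist_iterate_full_mul]
        funext l
        rw [hπl]
        cases s l <;> simp
      constructor
      -- A smaller period would divide `p * p ^ j`. That many rotations shift an entry `some i` by
      -- `p ^ j`, which is not zero modulo `p ^ (j+1)`.
      · by_contra hne
        have : Fact (q + 1).Prime := ⟨hp⟩
        have hdvd := (show Function.IsPeriodicPt (twist π) _ s from hfull).minimalPeriod_dvd
        rw [← pow_succ'] at hdvd hne
        have h2 := dvd_of_dvd_prime_pow_of_ne (q + 1) hdvd hne
        have h3 : (twist π)^[(q + 1) * (q + 1) ^ j] s = s := by
          rw [← pow_succ']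
          exact Function.isPeriodicPt_iff_minimalPeriod_dvd.2 h2
        rw [twist_iterate_full_mul] at h3
        obtain ⟨l, i, hli⟩ := hs'
        have h4 := congrFun h3 l
        simp only [hπl, hli, Option.map_some, Option.some.injEq, add_eq_left] at h4
        rw [ZMod.natCast_eq_zero_iff] at h4
        have := Nat.le_of_dvd (pow_pos hp.pos _) h4
        exact absurd this (not_le.2 (Nat.pow_lt_pow_right hp.one_lt (Nat.lt_succ_self j)))
      · obtain ⟨l, i, hli⟩ := hs'
        intro hmem
        have hmem := Finset.mem_singleton.1 hmem
        change twist π s = fun _ => none at hmem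
        have h5 : ∀ l, (twist π)^[l] (twist π s) = twist π s := by
          refine Function.iterate_fixed ?_
          rw [hmem]
          funext i
          induction i using Fin.cases <;> rfl
        have h6 := h5 ((q + 1) * (q + 1) ^ (j + 1) - 1)
        rw [← Function.iterate_succ_apply, Nat.succ_eq_add_one,
          Nat.sub_add_cancel (Nat.mul_pos hp.pos hh), hfull, hmem] at h6
        rw [h6] at hli
        simp at hli)
  obtain ⟨u, hu⟩ := h
  refine ⟨u, ?_⟩
  rw [hsum, ← hu, Finset.sum_singleton]
  simp [normProd, Finset.prod_range, Y]

end Norm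

/-! ### The kernel of the transfer on a permutation module -/

/-- The vanishing of Tate cohomology in degree `-1` for permutation modules. Modulo elements `e - σ
e` every vector can be moved to chosen representatives `ρ γ` of the orbits in the basis. At a
representative the transfer multiplies the coefficient by the order of the stabilizer, which can be
cancelled in a torsion-free ring. -/
theorem exists_sub_of_transfer_eq_zero {R P Γ : Type*} [CommRing R] [AddCommGroup P] [Module R P]
    [IsAddTorsionFree R] (b : Module.Basis Γ R P) (σ : P →+ P) (τ : Γ → Γ) {M : ℕ} (hM : 0 < M)
    (hσ : ∀ (r : R) γ, σ (r • b γ) = r • b (τ γ)) (hτ : ∀ γ, τ^[M] γ = γ) (v : P)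
    (hv : transfer σ M v = 0) : ∃ e, v = e - σ e := by
  classical
  have hσl : ∀ l (r : R) γ, σ^[l] (r • b γ) = r • b (τ^[l] γ) := by
    intro l r γ
    induction l with
    | zero => rfl
    | succ l ih => rw [Function.iterate_succ_apply', ih, hσ, Function.iterate_succ_apply']
  let S : Setoid Γ :=
    { r := fun x y => ∃ l, τ^[l] x = y
      iseqv := ⟨fun x => ⟨0, rfl⟩, by
        rintro x _ ⟨l, rfl⟩
        -- A natural number congruent to `-l` modulo `M`.
        refine ⟨M * l - l, ?_⟩
        rw [← Function.iterate_add_apply, Nat.sub_add_cancel (Nat.le_mul_of_pos_left l hM)]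
        exact iterate_mul_eq_self (hτ x) l, by
        rintro x _ _ ⟨l, rfl⟩ ⟨m, rfl⟩
        exact ⟨m + l, Function.iterate_add_apply _ _ _ _⟩⟩ }
  let ρ : Γ → Γ := fun γ => (Quotient.mk S γ).out
  have hρ : ∀ γ, ∃ l, τ^[l] (ρ γ) = γ := fun γ => Quotient.exact (Quotient.out_eq (Quotient.mk S γ))
  have hρl : ∀ γ l, ρ (τ^[l] γ) = ρ γ := fun γ l =>
    congrArg Quotient.out (Quotient.sound (s := S) ⟨l, rfl⟩ : Quotient.mk S γ = _).symm
  let Q : P →ₗ[R] P := b.constr R fun γ => b (ρ γ)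
  have hQb : ∀ γ, Q (b γ) = b (ρ γ) := fun γ => b.constr_basis R _ _
  have hspan : ∀ (C : P → Prop), C 0 → (∀ x y, C x → C y → C (x + y)) →
      (∀ (r : R) γ, C (r • b γ)) → ∀ x, C x := by
    intro C h0 hadd hb x
    rw [← b.linearCombination_repr x]
    induction b.repr x using Finsupp.induction_linear with
    | zero => simpa using h0
    | add f g hf hg => rw [map_add]; exact hadd _ _ hf hg
    | single γ r => rw [Finsupp.linearCombination_single]; exact hb r γ
  have hdiff : ∀ x, ∃ e, x - Q x = e - σ e := by
    refine hspan _ ⟨0, by simp⟩ ?_ ?_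
    · rintro x y ⟨e, he⟩ ⟨f, hf⟩
      refine ⟨e + f, ?_⟩
      rw [map_add, map_add, add_sub_add_comm, he, hf, add_sub_add_comm]
    · intro r γ
      obtain ⟨l, hl⟩ := hρ γ
      -- The sum telescopes along the orbit from `ρ γ` to `γ`.
      refine ⟨-∑ i ∈ Finset.range l, σ^[i] (r • b (ρ γ)), ?_⟩
      rw [map_smul, hQb, map_neg, map_sum, neg_sub_neg, ← Finset.sum_sub_distrib,
        Finset.sum_congr rfl fun i _ => by rw [← Function.iterate_succ_apply' (⇑σ)],
        Finset.sum_range_sub (fun i => σ^[i] (r • b (ρ γ))), hσl, hl]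
      rfl
  have hQ0 : Q v = 0 := by
    obtain ⟨e, he⟩ := hdiff v
    have h1 : transfer σ M (Q v) = 0 := by
      have : Q v = v - (e - σ e) := by rw [← he]; abel
      have hσM : ∀ x, σ^[M] x = x := by
        intro x
        rw [← iter_apply]
        refine hspan (fun x => iter σ M x = x) (map_zero _) (fun x y hx hy => ?_) (fun r γ => ?_) x
        · rw [map_add, hx, hy]
        · rw [iter_apply, hσl, hτ]
      rw [this, map_sub, map_sub, transfer_fixed σ e (hσM e), hv]
      simp
    -- Only the `l` with `τ^l (ρ γ) = ρ γ` contribute at a representative. Their number is positive,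
    -- as `l = 0` is one of them.
    have h2 : ∀ x γ, b.repr (transfer σ M (Q x)) (ρ γ) =
        ((Finset.range M).filter fun l => τ^[l] (ρ γ) = ρ γ).card • b.repr (Q x) (ρ γ) := by
      intro x γ
      revert x
      refine hspan _ (by simp) (fun x y hx hy => ?_) fun r δ => ?_
      · rw [map_add, map_add, map_add, Finsupp.add_apply, hx, hy, map_add, Finsupp.add_apply,
          smul_add]
      · rw [map_smul, hQb, transfer_apply, Finset.sum_congr rfl fun l _ => hσl l r (ρ δ),
          map_sum, Finsupp.finsetSum_apply]
        simp only [map_smul, Module.Basis.repr_self, Finsupp.smul_apply, Finsupp.single_apply]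
        by_cases hδ : ρ δ = ρ γ
        · rw [if_pos hδ, Finset.card_filter, Finset.sum_smul, hδ]
          refine Finset.sum_congr rfl fun l _ => ?_
          split_ifs <;> simp
        · rw [if_neg hδ, smul_zero, smul_zero]
          refine Finset.sum_eq_zero fun l _ => ?_
          rw [if_neg, smul_zero]
          intro h
          apply hδ
          have hρρ : ∀ δ, ρ (ρ δ) = ρ δ := fun δ => by
            obtain ⟨l, hl⟩ := hρ δ
            conv_rhs => rw [← hl]
            rw [hρl]
          rw [← hρρ δ, ← hρl (ρ δ) l, h, hρρ]
    have h3 : ∀ x γ, (∀ δ, γ ≠ ρ δ) → b.repr (Q x) γ = 0 := by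
      intro x γ hγ
      revert x
      refine hspan _ (by simp) (fun x y hx hy => ?_) fun r δ => ?_
      · rw [map_add, map_add, Finsupp.add_apply, hx, hy, add_zero]
      · rw [map_smul, hQb, map_smul, Module.Basis.repr_self, Finsupp.smul_apply,
          Finsupp.single_eq_of_ne (hγ δ), smul_zero]
    refine b.repr.injective (Finsupp.ext fun γ => ?_)
    rw [map_zero, Finsupp.zero_apply]
    by_cases hγ : ∃ δ, γ = ρ δ
    · obtain ⟨δ, rfl⟩ := hγ
      have := h2 v δ
      rw [h1, map_zero, Finsupp.zero_apply] at this
      refine (smul_eq_zero_iff_right ?_).1 this.symm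
      exact (Finset.card_pos.2 ⟨0, by simp [hM]⟩).ne'
    · exact h3 v γ fun δ h => hγ ⟨δ, h⟩
  obtain ⟨e, he⟩ := hdiff v
  exact ⟨e, by rw [← he, hQ0, sub_zero]⟩

/-! ### Elementary tensors -/

/-- Induction on the set of slots whose entries need not lie in `S`: multilinearity releases one
slot after the other. -/
theorem tprod_mem_of_closure_eq_top {R M : Type*} [CommRing R] [AddCommGroup M] [Module R M]
    {S : Set M} (hS : AddSubgroup.closure S = ⊤) {k : ℕ} (H : AddSubgroup (⨂[R] _ : Fin k, M))
    (h : ∀ m : Fin k → M, (∀ i, m i ∈ S) → PiTensorProduct.tprod R m ∈ H) (m : Fin k → M) :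
    PiTensorProduct.tprod R m ∈ H := by
  classical
  suffices key : ∀ (s : Finset (Fin k)) (m : Fin k → M), (∀ i, i ∉ s → m i ∈ S) →
      PiTensorProduct.tprod R m ∈ H from key Finset.univ m fun i hi => absurd (Finset.mem_univ i) hi
  intro s
  induction s using Finset.induction_on with
  | empty => exact fun m hm => h m fun i => hm i (Finset.notMem_empty i)
  | insert c s hc ih =>
    intro m hm
    have key : ∀ y : M, PiTensorProduct.tprod R (Function.update m c y) ∈ H := by
      intro y
      have hy : y ∈ AddSubgroup.closure S := hS ▸ AddSubgroup.mem_top y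
      induction hy using AddSubgroup.closure_induction with
      | mem y hy =>
        refine ih _ fun i hi => ?_
        by_cases hic : i = c
        · subst hic; simpa using hy
        · rw [Function.update_of_ne hic]
          exact hm i (by simp [hic, hi])
      | zero => rw [MultilinearMap.map_update_zero]; exact zero_mem _
      | add a b _ _ ha hb => rw [MultilinearMap.map_update_add]; exact add_mem ha hb
      | neg a _ ha => rw [MultilinearMap.map_update_neg]; exact neg_mem ha
    simpa using key (m c)

/-- An additive subgroup of a non-empty tensor power that contains the elementary tensors with
entries in an additive generating set is everything. -/
theorem mem_of_tprod_mem {R M : Type*} [CommRing R] [AddCommGroup M] [Module R M]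
    {S : Set M} (hS : AddSubgroup.closure S = ⊤) {k : ℕ} (hk : 0 < k)
    (H : AddSubgroup (⨂[R] _ : Fin k, M))
    (h : ∀ m : Fin k → M, (∀ i, m i ∈ S) → PiTensorProduct.tprod R m ∈ H)
    (x : ⨂[R] _ : Fin k, M) : x ∈ H := by
  induction x using PiTensorProduct.induction_on with
  | smul_tprod r m =>
    -- The scalar is absorbed into the first factor, which exists because `0 < k`; so elementary
    -- tensors generate additively.
    have : r • PiTensorProduct.tprod R m =
        PiTensorProduct.tprod R (Function.update m ⟨0, hk⟩ (r • m ⟨0, hk⟩)) := by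
      rw [MultilinearMap.map_update_smul, Function.update_eq_self]
    rw [this]
    exact tprod_mem_of_closure_eq_top hS H h _
  | add x y hx hy => exact add_mem hx hy

theorem addHom_ext_of_tprod {R M G : Type*} [CommRing R] [AddCommGroup M] [Module R M]
    [AddCommGroup G] {S : Set M} (hS : AddSubgroup.closure S = ⊤) {k : ℕ} (hk : 0 < k)
    {f g : (⨂[R] _ : Fin k, M) →+ G}
    (h : ∀ m : Fin k → M, (∀ i, m i ∈ S) →
      f (PiTensorProduct.tprod R m) = g (PiTensorProduct.tprod R m))
    (x : ⨂[R] _ : Fin k, M) : f x = g x :=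
  mem_of_tprod_mem hS hk (AddMonoidHom.eqLocus f g) h x

theorem closure_univ_eq_top {M : Type*} [AddCommGroup M] :
    AddSubgroup.closure (Set.univ : Set M) = ⊤ := by simp

namespace Bimod

variable (B : Bimod.{u})

/-- The class of an elementary tensor in the tensor power. -/
def mkT {k : ℕ} (m : Fin k → B.M) : B.TPow k :=
  QuotientAddGroup.mk (PiTensorProduct.tprod ℤ m)

/-- The class of an elementary tensor in the cyclic tensor power. -/
def mkC {k : ℕ} (m : Fin k → B.M) : B.CycPow k :=
  QuotientAddGroup.mk (PiTensorProduct.tprod ℤ m)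

variable {B}

theorem mem_of_mkT_mem {S : Set B.M} (hS : AddSubgroup.closure S = ⊤) {k : ℕ} (hk : 0 < k)
    (H : AddSubgroup (B.TPow k)) (h : ∀ m : Fin k → B.M, (∀ i, m i ∈ S) → B.mkT m ∈ H)
    (x : B.TPow k) : x ∈ H := by
  induction x using QuotientAddGroup.induction_on with
  | H y => exact mem_of_tprod_mem hS hk (H.comap (QuotientAddGroup.mk' _)) h y

theorem mem_of_mkC_mem {S : Set B.M} (hS : AddSubgroup.closure S = ⊤) {k : ℕ} (hk : 0 < k)
    (H : AddSubgroup (B.CycPow k)) (h : ∀ m : Fin k → B.M, (∀ i, m i ∈ S) → B.mkC m ∈ H)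
    (x : B.CycPow k) : x ∈ H := by
  induction x using QuotientAddGroup.induction_on with
  | H y => exact mem_of_tprod_mem hS hk (H.comap (QuotientAddGroup.mk' _)) h y

theorem tPow_hom_ext {G : Type*} [AddCommGroup G] {S : Set B.M}
    (hS : AddSubgroup.closure S = ⊤) {k : ℕ} (hk : 0 < k) {f g : B.TPow k →+ G}
    (h : ∀ m : Fin k → B.M, (∀ i, m i ∈ S) → f (B.mkT m) = g (B.mkT m)) (x : B.TPow k) :
    f x = g x :=
  mem_of_mkT_mem hS hk (AddMonoidHom.eqLocus f g) h x

theorem cycPow_hom_ext {G : Type*} [AddCommGroup G] {S : Set B.M}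
    (hS : AddSubgroup.closure S = ⊤) {k : ℕ} (hk : 0 < k) {f g : B.CycPow k →+ G}
    (h : ∀ m : Fin k → B.M, (∀ i, m i ∈ S) → f (B.mkC m) = g (B.mkC m)) (x : B.CycPow k) :
    f x = g x :=
  mem_of_mkC_mem hS hk (AddMonoidHom.eqLocus f g) h x

/-- Every tensor is an integral combination of elementary tensors. -/
theorem exists_eq_sum_mkT {S : Set B.M} (hS : AddSubgroup.closure S = ⊤) {k : ℕ} (hk : 0 < k)
    (x : B.TPow k) : ∃ (T : Finset {m : Fin k → B.M // ∀ i, m i ∈ S})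
      (c : {m : Fin k → B.M // ∀ i, m i ∈ S} → ℤ), x = ∑ t : T, c t • B.mkT (t : _).1.1 := by
  have hx : x ∈ Submodule.span ℤ
      (Set.range fun m : {m : Fin k → B.M // ∀ i, m i ∈ S} => B.mkT m.1) := by
    refine mem_of_mkT_mem hS hk (Submodule.span ℤ _).toAddSubgroup (fun m hm => ?_) x
    exact Submodule.subset_span ⟨⟨m, hm⟩, rfl⟩
  obtain ⟨c, rfl⟩ := Finsupp.mem_span_range_iff_exists_finsupp.1 hx
  refine ⟨c.support, c, ?_⟩
  rw [Finsupp.sum, ← Finset.sum_coe_sort]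

theorem linAdj.cycAdj {k : ℕ} {i j : Fin k} (h : linAdj i j) : cycAdj i j := by
  cases k with
  | zero => exact i.elim0
  | succ k =>
    rw [WittCoeff.cycAdj]
    ext
    rw [coe_finRotate_of_ne_last, h]
    rintro rfl
    have := j.2
    rw [linAdj] at h
    simp only [Fin.val_last] at h
    omega

variable (B) in
/-- The projection from the tensor power to the cyclic tensor power. -/
def toCyc (k : ℕ) : B.TPow k →+ B.CycPow k :=
  QuotientAddGroup.map _ _ (AddMonoidHom.id _) (by
    refine (AddSubgroup.closure_le _).2 ?_
    rintro _ ⟨m, r, i, j, hij, rfl⟩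
    exact AddSubgroup.subset_closure ⟨m, r, i, j, linAdj.cycAdj hij, rfl⟩)

theorem toCyc_mkT {k : ℕ} (m : Fin k → B.M) : B.toCyc k (B.mkT m) = B.mkC m := rfl

theorem toCyc_surjective (k : ℕ) : Function.Surjective (B.toCyc k) := by
  intro x
  induction x using QuotientAddGroup.induction_on with
  | H y => exact ⟨QuotientAddGroup.mk y, rfl⟩

theorem Hom.tPow_mkT {C : Bimod.{u}} (φ : Hom B C) {k : ℕ} (m : Fin k → B.M) :
    φ.tPow k (B.mkT m) = C.mkT fun i => φ.map (m i) :=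
  congrArg QuotientAddGroup.mk (φ.intPow_tprod m)

theorem Hom.cycPow_mkC {C : Bimod.{u}} (φ : Hom B C) {k : ℕ} (m : Fin k → B.M) :
    φ.cycPow k (B.mkC m) = C.mkC fun i => φ.map (m i) :=
  congrArg QuotientAddGroup.mk (φ.intPow_tprod m)

theorem Hom.cycPow_toCyc {C : Bimod.{u}} (φ : Hom B C) {k : ℕ} (x : B.TPow k) :
    φ.cycPow k (B.toCyc k x) = C.toCyc k (φ.tPow k x) := by
  induction x using QuotientAddGroup.induction_on with
  | H y => rfl

theorem cycRotate_mkC {k : ℕ} (m : Fin k → B.M) :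
    B.cycRotate k (B.mkC m) = B.mkC (shift k B.M m) :=
  congrArg QuotientAddGroup.mk (rotate_tprod ℤ m)

theorem cycRotate_iterate_mkC {k : ℕ} (l : ℕ) (m : Fin k → B.M) :
    (B.cycRotate k)^[l] (B.mkC m) = B.mkC ((shift k B.M)^[l] m) :=
  (Function.Semiconj.iterate_right (f := B.mkC) (ga := shift k B.M) (gb := B.cycRotate k)
    (fun m => (cycRotate_mkC m).symm) l m).symm

theorem cycRotate_iterate_self {k : ℕ} (hk : 0 < k) (x : B.CycPow k) :
    (B.cycRotate k)^[k] x = x := by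
  rw [← iter_apply]
  refine cycPow_hom_ext (f := iter (B.cycRotate k) k) (g := AddMonoidHom.id _)
    closure_univ_eq_top hk (fun m _ => ?_) x
  rw [iter_apply, cycRotate_iterate_mkC, shift_iterate_self hk]
  rfl

/-! ### Powers of sums -/

/-- The concatenation of `N` tuples of length `k`. -/
def _root_.WittCoeff.interleave {X : Type*} {N k K : ℕ} (hk : 0 < k) (h : N * k = K)
    (g : Fin N → Fin k → X) : Fin K → X := fun c =>
  g ⟨c / k, Nat.div_lt_of_lt_mul (by rw [mul_comm, h]; exact c.2)⟩ ⟨c % k, Nat.mod_lt _ hk⟩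

/-- Rotation by one block length permutes the blocks: `σ^k` acts on words of `N` blocks as the
generator acts on `N` letters. -/
theorem _root_.WittCoeff.shift_iterate_interleave {X : Type*} {N k K : ℕ} (hk : 0 < k)
    (h : N * k = K) (g : Fin N → Fin k → X) :
    (shift K X)^[k] (interleave hk h g) = interleave hk h (shift N _ g) := by
  subst h
  rcases N.eq_zero_or_pos with rfl | hN
  · funext i; exact absurd i.2 (by simp)
  have hK : 0 < N * k := Nat.mul_pos hN hk
  refine tuple_ext_mod hK k fun n => ?_
  rw [shift_iterate_mod hK]
  have e1 : ∀ n, n % (N * k) / k = n / k % N := fun n => by rw [Nat.mod_mul_left_div_self]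
  have e2 : ∀ n, n % (N * k) % k = n % k := fun n => Nat.mod_mod_of_dvd _ (Dvd.intro_left N rfl)
  simp only [interleave, e1, e2, Nat.add_div_right n hk, Nat.add_mod_right]
  rw [← Function.iterate_one (shift N (Fin k → X)), shift_iterate_mod hN]

theorem _root_.WittCoeff.interleave_rep {X : Type*} {N N' k K K' : ℕ} (hk : 0 < k) (hN : 0 < N)
    (hK : 0 < K) (h : N * k = K) (h' : N' * k = K') (g : Fin N → Fin k → X) :
    interleave hk h' (rep hN N' g) = rep hK K' (interleave hk h g) := by
  subst h
  funext c
  simp only [interleave, rep]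
  have e1 : (c : ℕ) % (N * k) / k = c / k % N := by rw [Nat.mod_mul_left_div_self]
  have e2 : (c : ℕ) % (N * k) % k = c % k := Nat.mod_mod_of_dvd _ (Dvd.intro_left N rfl)
  simp only [e1, e2]

/-- The power is not additive. Expanded over words `f` in the summands, it becomes a sum whose words
are permuted by rotation, the form in which `exists_transfer_eq_power_sub` applies. -/
theorem power_sum {N k K : ℕ} (hk : 0 < k) (h : N * k = K) {T : Type*} [Fintype T]
    (c : T → ℤ) (m : T → Fin k → B.M) :
    B.power h (∑ t, c t • B.mkT (m t)) =
      ∑ f : Fin N → T, (∏ a, c (f a)) • B.mkC (interleave hk h fun a => m (f a)) := by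
  subst h
  have e1 : ∑ t, c t • B.mkT (m t) =
      (QuotientAddGroup.mk (∑ t, c t • PiTensorProduct.tprod ℤ (m t)) : B.TPow k) := by
    change _ = QuotientAddGroup.mk' _ _
    rw [map_sum]
    refine Finset.sum_congr rfl fun t _ => ?_
    rw [map_zsmul]
    rfl
  classical
  rw [e1]
  change (QuotientAddGroup.mk (concat ℤ B.M N k fun _ =>
    ∑ t, c t • PiTensorProduct.tprod ℤ (m t)) : B.CycPow (N * k)) = _
  rw [MultilinearMap.map_sum]
  change QuotientAddGroup.mk' _ _ = _
  rw [map_sum]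
  refine Finset.sum_congr rfl fun f _ => ?_
  rw [MultilinearMap.map_smul_univ, concat_tprod, map_zsmul]
  rfl

theorem power_mkT {N k K : ℕ} (hk : 0 < k) (h : N * k = K) (m : Fin k → B.M) :
    B.power h (B.mkT m) = B.mkC (interleave hk h fun _ => m) := by
  have := power_sum (B := B) hk h (T := Unit) (fun _ => 1) fun _ => m
  simpa using this

theorem power_one {k : ℕ} (hk : 0 < k) (h : 1 * k = k) (x : B.TPow k) :
    B.power h x = B.toCyc k x := by
  obtain ⟨T, c, hx⟩ := exists_eq_sum_mkT (S := Set.univ) closure_univ_eq_top hk x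
  have := power_sum hk h (fun t : T => c t) fun t : T => t.1.1
  rw [hx, this, map_sum, ← (Equiv.funUnique (Fin 1) T).symm.sum_comp]
  refine Finset.sum_congr rfl fun t _ => ?_
  rw [map_zsmul, toCyc_mkT]
  simp only [Finset.univ_unique, Equiv.funUnique_symm_apply, uniqueElim_const,
    Finset.prod_const, Finset.card_singleton, pow_one]
  congr 2
  funext i
  simp [interleave, Nat.mod_eq_of_lt i.2]

theorem cycRotate_iterate_power {N k K : ℕ} (hk : 0 < k) (h : N * k = K) (x : B.TPow k) :
    (B.cycRotate K)^[k] (B.power h x) = B.power h x := by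
  obtain ⟨T, c, hx⟩ := exists_eq_sum_mkT (S := Set.univ) closure_univ_eq_top hk x
  have := power_sum hk h (fun t : T => c t) fun t : T => t.1.1
  rw [hx, this, ← iter_apply, map_sum]
  refine Finset.sum_equiv (shift N T) (by simp) fun f _ => ?_
  rw [map_zsmul, iter_apply, cycRotate_iterate_mkC, shift_iterate_interleave]
  congr 1
  exact (Equiv.prod_comp (finRotate N).symm fun a => c (f a)).symm

/-! ### Ghost components of infinite sequences -/

section Ghost

variable {p : ℕ}

/-- The contribution `tr(x^{⊗ p^{j-i}})` of `x ∈ M^{⊗ pⁱ}` to the `j`-th ghost component. -/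
def ghostTerm (i j : ℕ) (x : B.TPow (p ^ i)) : B.CycPow (p ^ j) :=
  if h : i ≤ j then transfer (B.cycRotate (p ^ j)) (p ^ i) (B.power (ghost_exponent h) x) else 0

/-- The `j`-th ghost component of an infinite sequence. -/
def infGhost (a : ∀ i : ℕ, B.TPow (p ^ i)) (j : ℕ) : B.CycPow (p ^ j) :=
  ∑ i ∈ Finset.range (j + 1), ghostTerm i j (a i)

/-- Extension of a sequence by zero. -/
def Seq.ext {n : ℕ} (a : B.Seq p n) (i : ℕ) : B.TPow (p ^ i) := if h : i < n then a ⟨i, h⟩ else 0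

/-- Truncation of an infinite sequence. -/
def Seq.trunc (n : ℕ) (a : ∀ i : ℕ, B.TPow (p ^ i)) : B.Seq p n := fun i => a i

theorem Seq.trunc_ext {n : ℕ} (a : B.Seq p n) : Seq.trunc n (Seq.ext a) = a := by
  funext i
  simp [Seq.trunc, Seq.ext]

theorem seqGhost_trunc {n : ℕ} (a : ∀ i : ℕ, B.TPow (p ^ i)) (j : Fin n) :
    B.seqGhost (Seq.trunc n a) j = infGhost a j := by
  rw [seqGhost, infGhost, Finset.sum_range]
  refine Finset.sum_congr rfl fun i _ => ?_
  rw [ghostTerm, dif_pos (Nat.lt_succ_iff.1 i.2), transfer_apply]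
  rfl

theorem infGhost_congr {a b : ∀ i : ℕ, B.TPow (p ^ i)} {j : ℕ} (h : ∀ i ≤ j, a i = b i) :
    infGhost a j = infGhost b j :=
  Finset.sum_congr rfl fun i hi => by rw [h i (Nat.lt_succ_iff.1 (Finset.mem_range.1 hi))]

theorem seqGhost_ext {n : ℕ} (a : B.Seq p n) (j : Fin n) :
    B.seqGhost a j = infGhost (Seq.ext a) j := by
  rw [← seqGhost_trunc, Seq.trunc_ext]

theorem ghostTerm_self (hp : 0 < p) (j : ℕ) (x : B.TPow (p ^ j)) :
    ghostTerm j j x = transfer (B.cycRotate (p ^ j)) (p ^ j) (B.toCyc _ x) := by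
  have key : ∀ (N : ℕ) (h : N * p ^ j = p ^ j), N = 1 → B.power h x = B.toCyc _ x := by
    rintro N h rfl
    exact power_one (pow_pos hp j) h x
  rw [ghostTerm, dif_pos le_rfl, key _ _ (by simp)]

/-- The part of the `j`-th ghost component that does not involve the `j`-th entry. -/
def lowGhost (a : ∀ i : ℕ, B.TPow (p ^ i)) (j : ℕ) : B.CycPow (p ^ j) :=
  ∑ i ∈ Finset.range j, ghostTerm i j (a i)

/-- The newest entry enters only through a transfer from the trivial group. This makes it possible
to correct ghost components one degree at a time. -/
theorem infGhost_eq (hp : 0 < p) (a : ∀ i : ℕ, B.TPow (p ^ i)) (j : ℕ) : infGhost a j =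
    lowGhost a j + transfer (B.cycRotate (p ^ j)) (p ^ j) (B.toCyc _ (a j)) := by
  rw [infGhost, Finset.sum_range_succ, ghostTerm_self hp, lowGhost]

theorem lowGhost_congr {a b : ∀ i : ℕ, B.TPow (p ^ i)} {j : ℕ} (h : ∀ i < j, a i = b i) :
    lowGhost a j = lowGhost b j :=
  Finset.sum_congr rfl fun i hi => by rw [h i (Finset.mem_range.1 hi)]

/-- A power of a tensor of length `p ^ i` is fixed by `σ^(p^i)`, so its transfer is fixed by `σ`. -/
theorem cycRotate_ghostTerm (hp : 0 < p) (i j : ℕ) (x : B.TPow (p ^ i)) :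
    B.cycRotate (p ^ j) (ghostTerm i j x) = ghostTerm i j x := by
  rw [ghostTerm]
  split_ifs with h
  · rw [← Function.iterate_one (B.cycRotate (p ^ j)), iterate_transfer, Function.iterate_one,
      transfer_fixed]
    exact cycRotate_iterate_power (pow_pos hp i) _ x
  · exact map_zero _

theorem cycRotate_infGhost (hp : 0 < p) (a : ∀ i : ℕ, B.TPow (p ^ i)) (j : ℕ) :
    B.cycRotate (p ^ j) (infGhost a j) = infGhost a j := by
  rw [infGhost, map_sum]
  exact Finset.sum_congr rfl fun i _ => cycRotate_ghostTerm hp i j _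

theorem Hom.tPow_surjective {C : Bimod.{u}} (φ : Hom B C) (h : Function.Surjective φ.map) {k : ℕ}
    (hk : 0 < k) : Function.Surjective (φ.tPow k) := by
  intro x
  refine mem_of_mkT_mem closure_univ_eq_top hk (φ.tPow k).range (fun m _ => ?_) x
  choose m' hm' using fun i => h (m i)
  exact ⟨B.mkT m', by rw [φ.tPow_mkT, funext hm']⟩

theorem Hom.seq_surjective {C : Bimod.{u}} (φ : Hom B C) (h : Function.Surjective φ.map)
    (hp : 0 < p) {n : ℕ} : Function.Surjective (φ.seq (p := p) (n := n)) := by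
  intro a
  choose b hb using fun i : Fin n => φ.tPow_surjective h (pow_pos hp i) (a i)
  exact ⟨b, funext hb⟩

end Ghost

end Bimod

/-! ### Towers with a Frobenius lift -/

/-- Targets of the cyclic tensor powers of a bimodule with a lift `ψ` of the Frobenius that repeats
tensors with entries in a generating set of monomials. -/
structure Tower (B : Bimod.{u}) (p : ℕ) [Fact p.Prime] where
  P : ℕ → Type u
  [addCommGroup : ∀ j, AddCommGroup (P j)]
  σ : ∀ j, P j →+ P j
  c : ∀ j, B.CycPow (p ^ j) →+ P j
  c_rotate : ∀ j x, c j (B.cycRotate _ x) = σ j (c j x)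
  c_surjective : ∀ j, Function.Surjective (c j)
  ψ : ∀ j, P j →+ P (j + 1)
  mono : Set B.M
  closure_mono : AddSubgroup.closure mono = ⊤
  ψ_mono : ∀ j (m : Fin (p ^ j) → B.M), (∀ i, m i ∈ mono) → ψ j (c j (B.mkC m)) =
    c (j + 1) (B.mkC (rep (pow_pos (Fact.out : p.Prime).pos j) (p ^ (j + 1)) m))

attribute [instance] Tower.addCommGroup

namespace Tower

open WittCoeff.Bimod

variable {B : Bimod.{u}} {p : ℕ} [hp : Fact p.Prime] (𝒯 : Tower B p)

/-- Repetition of a tuple commutes with rotation, and monomial tensors generate. -/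
theorem ψ_σ (j : ℕ) (x : 𝒯.P j) : 𝒯.ψ j (𝒯.σ j x) = 𝒯.σ (j + 1) (𝒯.ψ j x) := by
  obtain ⟨x, rfl⟩ := 𝒯.c_surjective j x
  rw [← 𝒯.c_rotate]
  refine cycPow_hom_ext (f := ((𝒯.ψ j).comp (𝒯.c j)).comp (B.cycRotate _))
    (g := ((𝒯.σ (j + 1)).comp (𝒯.ψ j)).comp (𝒯.c j)) 𝒯.closure_mono
    (pow_pos hp.out.pos j) (fun m hm => ?_) x
  simp only [AddMonoidHom.comp_apply]
  rw [cycRotate_mkC, 𝒯.ψ_mono j (shift _ _ m) fun i => hm _, 𝒯.ψ_mono j m hm, ← 𝒯.c_rotate, cycRotate_mkC,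
    shift_rep _ (pow_dvd_pow _ (Nat.le_succ j))]

theorem power_congr {N N' k K : ℕ} (h : N * k = K) (h' : N' * k = K) (e : N = N')
    (x : B.TPow k) : B.power h x = B.power h' x := by
  subst e
  rfl

/-- The Dwork congruence for a single entry. `σ^(p^i)` rotates blocks of length `p ^ i`, so the two
powers agree modulo transfers over the subgroup it generates. The outer transfer of length `p ^ i`
turns these into transfers from the trivial group. -/
theorem exists_transfer_ghostTerm (i m : ℕ) (x : B.TPow (p ^ i)) :
    ∃ y, 𝒯.c (i + m + 1) (ghostTerm i (i + m + 1) x) - 𝒯.ψ _ (𝒯.c (i + m) (ghostTerm i (i + m) x)) =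
      transfer (𝒯.σ (i + m + 1)) (p ^ (i + m + 1)) y := by
  classical
  have hk : 0 < p ^ i := pow_pos hp.out.pos i
  have h1 : p ^ (m + 1) * p ^ i = p ^ (i + m + 1) := by rw [← pow_add]; congr 1; omega
  have h2 : p ^ m * p ^ i = p ^ (i + m) := by rw [← pow_add, add_comm]
  -- An expansion in monomial tensors, on which `ψ` is repetition.
  obtain ⟨T, c, hx⟩ := exists_eq_sum_mkT 𝒯.closure_mono hk x
  let I : (Fin (p ^ (m + 1)) → T) → 𝒯.P (i + m + 1) := fun f =>
    𝒯.c _ (B.mkC (interleave hk h1 fun a => (f a).1.1))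
  have hI : ∀ f, I (shift _ T f) = iter (𝒯.σ (i + m + 1)) (p ^ i) (I f) := by
    intro f
    rw [iter_apply, ← Function.Semiconj.iterate_right (f := 𝒯.c _) (𝒯.c_rotate _),
      cycRotate_iterate_mkC, shift_iterate_interleave]
    rfl
  obtain ⟨y, hy⟩ := exists_transfer_eq_power_sub p (iter (𝒯.σ (i + m + 1)) (p ^ i)) m
    (fun t : T => c t) I hI
  refine ⟨y, ?_⟩
  have e1 : 𝒯.c _ (B.power h1 x) = ∑ f : Fin (p ^ (m + 1)) → T, (∏ a, c (f a)) • I f := by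
    rw [hx, power_sum hk h1 (fun t : T => c t) fun t : T => t.1.1, map_sum]
    exact Finset.sum_congr rfl fun f _ => map_zsmul _ _ _
  have e2 : 𝒯.ψ _ (𝒯.c _ (B.power h2 x)) =
      ∑ g : Fin (p ^ m) → T, (∏ a, c (g a)) • I (rep (pow_pos hp.out.pos m) _ g) := by
    rw [hx, power_sum hk h2 (fun t : T => c t) fun t : T => t.1.1, map_sum, map_sum]
    refine Finset.sum_congr rfl fun g _ => ?_
    rw [map_zsmul, map_zsmul, 𝒯.ψ_mono _ (interleave hk h2 fun a => (g a).1.1) fun i => (g _).1.2 _,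
      ← interleave_rep hk (pow_pos hp.out.pos m) _ h2 h1]
    rfl
  rw [← e1, ← e2] at hy
  rw [ghostTerm, dif_pos (by omega), ghostTerm, dif_pos (by omega),
    power_congr _ h1 (by congr 1; omega), power_congr _ h2 (by congr 1; omega),
    map_transfer _ _ (𝒯.c _) (𝒯.c_rotate _), map_transfer _ _ (𝒯.c _) (𝒯.c_rotate _),
    map_transfer _ _ (𝒯.ψ _) (𝒯.ψ_σ _), ← map_sub, hy, ← transfer_mul, mul_comm, h1]

/-- Consecutive ghost components agree under `ψ` up to transfers from the trivial group. -/
theorem exists_transfer_infGhost (a : ∀ i : ℕ, B.TPow (p ^ i)) (j : ℕ) :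
    ∃ y, 𝒯.c (j + 1) (infGhost a (j + 1)) - 𝒯.ψ j (𝒯.c j (infGhost a j)) =
      transfer (𝒯.σ (j + 1)) (p ^ (j + 1)) y := by
  have h : ∀ i, ∃ y, i ≤ j → 𝒯.c (j + 1) (ghostTerm i (j + 1) (a i)) -
      𝒯.ψ _ (𝒯.c j (ghostTerm i j (a i))) = transfer (𝒯.σ (j + 1)) (p ^ (j + 1)) y := by
    intro i
    by_cases hij : i ≤ j
    · obtain ⟨m, rfl⟩ := Nat.exists_eq_add_of_le hij
      obtain ⟨y, hy⟩ := 𝒯.exists_transfer_ghostTerm i m (a i)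
      exact ⟨y, fun _ => hy⟩
    · exact ⟨0, fun h => absurd h hij⟩
  choose y hy using h
  -- The old entries are compared one by one. The entry of index `j + 1` has no counterpart in
  -- degree `j` and is itself transferred.
  refine ⟨∑ i ∈ Finset.range (j + 1), y i + 𝒯.c _ (B.toCyc _ (a (j + 1))), ?_⟩
  rw [infGhost_eq hp.out.pos a (j + 1), lowGhost, infGhost, map_add, map_sum, map_sum, map_sum,
    map_add, add_sub_right_comm, ← Finset.sum_sub_distrib, map_sum,
    map_transfer _ _ (𝒯.c _) (𝒯.c_rotate _)]
  congr 1
  exact Finset.sum_congr rfl fun i hi => hy i (Nat.lt_succ_iff.1 (Finset.mem_range.1 hi))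

/-- A family that satisfies the congruences of `exists_transfer_infGhost` consists of the ghost
components of a sequence. -/
theorem exists_infGhost_eq (v : ∀ j, 𝒯.P j) (n : ℕ)
    (hv : ∀ j, j + 1 < n → ∃ y, v (j + 1) - 𝒯.ψ j (v j) =
      transfer (𝒯.σ (j + 1)) (p ^ (j + 1)) y) :
    ∃ a : ∀ i : ℕ, B.TPow (p ^ i), ∀ j < n, 𝒯.c j (infGhost a j) = v j := by
  induction n with
  | zero => exact ⟨fun _ => 0, fun j hj => absurd hj (Nat.not_lt_zero j)⟩
  | succ n ih =>
    obtain ⟨a, ha⟩ := ih fun j hj => hv j (hj.trans (Nat.lt_succ_self n))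
    -- Both `v n` and the `n`-th ghost component of the sequence found so far are congruent to `ψ (v
    -- (n-1))`. Hence `v n` differs from the low part by a transfer, which provides the new entry.
    -- In degree zero the transfer is the identity.
    have key : ∃ t, v n = 𝒯.c n (lowGhost a n) + transfer (𝒯.σ n) (p ^ n) t := by
      cases n with
      | zero => exact ⟨v 0, by rw [lowGhost, Finset.sum_range_zero, map_zero, pow_zero, transfer_one, zero_add]⟩
      | succ n =>
        obtain ⟨y, hy⟩ := 𝒯.exists_transfer_infGhost a n
        obtain ⟨z, hz⟩ := hv n (Nat.lt_succ_self _)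
        rw [ha n (Nat.lt_succ_self n), infGhost_eq hp.out.pos, map_add,
          map_transfer _ _ (𝒯.c _) (𝒯.c_rotate _)] at hy
        refine ⟨𝒯.c _ (B.toCyc _ (a (n + 1))) + z - y, ?_⟩
        rw [map_sub, map_add, ← hy, ← hz]
        abel
    obtain ⟨t, ht⟩ := key
    obtain ⟨s, rfl⟩ := 𝒯.c_surjective n t
    obtain ⟨x, rfl⟩ := toCyc_surjective _ s
    refine ⟨Function.update a n x, fun j hj => ?_⟩
    rcases (Nat.lt_succ_iff.1 hj).lt_or_eq with hj | rfl
    · rw [infGhost_congr (b := a) fun i hi => Function.update_of_ne (by omega) _ _, ha j hj]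
    · rw [infGhost_eq hp.out.pos, lowGhost_congr (b := a) fun i hi =>
        Function.update_of_ne (by omega) _ _, Function.update_self, map_add,
        map_transfer _ _ (𝒯.c _) (𝒯.c_rotate _), ht]

end Tower

namespace Bimod

/-! ### The Frobenius lift of a bimodule with a basis of monomials -/

/-- A basis of `M` over the integers that is permuted by left and right multiplication with the
elements of a generating set of `R`. -/
structure Monomial (B : Bimod.{u}) where
  β : Type u
  basis : Module.Basis β ℤ B.M
  words : Set B.R
  closure_words : AddSubgroup.closure words = ⊤
  left : ∀ w ∈ words, ∀ i, ∃ j, w • basis i = basis j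
  right : ∀ w ∈ words, ∀ i, ∃ j, MulOpposite.op w • basis i = basis j

variable {B : Bimod.{u}}

theorem mkC_move {k : ℕ} (m : Fin k → B.M) (r : B.R) {i j : Fin k} (h : cycAdj i j) :
    B.mkC (Function.update m i (MulOpposite.op r • m i)) =
      B.mkC (Function.update m j (r • m j)) := by
  refine QuotientAddGroup.eq_iff_sub_mem.2 (AddSubgroup.subset_closure ?_)
  exact ⟨m, r, i, j, h, rfl⟩

/-- The tuple with entries `w · m c · w`, where the left factor is present if the position before
`c` belongs to `S`, and the right factor if `c` belongs to `A`. -/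
def decorate {K : ℕ} (m : Fin K → B.M) (w : B.R) (A S : Finset (Fin K)) (c : Fin K) : B.M :=
  (if (finRotate K).symm c ∈ S then w else 1) •
    MulOpposite.op (if c ∈ A then w else 1) • m c

/-- The right factors `w` cross the tensor sign one at a time. Disjointness ensures that the place
where a factor arrives has not received one before. -/
theorem mkC_decorate {K : ℕ} (m : Fin K → B.M) (w : B.R) (A S : Finset (Fin K))
    (h : Disjoint A S) : B.mkC (decorate m w A S) = B.mkC (decorate m w ∅ (A ∪ S)) := by
  induction A using Finset.induction_on generalizing S with
  | empty => simp
  | insert c A hc ih =>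
    rw [Finset.disjoint_insert_left] at h
    have e1 : decorate m w (insert c A) S = Function.update (decorate m w A S) c
        (MulOpposite.op w • decorate m w A S c) := by
      funext d
      by_cases hd : d = c
      · subst hd
        simp only [decorate, Function.update_self, Finset.mem_insert, true_or, if_true, hc,
          if_false, MulOpposite.op_one, one_smul]
        exact smul_comm _ _ _
      · simp [decorate, hd]
    have e2 : decorate m w A (insert c S) = Function.update (decorate m w A S) (finRotate K c)
        (w • decorate m w A S (finRotate K c)) := by
      funext d
      by_cases hd : d = finRotate K c
      · subst hd
        simp only [decorate, Function.update_self, Finset.mem_insert, Equiv.symm_apply_apply,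
          true_or, if_true, h.1, if_false, one_smul]
      · have : (finRotate K).symm d ≠ c := fun hh =>
          hd (by rw [← hh, Equiv.apply_symm_apply])
        rw [Function.update_of_ne hd]
        simp only [decorate, Finset.mem_insert, this, false_or]
    rw [e1, mkC_move _ _ rfl, ← e2, ih, Finset.insert_union, Finset.union_insert]
    exact Finset.disjoint_insert_right.2 ⟨hc, h.2⟩

/-- A single move of `w` becomes, after repetition, one move in each period. -/
theorem mkC_rep_update {k K : ℕ} (hk : 0 < k) (hkK : k ∣ K) (m : Fin k → B.M) (w : B.R)
    {i j : Fin k} (h : cycAdj i j) :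
    B.mkC (rep hk K (Function.update m i (MulOpposite.op w • m i))) =
      B.mkC (rep hk K (Function.update m j (w • m j))) := by
  set A : Finset (Fin K) := Finset.univ.filter fun c => (⟨c % k, Nat.mod_lt _ hk⟩ : Fin k) = i
    with hA
  have e1 : rep hk K (Function.update m i (MulOpposite.op w • m i)) =
      decorate (rep hk K m) w A ∅ := by
    funext c
    simp only [rep, decorate, hA, Finset.mem_filter, Finset.mem_univ, true_and,
      Finset.notMem_empty, if_false, one_smul]
    split_ifs with hc
    · rw [hc, Function.update_self]
    · rw [Function.update_of_ne hc, MulOpposite.op_one, one_smul]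
  have e2 : rep hk K (Function.update m j (w • m j)) = decorate (rep hk K m) w ∅ A := by
    funext c
    obtain ⟨c, rfl⟩ := (finRotate K).surjective c
    have hK : 0 < K := c.pos
    have hc : finRotate K c = ⟨(c + 1) % K, Nat.mod_lt _ hK⟩ := by
      rw [← finRotate_mod hK]
      congr 1
      ext
      exact (Nat.mod_eq_of_lt c.2).symm
    have hc' : (⟨(finRotate K c : ℕ) % k, Nat.mod_lt _ hk⟩ : Fin k) =
        finRotate k ⟨c % k, Nat.mod_lt _ hk⟩ := by
      rw [finRotate_mod hk]
      ext
      simp only [hc]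
      exact Nat.mod_mod_of_dvd _ hkK
    simp only [rep, decorate, hA, Finset.mem_filter, Finset.mem_univ, true_and,
      Finset.notMem_empty, if_false, Equiv.symm_apply_apply, MulOpposite.op_one, one_smul]
    rw [hc', ← h]
    split_ifs with hci
    · rw [hci, Function.update_self]
    · rw [Function.update_of_ne (fun hh => hci ((finRotate k).injective hh)), one_smul]
  rw [e1, e2, mkC_decorate _ _ _ _ (Finset.disjoint_empty_right _), Finset.union_empty]

namespace Monomial

variable (𝓜 : B.Monomial)

/-- The Frobenius lift on integral tensor powers: it repeats tensors of monomials. -/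
def frobInt {k : ℕ} (hk : 0 < k) (K : ℕ) : B.IntPow k →ₗ[ℤ] B.CycPow K :=
  (Basis.piTensorProduct fun _ : Fin k => 𝓜.basis).constr ℤ
    fun f => B.mkC (rep hk K fun i => 𝓜.basis (f i))

theorem frobInt_tprod {k : ℕ} (hk : 0 < k) (K : ℕ) (f : Fin k → 𝓜.β) :
    𝓜.frobInt hk K (PiTensorProduct.tprod ℤ fun i => 𝓜.basis (f i)) =
      B.mkC (rep hk K fun i => 𝓜.basis (f i)) := by
  rw [← Basis.piTensorProduct_apply]
  exact Module.Basis.constr_basis _ _ _ _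

theorem frobInt_tprod' {k : ℕ} (hk : 0 < k) (K : ℕ) (m : Fin k → B.M)
    (hm : ∀ i, m i ∈ Set.range 𝓜.basis) :
    𝓜.frobInt hk K (PiTensorProduct.tprod ℤ m) = B.mkC (rep hk K m) := by
  choose f hf using hm
  obtain rfl : (fun i => 𝓜.basis (f i)) = m := funext hf
  exact 𝓜.frobInt_tprod hk K f

/-- Both sides are multilinear in `m`, so it suffices to take basis elements. A word maps these to
basis elements, so both tensors are again monomial and `frobInt` repeats them. -/
theorem frobInt_move_word {k K : ℕ} (hk : 0 < k) (hkK : k ∣ K) {w : B.R} (hw : w ∈ 𝓜.words)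
    {i j : Fin k} (h : cycAdj i j) (m : Fin k → B.M) :
    𝓜.frobInt hk K (PiTensorProduct.tprod ℤ (Function.update m i (MulOpposite.op w • m i))) =
      𝓜.frobInt hk K (PiTensorProduct.tprod ℤ (Function.update m j (w • m j))) := by
  let L : B.M →ₗ[ℤ] B.M := (DistribSMul.toAddMonoidHom B.M w).toIntLinearMap
  let R : B.M →ₗ[ℤ] B.M := (DistribSMul.toAddMonoidHom B.M (MulOpposite.op w)).toIntLinearMap
  have hupd : ∀ (i : Fin k) (f : B.M →ₗ[ℤ] B.M) (m : Fin k → B.M),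
      Function.update m i (f (m i)) = fun l => (if l = i then f else LinearMap.id) (m l) := by
    intro i f m
    funext l
    by_cases hl : l = i
    · subst hl; simp
    · simp [hl]
  have key : ((𝓜.frobInt hk K).compMultilinearMap (PiTensorProduct.tprod ℤ)).compLinearMap
      (fun l => if l = i then R else LinearMap.id) =
      ((𝓜.frobInt hk K).compMultilinearMap (PiTensorProduct.tprod ℤ)).compLinearMap
      (fun l => if l = j then L else LinearMap.id) := by
    refine Module.Basis.ext_multilinear (fun _ => 𝓜.basis) fun f => ?_
    simp only [MultilinearMap.compLinearMap_apply, LinearMap.compMultilinearMap_apply]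
    rw [← hupd i R fun l => 𝓜.basis (f l), ← hupd j L fun l => 𝓜.basis (f l)]
    have hmem : ∀ (i : Fin k) (x : B.M), x ∈ Set.range 𝓜.basis → ∀ l,
        Function.update (fun l => 𝓜.basis (f l)) i x l ∈ Set.range 𝓜.basis := by
      intro i x hx l
      by_cases hl : l = i
      · subst hl; simpa using hx
      · simp [hl]
    obtain ⟨a, ha⟩ := 𝓜.right w hw (f i)
    obtain ⟨b, hb⟩ := 𝓜.left w hw (f j)
    change R (𝓜.basis (f i)) = _ at ha
    change L (𝓜.basis (f j)) = _ at hb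
    rw [ha, hb, 𝓜.frobInt_tprod' hk K _ (hmem i _ ⟨a, rfl⟩),
      𝓜.frobInt_tprod' hk K _ (hmem j _ ⟨b, rfl⟩)]
    rw [← ha, ← hb]
    exact mkC_rep_update hk hkK (fun l => 𝓜.basis (f l)) w h
  have := DFunLike.congr_fun key m
  simp only [MultilinearMap.compLinearMap_apply, LinearMap.compMultilinearMap_apply] at this
  rw [← hupd i R, ← hupd j L] at this
  exact this

/-- `frobInt` is linear and the tensors are additive in `r`, so the relation extends from words to
all of `R`. -/
theorem frobInt_move {k K : ℕ} (hk : 0 < k) (hkK : k ∣ K) (r : B.R)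
    {i j : Fin k} (h : cycAdj i j) (m : Fin k → B.M) :
    𝓜.frobInt hk K (PiTensorProduct.tprod ℤ (Function.update m i (MulOpposite.op r • m i))) =
      𝓜.frobInt hk K (PiTensorProduct.tprod ℤ (Function.update m j (r • m j))) := by
  have hr : r ∈ AddSubgroup.closure 𝓜.words := 𝓜.closure_words ▸ AddSubgroup.mem_top r
  induction hr using AddSubgroup.closure_induction with
  | mem w hw => exact 𝓜.frobInt_move_word hk hkK hw h m
  | zero => simp [MultilinearMap.map_update_zero]
  | add a b _ _ ha hb =>
    rw [MulOpposite.op_add, add_smul, add_smul, MultilinearMap.map_update_add,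
      MultilinearMap.map_update_add, map_add, map_add, ha, hb]
  | neg a _ ha =>
    rw [MulOpposite.op_neg, neg_smul, neg_smul, MultilinearMap.map_update_neg,
      MultilinearMap.map_update_neg, map_neg, map_neg, ha]

/-- The Frobenius lift on cyclic tensor powers. -/
def frob {k K : ℕ} (hk : 0 < k) (hkK : k ∣ K) : B.CycPow k →+ B.CycPow K :=
  QuotientAddGroup.lift _ (𝓜.frobInt hk K).toAddMonoidHom (by
    refine (AddSubgroup.closure_le _).2 ?_
    rintro _ ⟨m, r, i, j, hij, rfl⟩
    refine (map_sub (𝓜.frobInt hk K) _ _).trans (sub_eq_zero.2 ?_)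
    exact 𝓜.frobInt_move hk hkK r hij m)

theorem frob_mkC {k K : ℕ} (hk : 0 < k) (hkK : k ∣ K) (m : Fin k → B.M)
    (hm : ∀ i, m i ∈ Set.range 𝓜.basis) : 𝓜.frob hk hkK (B.mkC m) = B.mkC (rep hk K m) :=
  𝓜.frobInt_tprod' hk K m hm

theorem _root_.WittCoeff.closure_range_basis {β M : Type*} [AddCommGroup M]
    (b : Module.Basis β ℤ M) : AddSubgroup.closure (Set.range b) = ⊤ := by
  have h := congrArg Submodule.toAddSubgroup b.span_eq
  rwa [Submodule.span_int_eq_addSubgroupClosure] at h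

/-- The tower of cyclic tensor powers. -/
def tower (p : ℕ) [hp : Fact p.Prime] : Tower B p where
  P j := B.CycPow (p ^ j)
  σ j := B.cycRotate (p ^ j)
  c _ := AddMonoidHom.id _
  c_rotate _ _ := rfl
  c_surjective _ x := ⟨x, rfl⟩
  ψ j := 𝓜.frob (pow_pos hp.out.pos j) (pow_dvd_pow _ (Nat.le_succ j))
  mono := Set.range 𝓜.basis
  closure_mono := closure_range_basis 𝓜.basis
  ψ_mono _ m hm := 𝓜.frob_mkC _ _ m hm

end Monomial

/-- The basis of words of the free bimodule. -/
def free.monomial (X Y : Type u) : (Bimod.free X Y).Monomial :=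
  let word : FreeMonoid X → FreeRing X := FreeAbelianGroup.of
  have hword : ∀ x y, word (x * y) = word x * word y := FreeAbelianGroup.of_mul
  let bR : Module.Basis (FreeMonoid X) ℤ (FreeRing X) :=
    Module.Basis.ofRepr (FreeAbelianGroup.equivFinsupp (FreeMonoid X)).toIntLinearEquiv
  let bT : Module.Basis (FreeMonoid X × FreeMonoid X) ℤ (FreeRing X ⊗[ℤ] (FreeRing X)ᵐᵒᵖ) :=
    bR.tensorProduct (bR.map (MulOpposite.opLinearEquiv ℤ))
  let bM := Finsupp.basis (ι := Y) fun _ => bT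
  have hR : ∀ x : FreeMonoid X, bR x = word x := fun x => by
    change Finsupp.toFreeAbelianGroup (Finsupp.single x 1) = _
    rw [Finsupp.toFreeAbelianGroup_single, one_smul]
  have hM : ∀ (y : Y) (x z : FreeMonoid X), bM ⟨y, (x, z)⟩ =
      Finsupp.single y (word x ⊗ₜ[ℤ] MulOpposite.op (word z)) := by
    intro y x z
    simp only [bM, Finsupp.coe_basis]
    have h : bT (x, z) = bR x ⊗ₜ[ℤ] MulOpposite.op (bR z) :=
      Module.Basis.tensorProduct_apply _ _ _ _
    rw [h, hR, hR]
  { β := Σ _ : Y, FreeMonoid X × FreeMonoid X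
    basis := Module.Basis.ofRepr (bM.repr.toAddEquiv.toIntLinearEquiv :
      (Y →₀ FreeRing X ⊗[ℤ] (FreeRing X)ᵐᵒᵖ) ≃ₗ[ℤ] _)
    words := Set.range word
    closure_words := by
      have := closure_range_basis bR
      rwa [show ⇑bR = word from funext hR] at this
    left := by
      rintro _ ⟨w, rfl⟩ ⟨y, x, z⟩
      refine ⟨⟨y, w * x, z⟩, ?_⟩
      change (word w ⊗ₜ[ℤ] (1 : (FreeRing X)ᵐᵒᵖ)) •
        bM ⟨y, x, z⟩ = bM ⟨y, w * x, z⟩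
      rw [hM, hM, Finsupp.smul_single, smul_eq_mul, Algebra.TensorProduct.tmul_mul_tmul, one_mul,
        hword]
    right := by
      rintro _ ⟨w, rfl⟩ ⟨y, x, z⟩
      -- The right factor lives in the opposite ring, where acting by `w` appends it to `z`.
      refine ⟨⟨y, x, z * w⟩, ?_⟩
      change ((1 : FreeRing X) ⊗ₜ[ℤ] MulOpposite.op (word w)) •
        bM ⟨y, x, z⟩ = bM ⟨y, x, z * w⟩
      rw [hM, hM, Finsupp.smul_single, smul_eq_mul, Algebra.TensorProduct.tmul_mul_tmul, one_mul,
        ← MulOpposite.op_mul, hword] }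

end Bimod

namespace Bimod

/-! ### The relation defining the Witt vectors -/

/-- The identity morphism. -/
def Hom.id (B : Bimod.{u}) : Hom B B where
  base := RingHom.id _
  map := AddMonoidHom.id _
  map_left _ _ := rfl
  map_right _ _ := rfl

theorem Hom.tPow_id {B : Bimod.{u}} {k : ℕ} (x : B.TPow k) : (Hom.id B).tPow k x = x := by
  have : (Hom.id B).intPow k = AddMonoidHom.id _ := intPow_hom_ext fun m => by
    rw [Hom.intPow_tprod]
    rfl
  induction x using QuotientAddGroup.induction_on with
  | H y => exact congrArg QuotientAddGroup.mk (DFunLike.congr_fun this y)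

theorem Hom.seq_id {B : Bimod.{u}} {p n : ℕ} (a : B.Seq p n) : (Hom.id B).seq a = a :=
  funext fun i => Hom.tPow_id (a i)

theorem Hom.witt_comp {B C D : Bimod.{u}} (ψ : Hom C D) (φ : Hom B C) {p n : ℕ}
    (x : Witt p n B) : (ψ.comp φ).witt p n x = ψ.witt p n (φ.witt p n x) := by
  induction x using Quot.ind with
  | mk a => exact congrArg (Quot.mk _) (ψ.seq_comp φ a)

theorem Hom.witt_id {B : Bimod.{u}} {p n : ℕ} (x : Witt p n B) : (Hom.id B).witt p n x = x := by
  induction x using Quot.ind with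
  | mk a => exact congrArg (Quot.mk _) (Hom.seq_id a)

variable {B : Bimod.{u}} {p n : ℕ}

/-- The class of a sequence. -/
def Witt.mk (a : B.Seq p n) : Witt p n B := Quot.mk _ a

variable (B) in
/-- The common section `FU(R; M) → FUFU(R; M)` of the two parallel maps. -/
def coverSection : Hom B.cover B.cover.cover :=
  free.lift (Bimod.free B.cover.R B.cover.M)
    (fun x => free.var (free.var x : (Bimod.free B.R B.M).R))
    (fun m => free.gen (free.gen m : (Bimod.free B.R B.M).M))

theorem coverSection_base (x : B.R) : B.coverSection.base (free.var x : (Bimod.free B.R B.M).R) =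
    (free.var (free.var x : (Bimod.free B.R B.M).R) : (Bimod.free B.cover.R B.cover.M).R) :=
  free.lift_base_var _ _ _ x

theorem coverSection_map (x : B.M) : B.coverSection.map (free.gen x : (Bimod.free B.R B.M).M) =
    (free.gen (free.gen x : (Bimod.free B.R B.M).M) : (Bimod.free B.cover.R B.cover.M).M) :=
  free.lift_map_gen _ _ _ x

theorem counit_base (x : B.R) : B.counit.base (free.var x : (Bimod.free B.R B.M).R) = x :=
  free.lift_base_var B id id x

theorem counit_map (x : B.M) : B.counit.map (free.gen x : (Bimod.free B.R B.M).M) = x :=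
  free.lift_map_gen B id id x

theorem counit_map_surjective : Function.Surjective B.counit.map := fun x =>
  ⟨_, counit_map x⟩

theorem counit_base_surjective : Function.Surjective B.counit.base := fun x =>
  ⟨_, counit_base x⟩

theorem counit_coverSection : B.cover.counit.comp B.coverSection = Hom.id B.cover := by
  refine free.hom_ext (fun x => ?_) fun x => ?_
  · exact (congrArg B.cover.counit.base (coverSection_base x)).trans (counit_base (B := B.cover) _)
  · exact (congrArg B.cover.counit.map (coverSection_map x)).trans (counit_map (B := B.cover) _)

theorem counit_cover_coverSection : B.counit.cover.comp B.coverSection = Hom.id B.cover := by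
  refine free.hom_ext (fun x => ?_) fun x => ?_
  · refine (congrArg B.counit.cover.base (coverSection_base x)).trans ?_
    refine (free.lift_base_var (Bimod.free B.R B.M) (X := B.cover.R) (Y := B.cover.M) _ _ _).trans
      ?_
    exact congrArg free.var (counit_base x)
  · refine (congrArg B.counit.cover.map (coverSection_map x)).trans ?_
    refine (free.lift_map_gen (Bimod.free B.R B.M) (X := B.cover.R) (Y := B.cover.M) _ _ _).trans
      ?_
    exact congrArg free.gen (counit_map x)

/-- Two sequences are similar if they have lifts to the free cover with the same ghost
components. -/
def Sim (a b : B.Seq p n) : Prop :=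
  ∃ q u : B.cover.Seq p n, B.counit.seq q = a ∧ B.counit.seq u = b ∧
    ∀ j, B.cover.seqGhost q j = B.cover.seqGhost u j

theorem Sim.symm {a b : B.Seq p n} (h : Sim a b) : Sim b a := by
  obtain ⟨q, u, hq, hu, h⟩ := h
  exact ⟨u, q, hu, hq, fun j => (h j).symm⟩

/-- This is the defining relation with `z` the image of `q` under the common section of the two
parallel maps. -/
theorem Sim.mk_eq {a b : B.Seq p n} (h : Sim a b) : Witt.mk a = Witt.mk b := by
  obtain ⟨q, u, rfl, rfl, h⟩ := h
  refine Quot.sound ⟨q, u, B.coverSection.seq q, rfl, rfl, fun j => ?_, fun j => ?_⟩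
  · rw [← Hom.seq_comp, counit_coverSection, Hom.seq_id]
  · rw [← Hom.seq_comp, counit_cover_coverSection, Hom.seq_id, h]

/-- The defining relation is a composite of two similarities, which meet in the common image of `z`
under the two composites from `FUFU` to `(R; M)`. Thus `Sim`, which no longer involves `FUFU`,
generates the same equivalence. -/
theorem eqvGen_sim_of_mk_eq {a b : B.Seq p n} (h : Witt.mk a = Witt.mk b) :
    Relation.EqvGen Sim a b := by
  have h' := Quot.eqvGen_exact h
  induction h' with
  | rel a b hab =>
    obtain ⟨q, u, z, rfl, rfl, hq, hu⟩ := hab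
    refine Relation.EqvGen.trans _ (B.counit.seq (B.cover.counit.seq z)) _
      (Relation.EqvGen.rel _ _ ⟨q, _, rfl, rfl, hq⟩) ?_
    rw [← Hom.seq_comp, B.counit_comp_counit, Hom.seq_comp]
    exact Relation.EqvGen.symm _ _ (Relation.EqvGen.rel _ _ ⟨u, _, rfl, rfl, hu⟩)
  | refl a => exact Relation.EqvGen.refl a
  | symm a b hab ih => exact Relation.EqvGen.symm _ _ (ih (Quot.eqvGen_sound hab))
  | trans a b c hab hbc ih1 ih2 =>
    exact Relation.EqvGen.trans _ _ _ (ih1 (Quot.eqvGen_sound hab)) (ih2 (Quot.eqvGen_sound hbc))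

/-! ### Injectivity of the ghost map -/

/-- The last entry of a sequence. -/
def Seq.lastEntry (a : B.Seq p (n + 1)) : B.TPow (p ^ n) := a (Fin.last n)

theorem Seq.eq_trunc_of_init (a : B.Seq p (n + 1)) (b : ∀ i : ℕ, B.TPow (p ^ i))
    (h : ∀ i : Fin n, b i = Seq.init a i) (h' : b n = a.lastEntry) :
    Seq.trunc (n + 1) b = a := by
  funext i
  induction i using Fin.lastCases with
  | last => exact h'
  | cast i => exact h i

theorem Seq.ext_last (a : B.Seq p (n + 1)) : Seq.ext a n = Seq.lastEntry a :=
  dif_pos (Nat.lt_succ_self n)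

variable [hp : Fact p.Prime]

/-- In degree `j + 1` both full ghost components are congruent to the same element, and the newest
entries change them only by transfers. -/
theorem _root_.WittCoeff.Tower.exists_transfer_lowGhost (𝒯 : Tower B p)
    (a b : ∀ i : ℕ, B.TPow (p ^ i)) (j : ℕ) (h : infGhost a j = infGhost b j) :
    ∃ y, 𝒯.c (j + 1) (lowGhost a (j + 1)) - 𝒯.c (j + 1) (lowGhost b (j + 1)) =
      transfer (𝒯.σ (j + 1)) (p ^ (j + 1)) y := by
  obtain ⟨y, hy⟩ := 𝒯.exists_transfer_infGhost a j
  obtain ⟨z, hz⟩ := 𝒯.exists_transfer_infGhost b j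
  rw [infGhost_eq hp.out.pos, map_add, map_transfer _ _ (𝒯.c _) (𝒯.c_rotate _), h] at hy
  rw [infGhost_eq hp.out.pos, map_add, map_transfer _ _ (𝒯.c _) (𝒯.c_rotate _)] at hz
  refine ⟨y - z - (𝒯.c _ (B.toCyc _ (a (j + 1))) - 𝒯.c _ (B.toCyc _ (b (j + 1)))), ?_⟩
  rw [map_sub, map_sub, map_sub, ← hy, ← hz]
  abel

/-- The generators of the cyclic relations lift along surjections, hence so does every element that
vanishes in the cyclic power. -/
theorem Hom.exists_toCyc_eq_zero {C : Bimod.{u}} (φ : Hom B C)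
    (h1 : Function.Surjective φ.base) (h2 : Function.Surjective φ.map) {k : ℕ} (x : C.TPow k)
    (hx : C.toCyc k x = 0) : ∃ y, φ.tPow k y = x ∧ B.toCyc k y = 0 := by
  induction x using QuotientAddGroup.induction_on with
  | H x =>
  have hx : x ∈ C.balance cycAdj := (QuotientAddGroup.eq_zero_iff x).1 hx
  have hle : C.balance (k := k) cycAdj ≤ (B.balance (k := k) cycAdj).map (φ.intPow k) := by
    refine (AddSubgroup.closure_le _).2 ?_
    rintro _ ⟨m, r, i, j, hij, rfl⟩
    choose m' hm' using fun l => h2 (m l)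
    obtain ⟨r', rfl⟩ := h1 r
    refine ⟨_, AddSubgroup.subset_closure ⟨m', r', i, j, hij, rfl⟩, ?_⟩
    rw [map_sub, φ.intPow_tprod, φ.intPow_tprod, map_update', map_update', φ.map_left,
      φ.map_right, funext hm', hm', hm']
  obtain ⟨y, hy, rfl⟩ := hle hx
  exact ⟨QuotientAddGroup.mk y, rfl, (QuotientAddGroup.eq_zero_iff y).2 hy⟩

/-- The lift of `c` is extended by any lift `t` of the last entry of `a`. The low ghost components
of the lifts of `c` and `d` differ by the transfer of some `y`, so extending the lift of `d` by `t +
y` gives the same top ghost component. -/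
theorem Sim.exists_extension {c d : B.Seq p n} (h : Sim c d) (a : B.Seq p (n + 1))
    (ha : Seq.init a = c) : ∃ b : B.Seq p (n + 1), Seq.init b = d ∧ Sim a b := by
  obtain ⟨q, u, rfl, rfl, h⟩ := h
  obtain ⟨t, ht⟩ := B.counit.tPow_surjective counit_map_surjective (pow_pos hp.out.pos n)
    (Seq.lastEntry a)
  have hlow : ∃ y, lowGhost (Seq.ext q) n - lowGhost (Seq.ext u) n =
      transfer (B.cover.cycRotate (p ^ n)) (p ^ n) y := by
    cases n with
    | zero => exact ⟨0, by rw [lowGhost, lowGhost]; simp only [Finset.sum_range_zero, map_zero,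
        sub_self]⟩
    | succ n =>
      refine ((free.monomial B.R B.M).tower p).exists_transfer_lowGhost (Seq.ext q) (Seq.ext u) n ?_
      have := h (Fin.last n)
      rwa [seqGhost_ext, seqGhost_ext] at this
  obtain ⟨y, hy⟩ := hlow
  obtain ⟨y, rfl⟩ := toCyc_surjective _ y
  let Q : ∀ i : ℕ, B.cover.TPow (p ^ i) := Function.update (Seq.ext q) n t
  let U : ∀ i : ℕ, B.cover.TPow (p ^ i) := Function.update (Seq.ext u) n (t + y)
  have hQ : ∀ i < n, Q i = Seq.ext q i := fun i hi => Function.update_of_ne hi.ne _ _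
  have hU : ∀ i < n, U i = Seq.ext u i := fun i hi => Function.update_of_ne hi.ne _ _
  have hQn : Q n = t := Function.update_self _ _ _
  have hUn : U n = t + y := Function.update_self _ _ _
  refine ⟨B.counit.seq (Seq.trunc (n + 1) U), ?_, Seq.trunc (n + 1) Q, Seq.trunc (n + 1) U, ?_, rfl,
    fun j => ?_⟩
  · funext i
    change B.counit.tPow _ (U i) = B.counit.tPow _ (u i)
    rw [hU i i.2, Seq.ext, dif_pos i.2]
  · refine Seq.eq_trunc_of_init a (fun i => B.counit.tPow _ (Q i)) (fun i => ?_) ?_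
    · rw [ha, hQ i i.2, Seq.ext, dif_pos i.2]
      rfl
    · rw [hQn, ht]
  · rw [seqGhost_trunc, seqGhost_trunc]
    rcases (Nat.lt_succ_iff.1 j.2).lt_or_eq with hj | hj
    · rw [infGhost_congr fun i hi => hQ i (lt_of_le_of_lt hi hj),
        infGhost_congr fun i hi => hU i (lt_of_le_of_lt hi hj)]
      have := h ⟨j, hj⟩
      rwa [seqGhost_ext, seqGhost_ext] at this
    · rw [hj, infGhost_eq hp.out.pos, infGhost_eq hp.out.pos, lowGhost_congr hQ,
        lowGhost_congr hU, hQn, hUn, map_add, map_add, ← hy]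
      abel

/-- The transfer does not see `e - σ e`, so a lift of this difference to the free cover leaves the
ghost components unchanged. -/
theorem sim_of_last {a b : B.Seq p (n + 1)} (hab : Seq.init a = Seq.init b)
    (e : B.CycPow (p ^ n))
    (he : B.toCyc _ (Seq.lastEntry a) - B.toCyc _ (Seq.lastEntry b) = e - B.cycRotate _ e) :
    Sim a b := by
  obtain ⟨q, rfl⟩ := B.counit.seq_surjective counit_map_surjective hp.out.pos b
  obtain ⟨e, rfl⟩ := toCyc_surjective _ e
  obtain ⟨e, rfl⟩ := B.counit.tPow_surjective counit_map_surjective (pow_pos hp.out.pos n) e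
  obtain ⟨e', he'⟩ := toCyc_surjective _ (B.cover.cycRotate _ (B.cover.toCyc _ e))
  -- `κ` lifts what remains of the difference of the last entries. It vanishes in the cyclic power
  -- and does not affect the ghost components.
  obtain ⟨κ, hκ1, hκ2⟩ := B.counit.exists_toCyc_eq_zero counit_base_surjective
    counit_map_surjective (Seq.lastEntry a - B.counit.tPow _ (Seq.lastEntry q) -
      B.counit.tPow _ e + B.counit.tPow _ e') (by
      have h2 : B.toCyc _ (B.counit.tPow _ e') =
          B.cycRotate _ (B.toCyc _ (B.counit.tPow (p ^ n) e)) := by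
        rw [← Hom.cycPow_toCyc, he', Hom.cycPow_rotate, Hom.cycPow_toCyc]
      have he2 : B.toCyc _ (Seq.lastEntry a) -
        B.toCyc _ (B.counit.tPow (p ^ n) (Seq.lastEntry q)) = _ := he
      rw [map_add, map_sub, map_sub, h2]
      refine (congrArg₂ (· + ·) (congrArg₂ (· - ·) he2 rfl) rfl).trans ?_
      abel)
  let Q : ∀ i : ℕ, B.cover.TPow (p ^ i) :=
    Function.update (Seq.ext q) n (Seq.lastEntry q + e - e' + κ)
  have hQ : ∀ i < n, Q i = Seq.ext q i := fun i hi => Function.update_of_ne hi.ne _ _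
  have hQn : Q n = Seq.lastEntry q + e - e' + κ := Function.update_self _ _ _
  refine ⟨Seq.trunc (n + 1) Q, q, ?_, rfl, fun j => ?_⟩
  · refine Seq.eq_trunc_of_init a (fun i => B.counit.tPow _ (Q i)) (fun i => ?_) ?_
    · rw [hab, hQ i i.2, Seq.ext, dif_pos (i.2.trans (Nat.lt_succ_self n))]
      rfl
    · rw [hQn, map_add, map_sub, map_add, hκ1]
      abel
  · rw [seqGhost_trunc, seqGhost_ext]
    rcases (Nat.lt_succ_iff.1 j.2).lt_or_eq with hj | hj
    · exact infGhost_congr fun i hi => hQ i (lt_of_le_of_lt hi hj)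
    · rw [hj, infGhost_eq hp.out.pos, infGhost_eq hp.out.pos, lowGhost_congr hQ, hQn, Seq.ext_last,
        map_add, map_sub, map_add, hκ2, he', map_add, map_sub, map_add, transfer_fixed, map_zero]
      · abel
      · exact cycRotate_iterate_self (pow_pos hp.out.pos n) _

variable (B p n) in
/-- The transfers `CycPow (p ^ j) → CycPow (p ^ j)` have no kernel apart from the coboundaries. -/
def TransferExact : Prop :=
  ∀ j < n, ∀ x : B.CycPow (p ^ j), transfer (B.cycRotate _) (p ^ j) x = 0 →
    ∃ e, x = e - B.cycRotate _ e

/-- The ghost map is injective if the transfers are exact. -/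
theorem mk_eq_of_seqGhost_eq (hB : B.TransferExact p n) {a b : B.Seq p n}
    (h : ∀ j, B.seqGhost a j = B.seqGhost b j) : Witt.mk a = Witt.mk b := by
  induction n with
  | zero => exact congrArg Witt.mk (funext fun i => i.elim0)
  | succ n ih =>
    have h1 := eqvGen_sim_of_mk_eq
      (ih (fun j hj => hB j (hj.trans (Nat.lt_succ_self n))) (a := Seq.init a) (b := Seq.init b)
        fun j => h j.castSucc)
    -- A sequence with initial part `c` is moved along the chain of similarities, within its class,
    -- to one with initial part `d`. Both directions are proved together so that the induction is
    -- symmetric.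
    have h2 : ∀ c d : B.Seq p n, Relation.EqvGen Sim c d →
        (∀ a, Seq.init a = c → ∃ b, Seq.init b = d ∧ Witt.mk a = Witt.mk b) ∧
        (∀ a, Seq.init a = d → ∃ b, Seq.init b = c ∧ Witt.mk a = Witt.mk b) := by
      intro c d hcd
      induction hcd with
      | rel c d hcd =>
        refine ⟨fun a ha => ?_, fun a ha => ?_⟩
        · obtain ⟨b, hb, hab⟩ := hcd.exists_extension a ha
          exact ⟨b, hb, hab.mk_eq⟩
        · obtain ⟨b, hb, hab⟩ := hcd.symm.exists_extension a ha
          exact ⟨b, hb, hab.mk_eq⟩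
      | refl c => exact ⟨fun a ha => ⟨a, ha, rfl⟩, fun a ha => ⟨a, ha, rfl⟩⟩
      | symm c d _ ih => exact ⟨ih.2, ih.1⟩
      | trans c d e _ _ ih1 ih2 =>
        refine ⟨fun a ha => ?_, fun a ha => ?_⟩
        · obtain ⟨b, hb, hab⟩ := ih1.1 a ha
          obtain ⟨b', hb', hab'⟩ := ih2.1 b hb
          exact ⟨b', hb', hab.trans hab'⟩
        · obtain ⟨b, hb, hab⟩ := ih2.2 a ha
          obtain ⟨b', hb', hab'⟩ := ih1.2 b hb
          exact ⟨b', hb', hab.trans hab'⟩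
    obtain ⟨b', hb', hab'⟩ := (h2 _ _ h1).1 a rfl
    rw [hab']
    -- Now `b'` and `b` differ only in the last entry, so the transfer of the difference of the last
    -- entries vanishes.
    have h3 : B.seqGhost b' (Fin.last n) = B.seqGhost b (Fin.last n) :=
      (congrArg (Bimod.ghost (Fin.last n)) hab').symm.trans (h _)
    rw [seqGhost_ext, seqGhost_ext] at h3
    have hlow : lowGhost (Seq.ext b') n = lowGhost (Seq.ext b) n := by
      refine lowGhost_congr fun i hi => ?_
      have hi' : i < n + 1 := hi.trans (Nat.lt_succ_self n)
      rw [Seq.ext, dif_pos hi', Seq.ext, dif_pos hi']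
      exact congrFun hb' ⟨i, hi⟩
    have h4 : infGhost (Seq.ext b') n = infGhost (Seq.ext b) n := h3
    rw [infGhost_eq hp.out.pos, infGhost_eq hp.out.pos, hlow, Seq.ext_last, Seq.ext_last] at h4
    obtain ⟨e, he⟩ := hB n (Nat.lt_succ_self n)
      (B.toCyc _ (Seq.lastEntry b') - B.toCyc _ (Seq.lastEntry b)) (by
        rw [map_sub, add_left_cancel h4, sub_self])
    exact (sim_of_last hb' e he).mk_eq

theorem ghost_injective (hB : B.TransferExact p n) {x y : Witt p n B}
    (h : ∀ j, ghost j x = ghost j y) : x = y := by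
  induction x using Quot.ind with
  | mk a =>
    induction y using Quot.ind with
    | mk b => exact mk_eq_of_seqGhost_eq hB h

end Bimod

namespace Bimod

/-! ### Presentations -/

/-- A presentation `f, g : C'' ⇉ C' → C` by a reflexive pair, in which every element of the kernel of
`ε` is the difference of the values of `f` and `g` at an element. -/
structure Presentation (C'' C' C : Bimod.{u}) where
  f : Hom C'' C'
  g : Hom C'' C'
  ε : Hom C' C
  s : Hom C' C''
  f_s : f.comp s = Hom.id C'
  g_s : g.comp s = Hom.id C'
  ε_f : ε.comp f = ε.comp g
  base_surjective : Function.Surjective ε.base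
  map_surjective : Function.Surjective ε.map
  ker : ∀ d, ε.map d = 0 → ∃ e, f.map e = d ∧ g.map e = 0

namespace Presentation

variable {C'' C' C : Bimod.{u}} (Φ : Presentation C'' C' C)

theorem f_map_s (m : C'.M) : Φ.f.map (Φ.s.map m) = m :=
  DFunLike.congr_fun (congrArg Hom.map Φ.f_s) m

/-- The image under `f` of the kernel of `g` on tensor powers. -/
def kerImage (k : ℕ) : AddSubgroup (C'.TPow k) := (Φ.g.tPow k).ker.map (Φ.f.tPow k)

/-- Lift the factor in the kernel of `ε` to an element killed by `g`, and the other factors by the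
section. The resulting elementary tensor is killed by `g` and mapped to the given one by `f`. -/
theorem mkT_update_mem_kerImage {k : ℕ} (m : Fin k → C'.M) (i : Fin k) (d : C'.M)
    (hd : Φ.ε.map d = 0) : C'.mkT (Function.update m i d) ∈ Φ.kerImage k := by
  obtain ⟨e, rfl, he⟩ := Φ.ker d hd
  refine ⟨C''.mkT (Function.update (fun l => Φ.s.map (m l)) i e), ?_, ?_⟩
  · refine AddMonoidHom.mem_ker.2 ?_
    rw [Hom.tPow_mkT, map_update', he]
    have := MultilinearMap.map_update_zero (PiTensorProduct.tprod ℤ)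
      (fun l => Φ.g.map (Φ.s.map (m l))) i
    exact congrArg QuotientAddGroup.mk this
  · rw [Hom.tPow_mkT, map_update']
    simp only [f_map_s]

theorem mkT_update_sub {k : ℕ} (m : Fin k → C'.M) (i : Fin k) (x y : C'.M) :
    C'.mkT (Function.update m i (x - y)) =
      C'.mkT (Function.update m i x) - C'.mkT (Function.update m i y) :=
  congrArg QuotientAddGroup.mk (MultilinearMap.map_update_sub (PiTensorProduct.tprod ℤ) m i x y)

theorem mkT_update_add {k : ℕ} (m : Fin k → C'.M) (i : Fin k) (x y : C'.M) :
    C'.mkT (Function.update m i (x + y)) =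
      C'.mkT (Function.update m i x) + C'.mkT (Function.update m i y) :=
  congrArg QuotientAddGroup.mk (MultilinearMap.map_update_add (PiTensorProduct.tprod ℤ) m i x y)

/-- The factors are exchanged one at a time; each exchange changes the tensor by one with a factor
in the kernel of `ε`. -/
theorem mkT_congr {k : ℕ} {m m' : Fin k → C'.M} (h : ∀ i, Φ.ε.map (m i) = Φ.ε.map (m' i)) :
    (C'.mkT m : C'.TPow k ⧸ Φ.kerImage k) = C'.mkT m' := by
  suffices key : ∀ s : Finset (Fin k),
      (C'.mkT (fun i => if i ∈ s then m i else m' i) : C'.TPow k ⧸ Φ.kerImage k) = C'.mkT m' by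
    simpa using key Finset.univ
  intro s
  induction s using Finset.induction_on with
  | empty => simp
  | insert c s hc ih =>
    rw [← ih]
    refine QuotientAddGroup.eq_iff_sub_mem.2 ?_
    have e1 : (fun i => if i ∈ insert c s then m i else m' i) =
        Function.update (fun i => if i ∈ s then m i else m' i) c (m c) := by
      funext i
      by_cases hi : i = c
      · subst hi; simp
      · simp [hi]
    have e2 : (fun i => if i ∈ s then m i else m' i) =
        Function.update (fun i => if i ∈ s then m i else m' i) c (m' c) := by
      funext i
      by_cases hi : i = c
      · subst hi; simp [hc]
      · simp [hi]
    have h3 := mkT_update_sub (fun i => if i ∈ s then m i else m' i) c (m c) (m' c)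
    rw [← e1, ← e2] at h3
    rw [← h3]
    exact Φ.mkT_update_mem_kerImage _ _ _ (by rw [map_sub, h, sub_self])

theorem balanced {k : ℕ} (m : Fin k → C'.M) (r : C'.R) {i j : Fin k} (h : linAdj i j) :
    C'.mkT (Function.update m i (MulOpposite.op r • m i)) =
      C'.mkT (Function.update m j (r • m j)) := by
  refine QuotientAddGroup.eq_iff_sub_mem.2 (AddSubgroup.subset_closure ?_)
  exact ⟨m, r, i, j, h, rfl⟩

/-- A set-theoretic section of `ε`. -/
def sec (m : C.M) : C'.M := (Φ.map_surjective m).choose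

theorem ε_sec (m : C.M) : Φ.ε.map (Φ.sec m) = m := (Φ.map_surjective m).choose_spec

/-- `sec` need not be additive. Modulo `kerImage` any preimage may replace it, and this makes
`liftInt` multilinear. -/
theorem map_update_sec {k : ℕ} (m : Fin k → C.M) (i : Fin k) (x : C.M) (y : C'.M)
    (hy : Φ.ε.map y = x) :
    (C'.mkT (fun l => Φ.sec (Function.update m i x l)) : C'.TPow k ⧸ Φ.kerImage k) =
      C'.mkT (Function.update (fun l => Φ.sec (m l)) i y) := by
  refine Φ.mkT_congr fun l => ?_
  rw [Φ.ε_sec]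
  by_cases hl : l = i
  · subst hl; simp [hy]
  · simp [hl, Φ.ε_sec]

/-- The inverse of the isomorphism from the quotient by `kerImage` to the tensor power of `C`. -/
def liftInt (k : ℕ) : C.IntPow k →ₗ[ℤ] (C'.TPow k ⧸ Φ.kerImage k) :=
  PiTensorProduct.lift
    (MultilinearMap.mk' (fun m : Fin k → C.M =>
      ((C'.mkT fun l => Φ.sec (m l) : C'.TPow k) : C'.TPow k ⧸ Φ.kerImage k))
      (fun m i x y => by
        rw [Φ.map_update_sec m i _ (Φ.sec x + Φ.sec y) (by rw [map_add, Φ.ε_sec, Φ.ε_sec]),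
          Φ.map_update_sec m i x _ (Φ.ε_sec x), Φ.map_update_sec m i y _ (Φ.ε_sec y),
          mkT_update_add]
        rfl)
      (fun m i c x => by
        rw [Φ.map_update_sec m i _ (c • Φ.sec x) (by rw [map_zsmul, Φ.ε_sec]),
          Φ.map_update_sec m i x _ (Φ.ε_sec x)]
        have := MultilinearMap.map_update_smul (PiTensorProduct.tprod ℤ)
          (fun l => Φ.sec (m l)) i c (Φ.sec x)
        exact congrArg (fun z : C'.IntPow k =>
          (((z : C'.TPow k)) : C'.TPow k ⧸ Φ.kerImage k)) this))

theorem liftInt_tprod {k : ℕ} (m : Fin k → C.M) (m' : Fin k → C'.M)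
    (h : ∀ i, Φ.ε.map (m' i) = m i) :
    Φ.liftInt k (PiTensorProduct.tprod ℤ m) = (C'.mkT m' : C'.TPow k ⧸ Φ.kerImage k) := by
  refine (PiTensorProduct.lift.tprod _).trans ?_
  exact Φ.mkT_congr fun i => by rw [Φ.ε_sec, h]

/-- The inverse of the isomorphism from the quotient by `kerImage` to the tensor power of `C`. -/
def liftT (k : ℕ) : C.TPow k →+ (C'.TPow k ⧸ Φ.kerImage k) :=
  QuotientAddGroup.lift _ (Φ.liftInt k).toAddMonoidHom (by
    refine (AddSubgroup.closure_le _).2 ?_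
    rintro _ ⟨m, r, i, j, hij, rfl⟩
    refine AddMonoidHom.mem_ker.2 ?_
    rw [map_sub, sub_eq_zero]
    obtain ⟨r, rfl⟩ := Φ.base_surjective r
    have h1 := Φ.liftInt_tprod (Function.update m i (MulOpposite.op (Φ.ε.base r) • m i))
      (Function.update (fun l => Φ.sec (m l)) i (MulOpposite.op r • Φ.sec (m i))) (fun l => by
        by_cases hl : l = i
        · subst hl; simp [Φ.ε.map_right, Φ.ε_sec]
        · simp [hl, Φ.ε_sec])
    have h2 := Φ.liftInt_tprod (Function.update m j (Φ.ε.base r • m j))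
      (Function.update (fun l => Φ.sec (m l)) j (r • Φ.sec (m j))) (fun l => by
        by_cases hl : l = j
        · subst hl; simp [Φ.ε.map_left, Φ.ε_sec]
        · simp [hl, Φ.ε_sec])
    refine h1.trans (Eq.trans ?_ h2.symm)
    exact congrArg QuotientAddGroup.mk (balanced (fun l => Φ.sec (m l)) r hij))

/-- Right exactness of tensor powers: `liftT` after `ε` is the projection modulo `kerImage`, so the
kernel of `ε` lies in `kerImage`. -/
theorem exists_of_tPow_eq_zero {k : ℕ} (hk : 0 < k) (x : C'.TPow k) (hx : Φ.ε.tPow k x = 0) :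
    ∃ z, Φ.f.tPow k z = x ∧ Φ.g.tPow k z = 0 := by
  have key : ∀ x : C'.TPow k, Φ.liftT k (Φ.ε.tPow k x) = QuotientAddGroup.mk' _ x := fun x =>
    tPow_hom_ext (f := (Φ.liftT k).comp (Φ.ε.tPow k)) (g := QuotientAddGroup.mk' (Φ.kerImage k))
      closure_univ_eq_top hk (fun m _ => by
        rw [AddMonoidHom.comp_apply, Hom.tPow_mkT]
        exact Φ.liftInt_tprod _ m fun _ => rfl) x
  have := key x
  rw [hx, map_zero] at this
  obtain ⟨z, hz, rfl⟩ := (QuotientAddGroup.eq_zero_iff x).1 this.symm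
  exact ⟨z, rfl, hz⟩

/-- The difference `x - y` lies in the kernel of `ε`. As the pair is reflexive, adding the section
of `y` turns the values `x - y` and `0` into `x` and `y`. -/
theorem exists_of_tPow_eq {k : ℕ} (hk : 0 < k) (x y : C'.TPow k)
    (h : Φ.ε.tPow k x = Φ.ε.tPow k y) : ∃ z, Φ.f.tPow k z = x ∧ Φ.g.tPow k z = y := by
  obtain ⟨z, h1, h2⟩ := Φ.exists_of_tPow_eq_zero hk (x - y) (by rw [map_sub, h, sub_self])
  refine ⟨z + Φ.s.tPow k y, ?_, ?_⟩
  · rw [map_add, h1, ← Hom.tPow_comp, Φ.f_s, Hom.tPow_id, sub_add_cancel]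
  · rw [map_add, h2, ← Hom.tPow_comp, Φ.g_s, Hom.tPow_id, zero_add]

/-! ### Witt vectors as coequalizers of a presentation -/

variable {p n : ℕ} [hp : Fact p.Prime]

theorem exists_of_seq_eq (x y : C'.Seq p n) (h : Φ.ε.seq x = Φ.ε.seq y) :
    ∃ z, Φ.f.seq z = x ∧ Φ.g.seq z = y := by
  choose z h1 h2 using fun i : Fin n =>
    Φ.exists_of_tPow_eq (pow_pos hp.out.pos i) (x i) (y i) (congrFun h i)
  exact ⟨z, funext h1, funext h2⟩

theorem witt_surjective : Function.Surjective (Φ.ε.witt p n) := by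
  intro x
  induction x using Quot.ind with
  | mk a =>
    obtain ⟨b, rfl⟩ := Φ.ε.seq_surjective Φ.map_surjective hp.out.pos a
    exact ⟨Witt.mk b, rfl⟩

/-- The canonical lift of the counit of the free cover of `C`. -/
def coverLift : Hom C.cover C' :=
  free.lift C' (fun r => (Φ.base_surjective r).choose) Φ.sec

theorem ε_coverLift : Φ.ε.comp Φ.coverLift = C.counit := by
  refine free.hom_ext (fun x => ?_) fun x => ?_
  · refine Eq.trans ?_ (counit_base x).symm
    refine (congrArg Φ.ε.base (free.lift_base_var C' _ _ x)).trans ?_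
    exact (Φ.base_surjective x).choose_spec
  · refine Eq.trans ?_ (counit_map x).symm
    exact (congrArg Φ.ε.map (free.lift_map_gen C' _ _ x)).trans (Φ.ε_sec x)

/-- The Witt vectors of `C` are the coequalizer of those of `C''` and `C'`. -/
theorem eqvGen_of_witt_eq (hC' : C'.TransferExact p n) (x y : Witt p n C')
    (h : Φ.ε.witt p n x = Φ.ε.witt p n y) :
    Relation.EqvGen (fun u v => ∃ z, Φ.f.witt p n z = u ∧ Φ.g.witt p n z = v) x y := by
  induction x using Quot.ind with
  | mk a =>
  induction y using Quot.ind with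
  | mk b =>
  -- Sequences with the same image in `C` are linked by `f` and `g`, entry by entry.
  have h0 : ∀ a b : C'.Seq p n, Φ.ε.seq a = Φ.ε.seq b →
      Relation.EqvGen (fun u v => ∃ z, Φ.f.witt p n z = u ∧ Φ.g.witt p n z = v)
        (Witt.mk a) (Witt.mk b) := by
    intro a b hab
    obtain ⟨z, rfl, rfl⟩ := Φ.exists_of_seq_eq a b hab
    exact Relation.EqvGen.rel _ _ ⟨Witt.mk z, rfl, rfl⟩
  have key : ∀ c d : C.Seq p n, Relation.EqvGen Sim c d → ∀ a b : C'.Seq p n, Φ.ε.seq a = c →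
      Φ.ε.seq b = d →
      Relation.EqvGen (fun u v => ∃ z, Φ.f.witt p n z = u ∧ Φ.g.witt p n z = v)
        (Witt.mk a) (Witt.mk b) := by
    intro c d hcd
    induction hcd with
    | rel c d hcd =>
      obtain ⟨q, u, rfl, rfl, hqu⟩ := hcd
      intro a b ha hb
      have hcov : ∀ q : C.cover.Seq p n, Φ.ε.seq (Φ.coverLift.seq q) = C.counit.seq q := fun q => by
        rw [← Hom.seq_comp, Φ.ε_coverLift]
      -- The free cover of `C` maps to `C'` over `C`. The two lifts in a similarity become sequences
      -- over `C'` with the same ghost components, hence of the same class, as the ghost map of `C'`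
      -- is injective.
      have hmid : Witt.mk (Φ.coverLift.seq q) = Witt.mk (Φ.coverLift.seq u) :=
        mk_eq_of_seqGhost_eq hC' fun j => by
          rw [← Hom.cycPow_seqGhost, ← Hom.cycPow_seqGhost, hqu]
      refine Relation.EqvGen.trans _ _ _ (h0 a (Φ.coverLift.seq q) (by rw [ha, hcov])) ?_
      rw [hmid]
      exact h0 _ _ (by rw [hb, hcov])
    | refl c => exact fun a b ha hb => h0 a b (ha.trans hb.symm)
    | symm c d _ ih => exact fun a b ha hb => Relation.EqvGen.symm _ _ (ih b a hb ha)
    | trans c d e _ _ ih1 ih2 =>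
      intro a b ha hb
      obtain ⟨m, hm⟩ := Φ.ε.seq_surjective Φ.map_surjective hp.out.pos d
      exact Relation.EqvGen.trans _ _ _ (ih1 a m ha hm) (ih2 m b hm hb)
  exact key _ _ (eqvGen_sim_of_mk_eq h) a b rfl rfl

end Presentation

end Bimod

open WittCoeff.Bimod

namespace AlgPair

/-! ### Morphisms of commutative pairs and their tensor powers -/

variable {A B C : AlgPair.{u}}

theorem Hom.ext' {φ ψ : Hom A B} (h1 : φ.base = ψ.base) (h2 : φ.map = ψ.map) : φ = ψ := by
  cases φ
  cases ψ
  subst h1 h2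
  rfl

/-- The identity morphism. -/
def Hom.id (A : AlgPair.{u}) : Hom A A := ⟨RingHom.id _, RingHom.id _, fun _ => rfl⟩

/-- Composition of morphisms. -/
def Hom.comp (ψ : Hom B C) (φ : Hom A B) : Hom A C :=
  ⟨ψ.base.comp φ.base, ψ.map.comp φ.map, fun r => by
    rw [RingHom.comp_apply, φ.comm, ψ.comm, RingHom.comp_apply]⟩

theorem Hom.W_comp {p n : ℕ} (ψ : Hom B C) (φ : Hom A B) (x : A.W p n) :
    (ψ.comp φ).W p n x = ψ.W p n (φ.W p n x) :=
  Bimod.Hom.witt_comp ψ.toBimod φ.toBimod x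

theorem Hom.W_id {p n : ℕ} (x : A.W p n) : (Hom.id A).W p n x = x := Bimod.Hom.witt_id x

theorem pow_hom_ext {G : Type*} [AddCommGroup G] {k : ℕ} (hk : 0 < k) {f g : A.Pow k →+ G}
    (h : ∀ m : Fin k → A.M, f (PiTensorProduct.tprod A.R m) = g (PiTensorProduct.tprod A.R m))
    (x : A.Pow k) : f x = g x :=
  addHom_ext_of_tprod closure_univ_eq_top hk (fun m _ => h m) x

theorem Hom.powHom_smul_tprod (φ : Hom A B) {k : ℕ} (r : A.R) (m : Fin k → A.M) :
    φ.powHom k (r • PiTensorProduct.tprod A.R m) =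
      φ.base r • PiTensorProduct.tprod B.R (fun i => φ.map (m i)) :=
  φ.powAdd_smul_tprod r m

theorem Hom.powHom_tprod (φ : Hom A B) {k : ℕ} (m : Fin k → A.M) :
    φ.powHom k (PiTensorProduct.tprod A.R m) =
      PiTensorProduct.tprod B.R (fun i => φ.map (m i)) := by
  have := φ.powHom_smul_tprod 1 m
  rwa [one_smul, map_one, one_smul] at this

theorem Hom.powHom_comp (ψ : Hom B C) (φ : Hom A B) {k : ℕ} :
    (ψ.comp φ).powHom k = (ψ.powHom k).comp (φ.powHom k) := by
  ext x
  induction x using PiTensorProduct.induction_on with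
  | smul_tprod r m =>
    rw [RingHom.comp_apply, powHom_smul_tprod, powHom_smul_tprod, powHom_smul_tprod]
    rfl
  | add x y hx hy => rw [map_add, map_add, hx, hy]

theorem Hom.powHom_id {k : ℕ} : (Hom.id A).powHom k = RingHom.id _ := by
  ext x
  induction x using PiTensorProduct.induction_on with
  | smul_tprod r m =>
    rw [powHom_smul_tprod]
    rfl
  | add x y hx hy => rw [map_add, map_add, hx, hy]

theorem Hom.tensor_comp (ψ : Hom B C) (φ : Hom A B) (k : ℕ) :
    (ψ.comp φ).tensor k = (ψ.tensor k).comp (φ.tensor k) :=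
  Hom.ext' rfl (ψ.powHom_comp φ)

theorem Hom.tensor_id (k : ℕ) : (Hom.id A).tensor k = Hom.id (A.tensor k) :=
  Hom.ext' rfl Hom.powHom_id

/-! ### Comparison of the tensor powers of a pair and of its bimodule -/

variable (A) in
/-- The canonical map from the tensor power of the bimodule to that of the algebra. -/
def fromT (k : ℕ) : A.toBimod.TPow k →+ A.Pow k := (A.fromCyc k).comp (A.toBimod.toCyc k)

theorem fromCyc_mkC {k : ℕ} (m : Fin k → A.M) :
    A.fromCyc k (mkC A.toBimod m) = PiTensorProduct.tprod A.R m :=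
  PiTensorProduct.lift.tprod (R := ℤ) (s := fun _ : Fin k => A.M) m

theorem fromT_mkT {k : ℕ} (m : Fin k → A.M) :
    A.fromT k (mkT A.toBimod m) = PiTensorProduct.tprod A.R m := fromCyc_mkC m

/-- Left and right actions agree, so the relations between neighbours carry the scalar down to the
first factor. -/
theorem elem_update_smul {k : ℕ} (hk : 0 < k) (m : Fin k → A.M) (r : A.R) (i : Fin k) :
    A.elem (Function.update m i (r • m i)) =
      A.elem (Function.update m ⟨0, hk⟩ (r • m ⟨0, hk⟩)) := by
  obtain ⟨i, hi⟩ := i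
  induction i with
  | zero => rfl
  | succ i ih =>
    rw [← ih (by omega)]
    symm
    refine QuotientAddGroup.eq_iff_sub_mem.2 (AddSubgroup.subset_closure ?_)
    exact ⟨m, r, ⟨i, by omega⟩, ⟨i + 1, hi⟩, rfl, rfl⟩

theorem elem_update_add {k : ℕ} (m : Fin k → A.M) (i : Fin k) (x y : A.M) :
    A.elem (Function.update m i (x + y)) =
      A.elem (Function.update m i x) + A.elem (Function.update m i y) :=
  congrArg QuotientAddGroup.mk
    (MultilinearMap.map_update_add (PiTensorProduct.tprod ℤ (s := fun _ : Fin k => A.M)) m i x y)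

theorem elem_eq_zero {k : ℕ} (m : Fin k → A.M) (i : Fin k) (h : m i = 0) : A.elem m = 0 :=
  congrArg QuotientAddGroup.mk
    (MultilinearMap.map_coord_zero (PiTensorProduct.tprod ℤ (s := fun _ : Fin k => A.M)) i h)

variable (A) in
/-- The inverse of `fromT`. -/
def toT {k : ℕ} (hk : 0 < k) : A.Pow k →+ A.toBimod.TPow k :=
  PiTensorProduct.liftAddHom
    (fun x => A.elem (Function.update x.2 ⟨0, hk⟩ (x.1 • x.2 ⟨0, hk⟩)))
    (fun r f i hf => by
      rw [← elem_update_smul hk f r i]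
      exact elem_eq_zero _ i (by rw [hf, smul_zero, Function.update_self]))
    (fun f => elem_eq_zero _ ⟨0, hk⟩ (by simp only [zero_smul, Function.update_self]))
    (fun {inst} r f i x y => by
      have : inst = instDecidableEqFin k := Subsingleton.elim _ _
      subst this
      have key : ∀ z, A.elem (Function.update (Function.update f i z) ⟨0, hk⟩
          (r • Function.update f i z ⟨0, hk⟩)) = A.elem (Function.update f i (r • z)) := by
        intro z
        rw [← elem_update_smul hk (Function.update f i z) r i, Function.update_self,
          Function.update_idem]
      simp only [key, smul_add, elem_update_add])
    (fun r r' f => by rw [← elem_update_add, add_smul])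
    (fun {inst} r f i r' => by
      have : inst = instDecidableEqFin k := Subsingleton.elim _ _
      subst this
      change A.elem (Function.update (Function.update f i (r' • f i)) ⟨0, hk⟩
        (r • Function.update f i (r' • f i) ⟨0, hk⟩)) = A.elem (Function.update f ⟨0, hk⟩
          ((r' * r) • f ⟨0, hk⟩))
      rw [← elem_update_smul hk (Function.update f i (r' • f i)) r i, Function.update_self,
          Function.update_idem, ← elem_update_smul hk f (r' * r) i, smul_smul, mul_comm])

theorem toT_tprod {k : ℕ} (hk : 0 < k) (m : Fin k → A.M) :
    A.toT hk (PiTensorProduct.tprod A.R m) = mkT A.toBimod m := by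
  have : A.toT hk (PiTensorProduct.tprod A.R m) =
      A.elem (Function.update m ⟨0, hk⟩ ((1 : A.R) • m ⟨0, hk⟩)) := by
    rw [PiTensorProduct.tprod_eq_tprodCoeff_one]
    exact zero_add (A.elem _)
  rw [this, one_smul, Function.update_eq_self]
  rfl

theorem toT_fromT {k : ℕ} (hk : 0 < k) (x : A.toBimod.TPow k) : A.toT hk (A.fromT k x) = x :=
  tPow_hom_ext (f := (A.toT hk).comp (A.fromT k)) (g := AddMonoidHom.id _) closure_univ_eq_top hk
    (fun m _ => (congrArg (A.toT hk) (fromT_mkT m)).trans (toT_tprod hk m)) x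

theorem fromT_toT {k : ℕ} (hk : 0 < k) (x : A.Pow k) : A.fromT k (A.toT hk x) = x :=
  pow_hom_ext (f := (A.fromT k).comp (A.toT hk)) (g := AddMonoidHom.id _) hk
    (fun m => (congrArg (A.fromT k) (toT_tprod hk m)).trans (fromT_mkT m)) x

theorem fromCyc_surjective {k : ℕ} (hk : 0 < k) : Function.Surjective (A.fromCyc k) := fun x =>
  ⟨_, fromT_toT hk x⟩

/-- For symmetric bimodules the relation between the last factor and the first adds nothing: `toT`
followed by the projection is a left inverse. -/
theorem fromCyc_injective {k : ℕ} (hk : 0 < k) : Function.Injective (A.fromCyc k) := by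
  have : ∀ x, A.toBimod.toCyc k (A.toT hk (A.fromCyc k x)) = x := by
    intro x
    obtain ⟨x, rfl⟩ := toCyc_surjective k x
    exact congrArg (A.toBimod.toCyc k) (toT_fromT hk x)
  exact Function.LeftInverse.injective (g := fun y => A.toBimod.toCyc k (A.toT hk y)) this

theorem Hom.powHom_fromCyc (φ : Hom A B) {k : ℕ} (hk : 0 < k) (x : A.toBimod.CycPow k) :
    φ.powHom k (A.fromCyc k x) = B.fromCyc k (φ.toBimod.cycPow k x) :=
  cycPow_hom_ext (f := (φ.powHom k).toAddMonoidHom.comp (A.fromCyc k))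
    (g := (B.fromCyc k).comp (φ.toBimod.cycPow k)) closure_univ_eq_top hk (fun m _ => by
      refine (congrArg (φ.powHom k) (fromCyc_mkC m)).trans ((φ.powHom_tprod m).trans ?_)
      refine Eq.trans ?_ (congrArg (B.fromCyc k) (φ.toBimod.cycPow_mkC m)).symm
      exact (fromCyc_mkC (A := B) fun i => φ.map (m i)).symm) x

theorem Hom.powHom_fromT (φ : Hom A B) {k : ℕ} (hk : 0 < k) (x : A.toBimod.TPow k) :
    φ.powHom k (A.fromT k x) = B.fromT k (φ.toBimod.tPow k x) :=
  (φ.powHom_fromCyc hk _).trans (congrArg (B.fromCyc k) (φ.toBimod.cycPow_toCyc x))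

theorem fromCyc_rotate {k : ℕ} (hk : 0 < k) (x : A.toBimod.CycPow k) :
    A.fromCyc k (A.toBimod.cycRotate k x) = rotate A.R k (A.fromCyc k x) :=
  cycPow_hom_ext (f := (A.fromCyc k).comp (A.toBimod.cycRotate k))
    (g := (rotate A.R k).comp (A.fromCyc k)) closure_univ_eq_top hk (fun m _ => by
      refine (congrArg (A.fromCyc k) (cycRotate_mkC m)).trans ?_
      refine Eq.trans ?_ (congrArg (rotate A.R k) (fromCyc_mkC m)).symm
      exact (fromCyc_mkC (A := A) _).trans (rotate_tprod A.R (X := A.M) m).symm) x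

theorem mulMap_tprod {k : ℕ} (m : Fin k → A.M) :
    A.mulMap k (PiTensorProduct.tprod A.R m) = ∏ i, m i := by
  rw [mulMap, PiTensorProduct.lift.tprod, MultilinearMap.mkPiAlgebra_apply]

theorem mulMap_one {k : ℕ} : A.mulMap k 1 = 1 := by
  rw [PiTensorProduct.one_def, mulMap_tprod]
  simp

theorem mulMap_mul {k : ℕ} (x y : A.Pow k) : A.mulMap k (x * y) = A.mulMap k x * A.mulMap k y := by
  induction x using PiTensorProduct.induction_on with
  | smul_tprod r m =>
    induction y using PiTensorProduct.induction_on with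
    | smul_tprod s l =>
      rw [smul_mul_smul_comm, PiTensorProduct.tprod_mul_tprod, map_smul, map_smul, map_smul,
        mulMap_tprod, mulMap_tprod, mulMap_tprod, smul_mul_smul_comm]
      simp only [Pi.mul_apply, Finset.prod_mul_distrib]
    | add y z hy hz => rw [mul_add, map_add, map_add, mul_add, hy, hz]
  | add x z hx hz => rw [add_mul, map_add, map_add, add_mul, hx, hz]

theorem Hom.map_mulMap (φ : Hom A B) {k : ℕ} (x : A.Pow k) :
    φ.map (A.mulMap k x) = B.mulMap k (φ.powHom k x) := by
  induction x using PiTensorProduct.induction_on with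
  | smul_tprod r m =>
    rw [powHom_smul_tprod, (A.mulMap k).map_smul, (B.mulMap k).map_smul, mulMap_tprod, mulMap_tprod, φ.map_smul, map_prod]
  | add x y hx hy => rw [map_add, map_add, map_add, map_add, hx, hy]

/-! ### Rotation -/

theorem rotate_smul {k : ℕ} (r : A.R) (x : A.Pow k) :
    rotate A.R k (r • x) = r • rotate A.R k x :=
  map_smul (PiTensorProduct.reindex A.R (fun _ : Fin k => A.M) (finRotate k)) r x

theorem rotate_one {k : ℕ} : rotate A.R k (1 : A.Pow k) = 1 := by
  rw [PiTensorProduct.one_def, rotate_tprod]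
  rfl

theorem rotate_mul {k : ℕ} (x y : A.Pow k) :
    rotate A.R k (x * y) = rotate A.R k x * rotate A.R k y := by
  induction x using PiTensorProduct.induction_on with
  | smul_tprod r m =>
    induction y using PiTensorProduct.induction_on with
    | smul_tprod s l =>
      rw [smul_mul_smul_comm, PiTensorProduct.tprod_mul_tprod, rotate_smul, rotate_smul,
        rotate_smul, rotate_tprod, rotate_tprod, rotate_tprod, smul_mul_smul_comm,
        PiTensorProduct.tprod_mul_tprod]
      rfl
    | add y z hy hz => rw [mul_add, map_add, map_add, mul_add, hy, hz]
  | add x z hx hz => rw [add_mul, map_add, map_add, add_mul, hx, hz]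

theorem rotate_iterate_smul_tprod {k : ℕ} (l : ℕ) (r : A.R) (m : Fin k → A.M) :
    (rotate A.R k)^[l] (r • PiTensorProduct.tprod A.R m) =
      r • PiTensorProduct.tprod A.R ((shift k A.M)^[l] m) := by
  induction l generalizing m with
  | zero => rfl
  | succ l ih =>
    rw [Function.iterate_succ_apply, rotate_smul, rotate_tprod]
    exact ih _

theorem rotate_iterate_tprod {k : ℕ} (l : ℕ) (m : Fin k → A.M) :
    (rotate A.R k)^[l] (PiTensorProduct.tprod A.R m) =
      PiTensorProduct.tprod A.R ((shift k A.M)^[l] m) := by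
  have := rotate_iterate_smul_tprod (A := A) l 1 m
  rwa [one_smul, one_smul] at this

theorem rotate_iterate_self {k : ℕ} (hk : 0 < k) (x : A.Pow k) : (rotate A.R k)^[k] x = x := by
  rw [← iter_apply]
  refine pow_hom_ext (f := iter (rotate A.R k) k) (g := AddMonoidHom.id _) hk (fun m => ?_) x
  rw [iter_apply, rotate_iterate_tprod, shift_iterate_self hk]
  rfl

theorem Hom.powHom_rotate (φ : Hom A B) {k : ℕ} (x : A.Pow k) :
    φ.powHom k (rotate A.R k x) = rotate B.R k (φ.powHom k x) := by
  induction x using PiTensorProduct.induction_on with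
  | smul_tprod r m =>
    rw [powHom_smul_tprod, rotate_smul, rotate_smul, rotate_tprod, rotate_tprod,
      powHom_smul_tprod]
  | add x y hx hy => rw [map_add, map_add, map_add, map_add, hx, hy]

/-! ### Concatenation -/

theorem closure_range_tprod {k : ℕ} (hk : 0 < k) :
    AddSubgroup.closure (Set.range (PiTensorProduct.tprod A.R (s := fun _ : Fin k => A.M))) = ⊤ := by
  refine top_le_iff.1 fun x _ => ?_
  exact mem_of_tprod_mem closure_univ_eq_top hk _
    (fun m _ => AddSubgroup.subset_closure (Set.mem_range_self m)) x

theorem tensor_pow_hom_ext {G : Type*} [AddCommGroup G] {k N : ℕ} (hk : 0 < k) (hN : 0 < N)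
    {f g : (A.tensor k).Pow N →+ G}
    (h : ∀ v : Fin N → Fin k → A.M,
      f (PiTensorProduct.tprod A.R fun a => PiTensorProduct.tprod A.R (v a)) =
        g (PiTensorProduct.tprod A.R fun a => PiTensorProduct.tprod A.R (v a)))
    (x : (A.tensor k).Pow N) : f x = g x := by
  refine addHom_ext_of_tprod (closure_range_tprod (A := A) hk) hN (fun m hm => ?_) x
  choose v hv using hm
  obtain rfl : (fun a => PiTensorProduct.tprod A.R (v a)) = m := funext hv
  exact h v

variable {p : ℕ}

theorem assoc_tprod (hp : 0 < p) (j : ℕ) (v : Fin (p ^ j) → Fin p → A.M) :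
    A.assoc p j (PiTensorProduct.tprod A.R fun a => PiTensorProduct.tprod A.R (v a)) =
      PiTensorProduct.tprod A.R (interleave hp (pow_succ p j).symm v) :=
  (PiTensorProduct.lift.tprod (E := A.Pow (p ^ j * p)) _).trans (concat_tprod A.R v)

theorem assoc_smul (j : ℕ) (r : A.R) (x : (A.tensor p).Pow (p ^ j)) :
    A.assoc p j (r • x) = r • A.assoc p j x := by
  have h := (PiTensorProduct.lift (concat A.R A.M (p ^ j) p)).map_smul r x
  exact h

theorem assoc_one (hp : 0 < p) (j : ℕ) : A.assoc p j 1 = 1 := assoc_tprod (A := A) hp j 1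

theorem assoc_mul (hp : 0 < p) (j : ℕ) (x y : (A.tensor p).Pow (p ^ j)) :
    A.assoc p j (x * y) = A.assoc p j x * A.assoc p j y := by
  have hj : 0 < p ^ j := pow_pos hp j
  refine tensor_pow_hom_ext hp hj (f := (A.assoc p j).comp (AddMonoidHom.mulRight y))
    (g := (AddMonoidHom.mulRight (A.assoc p j y)).comp (A.assoc p j)) (fun v => ?_) x
  refine tensor_pow_hom_ext hp hj (f := (A.assoc p j).comp (AddMonoidHom.mulLeft _))
    (g := (AddMonoidHom.mulLeft (A.assoc p j _)).comp (A.assoc p j)) (fun w => ?_) y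
  simp only [AddMonoidHom.comp_apply, AddMonoidHom.coe_mulLeft]
  have : (PiTensorProduct.tprod A.R fun a => PiTensorProduct.tprod A.R (v a)) *
      (PiTensorProduct.tprod A.R fun a => PiTensorProduct.tprod A.R (w a)) =
      (PiTensorProduct.tprod A.R fun a => PiTensorProduct.tprod A.R (v a * w a) :
        (A.tensor p).Pow (p ^ j)) := by
    rw [PiTensorProduct.tprod_mul_tprod]
    congr 1
    funext a
    exact PiTensorProduct.tprod_mul_tprod _ _
  rw [assoc_tprod hp, assoc_tprod hp]
  refine (congrArg (A.assoc p j) this).trans ?_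
  rw [assoc_tprod hp, PiTensorProduct.tprod_mul_tprod]
  rfl

/-- Rotating blocks of length `p` by one block is `p` steps of the rotation of all `p ^ (j+1)`
factors. -/
theorem assoc_rotate (hp : 0 < p) (j : ℕ) (x : (A.tensor p).Pow (p ^ j)) :
    A.assoc p j (rotate A.R _ x) = iter (rotate A.R _) p (A.assoc p j x) := by
  refine tensor_pow_hom_ext hp (pow_pos hp j) (f := (A.assoc p j).comp (rotate A.R _))
    (g := (iter (rotate A.R _) p).comp (A.assoc p j)) (fun v => ?_) x
  simp only [AddMonoidHom.comp_apply]
  rw [rotate_tprod, assoc_tprod hp, assoc_tprod hp, iter_apply,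
    rotate_iterate_tprod, shift_iterate_interleave]
  rfl

theorem assoc_surjective (hp : 0 < p) (j : ℕ) : Function.Surjective (A.assoc p j) := by
  intro x
  refine mem_of_tprod_mem closure_univ_eq_top (pow_pos hp (j + 1)) (A.assoc p j).range
    (fun m _ => ?_) x
  refine ⟨PiTensorProduct.tprod A.R fun a : Fin (p ^ j) => PiTensorProduct.tprod A.R
    fun b : Fin p => m (finProdFinEquiv (a, b)), ?_⟩
  refine (PiTensorProduct.lift.tprod (E := A.Pow (p ^ j * p)) _).trans
    ((concat_tprod A.R _).trans ?_)
  congr 1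
  funext c
  exact congrArg m (finProdFinEquiv.apply_symm_apply c)

theorem Hom.powHom_assoc (φ : Hom A B) (hp : 0 < p) (j : ℕ) (x : (A.tensor p).Pow (p ^ j)) :
    φ.powHom _ (A.assoc p j x) = B.assoc p j ((φ.tensor p).powHom _ x) := by
  refine tensor_pow_hom_ext hp (pow_pos hp j) (f := (φ.powHom _).toAddMonoidHom.comp (A.assoc p j))
    (g := (B.assoc p j).comp ((φ.tensor p).powHom _).toAddMonoidHom) (fun v => ?_) x
  change φ.powHom _ (A.assoc p j (PiTensorProduct.tprod A.R fun a =>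
    PiTensorProduct.tprod A.R (v a))) = B.assoc p j ((φ.tensor p).powHom _
      (PiTensorProduct.tprod A.R fun a => PiTensorProduct.tprod A.R (v a)))
  rw [assoc_tprod hp, powHom_tprod]
  refine Eq.trans ?_ (congrArg (B.assoc p j) ((φ.tensor p).powHom_tprod _)).symm
  have : (fun a => (φ.tensor p).map (PiTensorProduct.tprod A.R (v a))) =
      fun a => PiTensorProduct.tprod B.R fun b => φ.map (v a b) :=
    funext fun a => φ.powHom_tprod (v a)
  rw [this, assoc_tprod hp]
  rfl

/-! ### Ghost components -/

variable {n : ℕ}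

theorem Hom.powHom_ghost (φ : Hom A B) (hp : 0 < p) (x : A.W p n) (j : Fin n) :
    φ.powHom _ (ghost x j) = ghost (φ.W p n x) j := by
  refine (φ.powHom_fromCyc (pow_pos hp j) _).trans (congrArg (B.fromCyc _) ?_)
  induction x using Quot.ind with
  | mk a => exact φ.toBimod.cycPow_seqGhost a j

theorem Hom.powHom_tensorGhost (φ : Hom A B) (hp : 0 < p) (x : (A.tensor p).W p n) (j : Fin n) :
    φ.powHom _ (tensorGhost x j) = tensorGhost ((φ.tensor p).W p n x) j :=
  (φ.powHom_assoc hp j _).trans (congrArg (B.assoc p j) ((φ.tensor p).powHom_ghost hp x j))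

theorem ghost_mk_trunc (a : ∀ i : ℕ, A.toBimod.TPow (p ^ i)) (j : Fin n) :
    ghost (W.mk (Seq.trunc n a)) j = A.fromCyc _ (infGhost a j) :=
  congrArg (A.fromCyc _) (seqGhost_trunc a j)

theorem exists_eq_mk_trunc (x : A.W p n) : ∃ a, x = W.mk (Seq.trunc n a) := by
  induction x using Quot.ind with
  | mk a => exact ⟨Seq.ext a, congrArg W.mk (Seq.trunc_ext a).symm⟩

end AlgPair

/-! ### Bases over a tower -/

section SMul

variable {R P G ι Γ : Type*} [CommRing R] [AddCommGroup P] [Module R P] [AddCommGroup G]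
  (a : Module.Basis ι ℤ R) (b : Module.Basis Γ R P)

/-- The additive map with prescribed values on the products of the elements of a basis of the
scalars and a basis of the module. -/
def liftSMul (F : ι → Γ → G) : P →+ G :=
  ((a.smulTower b).constr ℤ fun x => F x.1 x.2).toAddMonoidHom

theorem liftSMul_apply (F : ι → Γ → G) (i : ι) (γ : Γ) : liftSMul a b F (a i • b γ) = F i γ := by
  have := (a.smulTower b).constr_basis ℤ (fun x => F x.1 x.2) (i, γ)
  rwa [Module.Basis.smulTower_apply] at this

theorem closure_smul :
    AddSubgroup.closure {x : P | ∃ r ∈ Set.range a, ∃ y ∈ Set.range b, r • y = x} = ⊤ := by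
  rw [← closure_range_basis (a.smulTower b)]
  congr 1
  ext x
  constructor
  · rintro ⟨_, ⟨i, rfl⟩, _, ⟨γ, rfl⟩, rfl⟩
    exact ⟨(i, γ), Module.Basis.smulTower_apply _ _ _⟩
  · rintro ⟨⟨i, γ⟩, rfl⟩
    exact ⟨_, ⟨i, rfl⟩, _, ⟨γ, rfl⟩, (Module.Basis.smulTower_apply a b (i, γ)).symm⟩

end SMul

namespace AlgPair

/-! ### Pairs with multiplicative bases -/

/-- A basis of `R` over the integers and a basis of `M` over `R` that are closed under
multiplication. -/
structure MulBasis (A : AlgPair.{u}) where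
  ι : Type u
  κ : Type u
  bR : Module.Basis ι ℤ A.R
  bM : Module.Basis κ A.R A.M
  SR : Submonoid A.R
  SM : Submonoid A.M
  range_bR : Set.range bR = SR
  range_bM : Set.range bM = SM

namespace MulBasis

variable {A : AlgPair.{u}} (𝔟 : MulBasis A)

/-- The basis of elementary tensors. -/
def pow (k : ℕ) : Module.Basis (Fin k → 𝔟.κ) A.R (A.Pow k) :=
  Basis.piTensorProduct fun _ : Fin k => 𝔟.bM

theorem pow_apply {k : ℕ} (f : Fin k → 𝔟.κ) :
    𝔟.pow k f = PiTensorProduct.tprod A.R fun i => 𝔟.bM (f i) :=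
  Basis.piTensorProduct_apply _ _

theorem range_pow (k : ℕ) : Set.range (𝔟.pow k) =
    {x | ∃ m : Fin k → A.M, (∀ i, m i ∈ 𝔟.SM) ∧ PiTensorProduct.tprod A.R m = x} := by
  ext x
  constructor
  · rintro ⟨f, rfl⟩
    exact ⟨_, fun i => (𝔟.range_bM ▸ Set.mem_range_self (f i) : 𝔟.bM (f i) ∈ (𝔟.SM : Set A.M)),
      (𝔟.pow_apply f).symm⟩
  · rintro ⟨m, hm, rfl⟩
    have hm' : ∀ i, m i ∈ Set.range 𝔟.bM := fun i => by rw [𝔟.range_bM]; exact hm i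
    choose f hf using hm'
    exact ⟨f, by rw [𝔟.pow_apply, funext hf]⟩

/-- The elementary tensors form a multiplicative basis. -/
def tensor (k : ℕ) : MulBasis (A.tensor k) where
  ι := 𝔟.ι
  κ := Fin k → 𝔟.κ
  bR := 𝔟.bR
  bM := 𝔟.pow k
  SR := 𝔟.SR
  SM :=
    { carrier := {x | ∃ m : Fin k → A.M, (∀ i, m i ∈ 𝔟.SM) ∧ PiTensorProduct.tprod A.R m = x}
      mul_mem' := by
        rintro _ _ ⟨m, hm, rfl⟩ ⟨l, hl, rfl⟩
        exact ⟨m * l, fun i => mul_mem (hm i) (hl i), (PiTensorProduct.tprod_mul_tprod m l).symm⟩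
      one_mem' := ⟨1, fun _ => one_mem _, rfl⟩ }
  range_bR := 𝔟.range_bR
  range_bM := 𝔟.range_pow k

theorem closure_mono :
    AddSubgroup.closure {x : A.M | ∃ r ∈ 𝔟.SR, ∃ y ∈ 𝔟.SM, r • y = x} = ⊤ := by
  have := closure_smul 𝔟.bR 𝔟.bM
  rwa [𝔟.range_bR, 𝔟.range_bM] at this

theorem pow_hom_ext {G : Type*} [AddCommGroup G] {k : ℕ} {f g : A.Pow k →+ G}
    (h : ∀ r ∈ 𝔟.SR, ∀ m : Fin k → A.M, (∀ i, m i ∈ 𝔟.SM) →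
      f (r • PiTensorProduct.tprod A.R m) = g (r • PiTensorProduct.tprod A.R m)) (x : A.Pow k) :
    f x = g x := by
  have hx : x ∈ AddSubgroup.closure {x : A.Pow k | ∃ r ∈ 𝔟.SR, ∃ y ∈ (𝔟.tensor k).SM, r • y = x} :=
    (𝔟.tensor k).closure_mono ▸ AddSubgroup.mem_top x
  refine (AddSubgroup.closure_le (AddMonoidHom.eqLocus f g)).2 ?_ hx
  rintro _ ⟨r, hr, _, ⟨m, hm, rfl⟩, rfl⟩
  exact h r hr m hm

theorem torsionFree (𝔟 : MulBasis A) : IsAddTorsionFree A.R :=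
  𝔟.bR.repr.injective.isAddTorsionFree 𝔟.bR.repr.toLinearMap.toAddMonoidHom

/-- The elementary tensors of basis elements form an `R`-basis permuted by rotation, and `R` is
torsion-free because it is free over `ℤ`. -/
theorem transferExact (𝔟 : MulBasis A) (p n : ℕ) (hp : 0 < p) : A.toBimod.TransferExact p n := by
  intro j _ x hx
  have hk : 0 < p ^ j := pow_pos hp j
  have := 𝔟.torsionFree
  obtain ⟨e, he⟩ := exists_sub_of_transfer_eq_zero (𝔟.pow (p ^ j)) (rotate A.R (p ^ j))
    (shift (p ^ j) 𝔟.κ) hk (fun r f => by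
      rw [rotate_smul, 𝔟.pow_apply, 𝔟.pow_apply, rotate_tprod]
      rfl) (fun f => shift_iterate_self hk f) (A.fromCyc _ x) (by
      rw [← map_transfer (A.toBimod.cycRotate _) _ (A.fromCyc _) (fromCyc_rotate hk), hx, map_zero])
  obtain ⟨e, rfl⟩ := fromCyc_surjective hk e
  refine ⟨e, fromCyc_injective hk ?_⟩
  rw [he, map_sub, fromCyc_rotate hk]

theorem ghost_injective (𝔟 : MulBasis A) {p n : ℕ} [hp : Fact p.Prime] {x y : A.W p n}
    (h : ∀ j, ghost x j = ghost y j) : x = y :=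
  Bimod.ghost_injective (𝔟.transferExact p n hp.out.pos) fun j =>
    fromCyc_injective (pow_pos hp.out.pos j) (h j)

/-- On bases concatenation is a bijection of index sets, inverted by cutting a tuple into blocks. -/
theorem assoc_injective (𝔟 : MulBasis A) {p : ℕ} (j : ℕ) : Function.Injective (A.assoc p j) := by
  let u : (Fin (p ^ j * p) → 𝔟.κ) → (Fin (p ^ j) → Fin p → 𝔟.κ) :=
    fun f a b => f (finProdFinEquiv (a, b))
  let inv : A.Pow (p ^ j * p) →ₗ[A.R] (A.tensor p).Pow (p ^ j) :=
    (𝔟.pow (p ^ j * p)).constr A.R fun f => (𝔟.tensor p).pow (p ^ j) (u f)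
  have key : inv.comp (PiTensorProduct.lift (concat A.R A.M (p ^ j) p)) = LinearMap.id := by
    refine ((𝔟.tensor p).pow (p ^ j)).ext fun f => ?_
    have h1 : PiTensorProduct.lift (concat A.R A.M (p ^ j) p) ((𝔟.tensor p).pow (p ^ j) f) =
        𝔟.pow (p ^ j * p) (fun c => f (finProdFinEquiv.symm c).1 (finProdFinEquiv.symm c).2) := by
      rw [pow_apply, 𝔟.pow_apply]
      refine (PiTensorProduct.lift.tprod _).trans ?_
      have : (fun i => (𝔟.tensor p).bM (f i)) = fun i => PiTensorProduct.tprod A.R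
          fun b => 𝔟.bM (f i b) := funext fun i => 𝔟.pow_apply (f i)
      rw [this, concat_tprod]
    rw [LinearMap.comp_apply, h1, Module.Basis.constr_basis]
    refine congrArg _ ?_
    funext a b
    simp only [u, Equiv.symm_apply_apply]
  exact Function.LeftInverse.injective (g := inv) fun x => DFunLike.congr_fun key x

theorem tensorGhost_injective (𝔟 : MulBasis A) {p n : ℕ} [Fact p.Prime] {x y : (A.tensor p).W p n}
    (h : ∀ j, tensorGhost x j = tensorGhost y j) : x = y :=
  (𝔟.tensor p).ghost_injective fun j => 𝔟.assoc_injective j (h j)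

/-! ### Lifts of the Frobenius -/

/-- The Frobenius lift as an additive map. -/
def frobAdd {k : ℕ} (hk : 0 < k) (p : ℕ) : A.Pow k →+ A.Pow (k * p) :=
  liftSMul 𝔟.bR (𝔟.pow k) fun i f =>
    𝔟.bR i ^ p • PiTensorProduct.tprod A.R (rep hk (k * p) fun i => 𝔟.bM (f i))

/-- The `p`-th power of `r` is forced: a scalar spread over the factors of a tensor is repeated
together with them. -/
theorem frobAdd_smul_tprod {k : ℕ} (hk : 0 < k) (p : ℕ) {r : A.R} (hr : r ∈ 𝔟.SR) (m : Fin k → A.M)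
    (hm : ∀ i, m i ∈ 𝔟.SM) : 𝔟.frobAdd hk p (r • PiTensorProduct.tprod A.R m) =
      r ^ p • PiTensorProduct.tprod A.R (rep hk (k * p) m) := by
  have hr' : r ∈ Set.range 𝔟.bR := by rw [𝔟.range_bR]; exact hr
  have hm' : ∀ i, m i ∈ Set.range 𝔟.bM := fun i => by rw [𝔟.range_bM]; exact hm i
  obtain ⟨i, rfl⟩ := hr'
  choose f hf using hm'
  obtain rfl : (fun i => 𝔟.bM (f i)) = m := funext hf
  rw [← 𝔟.pow_apply, frobAdd, liftSMul_apply]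

/-- The lift of the Frobenius that repeats elementary tensors of basis elements. -/
def frob {k : ℕ} (hk : 0 < k) (p : ℕ) : A.Pow k →+* A.Pow (k * p) where
  toFun := 𝔟.frobAdd hk p
  map_zero' := map_zero _
  map_add' := map_add _
  map_one' := by
    have h : (1 : A.Pow k) = (1 : A.R) • PiTensorProduct.tprod A.R 1 := (one_smul _ _).symm
    rw [h, 𝔟.frobAdd_smul_tprod hk p (one_mem _) 1 fun _ => one_mem _, one_pow, one_smul]
    rfl
  -- Multiplicativity is checked on monomials; this is why the bases have to be closed under
  -- products.
  map_mul' x y := by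
    refine 𝔟.pow_hom_ext (f := (𝔟.frobAdd hk p).comp (AddMonoidHom.mulRight y))
      (g := (AddMonoidHom.mulRight (𝔟.frobAdd hk p y)).comp (𝔟.frobAdd hk p)) ?_ x
    intro r hr m hm
    refine 𝔟.pow_hom_ext (f := (𝔟.frobAdd hk p).comp
        (AddMonoidHom.mulLeft (r • PiTensorProduct.tprod A.R m)))
      (g := (AddMonoidHom.mulLeft (𝔟.frobAdd hk p (r • PiTensorProduct.tprod A.R m))).comp
        (𝔟.frobAdd hk p)) ?_ y
    intro s hs l hl
    simp only [AddMonoidHom.comp_apply, AddMonoidHom.coe_mulLeft]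
    rw [smul_mul_smul_comm, PiTensorProduct.tprod_mul_tprod, 𝔟.frobAdd_smul_tprod hk p hr m hm,
      𝔟.frobAdd_smul_tprod hk p hs l hl, 𝔟.frobAdd_smul_tprod hk p (mul_mem hr hs) (m * l)
        fun i => mul_mem (hm i) (hl i), smul_mul_smul_comm, PiTensorProduct.tprod_mul_tprod,
      mul_pow]
    rfl

theorem frob_smul_tprod {k : ℕ} (hk : 0 < k) (p : ℕ) {r : A.R} (hr : r ∈ 𝔟.SR) (m : Fin k → A.M)
    (hm : ∀ i, m i ∈ 𝔟.SM) : 𝔟.frob hk p (r • PiTensorProduct.tprod A.R m) =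
      r ^ p • PiTensorProduct.tprod A.R (rep hk (k * p) m) :=
  𝔟.frobAdd_smul_tprod hk p hr m hm

theorem frob_rotate {k : ℕ} (hk : 0 < k) (p : ℕ) (x : A.Pow k) :
    𝔟.frob hk p (rotate A.R k x) = rotate A.R (k * p) (𝔟.frob hk p x) := by
  refine 𝔟.pow_hom_ext (f := (𝔟.frobAdd hk p).comp (rotate A.R k))
    (g := (rotate A.R (k * p)).comp (𝔟.frobAdd hk p)) ?_ x
  intro r hr m hm
  simp only [AddMonoidHom.comp_apply]
  rw [rotate_smul, rotate_tprod, 𝔟.frobAdd_smul_tprod hk p hr m hm,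
    𝔟.frobAdd_smul_tprod hk p hr _ fun i => hm _, rotate_smul, rotate_tprod]
  congr 2
  exact (shift_rep hk (Dvd.intro _ rfl) m).symm

/-! ### The two towers of a pair with a multiplicative basis -/

variable (p : ℕ) [hp : Fact p.Prime]

/-- The tower of tensor powers of a pair with a multiplicative basis. -/
def tower : Tower A.toBimod p where
  P j := A.Pow (p ^ j)
  σ j := rotate A.R (p ^ j)
  c j := A.fromCyc (p ^ j)
  c_rotate j := fromCyc_rotate (pow_pos hp.out.pos j)
  c_surjective j := fromCyc_surjective (pow_pos hp.out.pos j)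
  ψ j := (𝔟.frob (pow_pos hp.out.pos j) p).toAddMonoidHom
  mono := {x : A.M | ∃ r ∈ 𝔟.SR, ∃ y ∈ 𝔟.SM, r • y = x}
  closure_mono := 𝔟.closure_mono
  ψ_mono j m hm := by
    choose r hr y hy hm using hm
    obtain rfl : (fun i => r i • y i : Fin (p ^ j) → A.M) = m := funext hm
    have h1 := fromCyc_mkC (A := A) fun i => r i • y i
    have h2 := fromCyc_mkC (A := A) (rep (pow_pos hp.out.pos j) (p ^ (j + 1)) fun i => r i • y i)
    refine (congrArg _ h1).trans (Eq.trans ?_ h2.symm)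
    have h3 : rep (pow_pos hp.out.pos j) (p ^ (j + 1)) (fun i => r i • y i) =
      fun c => rep (pow_pos hp.out.pos j) (p ^ (j + 1)) r c •
        rep (pow_pos hp.out.pos j) (p ^ (j + 1)) y c := rfl
    -- The scalars of all factors are collected in front. Over the repeated tuple their product is
    -- the `p`-th power of the product over one period.
    rw [h3, MultilinearMap.map_smul_univ, MultilinearMap.map_smul_univ]
    refine (𝔟.frob_smul_tprod _ p (prod_mem fun i _ => hr i) y hy).trans ?_
    rw [← prod_rep]
    rfl

/-- The tower of tensor powers of the tensor power of a pair with a multiplicative basis. -/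
def tensorTower : Tower (A.tensor p).toBimod p where
  P j := A.Pow (p ^ (j + 1))
  σ j := iter (rotate A.R (p ^ (j + 1))) p
  c j := (A.assoc p j).comp ((A.tensor p).fromCyc (p ^ j))
  c_rotate j x := (congrArg (A.assoc p j) (fromCyc_rotate (pow_pos hp.out.pos j) x)).trans
    (assoc_rotate hp.out.pos j _)
  c_surjective j := (assoc_surjective hp.out.pos j).comp
    (fromCyc_surjective (pow_pos hp.out.pos j))
  ψ j := (𝔟.frob (pow_pos hp.out.pos (j + 1)) p).toAddMonoidHom
  mono := {x : A.Pow p | ∃ r ∈ 𝔟.SR, ∃ y ∈ (𝔟.tensor p).SM, r • y = x}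
  closure_mono := (𝔟.tensor p).closure_mono
  ψ_mono j m hm := by
    choose r hr y hy hm using hm
    choose z hz hy using hy
    obtain rfl : (fun i => PiTensorProduct.tprod A.R (z i)) = y := funext hy
    obtain rfl : (fun i => r i • PiTensorProduct.tprod A.R (z i) : Fin (p ^ j) → A.Pow p) = m :=
      funext hm
    -- Monomial tensors of length `p` concatenate to monomial tensors of length `p ^ (j+1)`, so the
    -- Frobenius lift on the tensor powers of `M` also serves those of `M^{⊗ p}`.
    have key : ∀ j (r : Fin (p ^ j) → A.R) (z : Fin (p ^ j) → Fin p → A.M),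
        A.assoc p j ((A.tensor p).fromCyc _ (mkC (A.tensor p).toBimod
          fun i => r i • PiTensorProduct.tprod A.R (z i))) =
        (∏ i, r i) • PiTensorProduct.tprod A.R (interleave hp.out.pos (pow_succ p j).symm z) := by
      intro j r z
      have h1 := fromCyc_mkC (A := A.tensor p) fun i => r i • PiTensorProduct.tprod A.R (z i)
      refine (congrArg (A.assoc p j) h1).trans ?_
      rw [← assoc_tprod hp.out.pos, ← assoc_smul]
      exact congrArg (A.assoc p j) (MultilinearMap.map_smul_univ _ _ _)
    refine (congrArg _ (key j r z)).trans (Eq.trans ?_ (key (j + 1)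
      (rep (pow_pos hp.out.pos j) _ r) (rep (pow_pos hp.out.pos j) _ z)).symm)
    refine (𝔟.frob_smul_tprod _ p (prod_mem fun i _ => hr i) _ fun i => hz _ _).trans ?_
    rw [← prod_rep (pow_pos hp.out.pos j)]
    congr 2
    exact (interleave_rep hp.out.pos (pow_pos hp.out.pos j) _
      (pow_succ p j).symm _ z).symm

end MulBasis

end AlgPair

namespace AlgPair

/-! ### Polynomial pairs -/

/-- The free pair on a pair of sets: polynomials over a polynomial ring. -/
def poly (X Y : Type u) : AlgPair.{u} where
  R := MvPolynomial X ℤ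
  M := MvPolynomial Y (MvPolynomial X ℤ)

namespace poly

variable {X Y : Type u}

/-- The generator of the ring. -/
def var (x : X) : (poly X Y).R := (MvPolynomial.X x : MvPolynomial X ℤ)

/-- The generator of the algebra. -/
def gen (y : Y) : (poly X Y).M := (MvPolynomial.X y : MvPolynomial Y (MvPolynomial X ℤ))

/-- The universal property of the free pair. -/
def lift (B : AlgPair.{u}) (g : X → B.R) (h : Y → B.M) : Hom (poly X Y) B where
  base := (MvPolynomial.eval₂Hom (Int.castRingHom B.R) g : MvPolynomial X ℤ →+* B.R)
  map := (MvPolynomial.eval₂Hom ((algebraMap B.R B.M).comp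
    (MvPolynomial.eval₂Hom (Int.castRingHom B.R) g)) h :
      MvPolynomial Y (MvPolynomial X ℤ) →+* B.M)
  comm r := MvPolynomial.eval₂Hom_C _ _ r

theorem lift_var (B : AlgPair.{u}) (g : X → B.R) (h : Y → B.M) (x : X) :
    (lift B g h).base (var x) = g x :=
  MvPolynomial.eval₂Hom_X' _ _ x

theorem lift_gen (B : AlgPair.{u}) (g : X → B.R) (h : Y → B.M) (y : Y) :
    (lift B g h).map (gen y) = h y :=
  MvPolynomial.eval₂Hom_X' _ _ y

theorem hom_ext {B : AlgPair.{u}} {φ ψ : Hom (poly X Y) B}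
    (h1 : ∀ x : X, φ.base (var x) = ψ.base (var x))
    (h2 : ∀ y : Y, φ.map (gen y) = ψ.map (gen y)) : φ = ψ := by
  have hb : φ.base = ψ.base := MvPolynomial.ringHom_ext (fun r => by
    exact (map_intCast φ.base r).trans (map_intCast ψ.base r).symm) h1
  refine Hom.ext' hb (MvPolynomial.ringHom_ext (fun r => ?_) h2)
  exact (φ.comm r).trans (by rw [hb]; exact (ψ.comm r).symm)

/-- The monomials, as a submonoid. -/
def monomials (σ R : Type*) [CommRing R] : Submonoid (MvPolynomial σ R) where
  carrier := Set.range fun s => MvPolynomial.monomial s 1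
  mul_mem' := by
    rintro _ _ ⟨s, rfl⟩ ⟨t, rfl⟩
    exact ⟨s + t, by simp [MvPolynomial.monomial_mul]⟩
  one_mem' := ⟨0, rfl⟩

theorem range_basisMonomials (σ R : Type*) [CommRing R] :
    Set.range (MvPolynomial.basisMonomials σ R) = monomials σ R := by
  rw [MvPolynomial.coe_basisMonomials]
  rfl

/-- The multiplicative basis of monomials. -/
def mulBasis (X Y : Type u) : MulBasis (poly X Y) where
  ι := X →₀ ℕ
  κ := Y →₀ ℕ
  bR := MvPolynomial.basisMonomials X ℤ
  bM := MvPolynomial.basisMonomials Y (MvPolynomial X ℤ)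
  SR := monomials X ℤ
  SM := monomials Y (MvPolynomial X ℤ)
  range_bR := range_basisMonomials X ℤ
  range_bM := range_basisMonomials Y (MvPolynomial X ℤ)

end poly

/-! ### The polynomial cover of a pair -/

variable (A : AlgPair.{u})

/-- The free pair on the underlying pair of sets. -/
def cov : AlgPair.{u} := poly A.R A.M

/-- The multiplicative basis of monomials of the polynomial cover. -/
def covBasis : MulBasis A.cov := poly.mulBasis A.R A.M

/-- The counit of the polynomial cover. -/
def covCounit : Hom A.cov A := poly.lift A _root_.id _root_.id

/-- Functoriality of the polynomial cover. -/
def Hom.cov {A B : AlgPair.{u}} (φ : Hom A B) : Hom A.cov B.cov :=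
  poly.lift B.cov (fun r => poly.var (φ.base r)) fun m => poly.gen (φ.map m)

/-- The common section of the two maps of the canonical presentation. -/
def covSection : Hom A.cov A.cov.cov :=
  poly.lift A.cov.cov (fun r => poly.var (poly.var r : (poly A.R A.M).R))
    fun m => poly.gen (poly.gen m : (poly A.R A.M).M)

variable {A}

theorem covCounit_var (x : A.R) : A.covCounit.base (poly.var x : (poly A.R A.M).R) = x :=
  poly.lift_var A _ _ x

theorem covCounit_gen (x : A.M) : A.covCounit.map (poly.gen x : (poly A.R A.M).M) = x :=
  poly.lift_gen A _ _ x

theorem Hom.cov_var {B : AlgPair.{u}} (φ : Hom A B) (x : A.R) :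
    φ.cov.base (poly.var x : (poly A.R A.M).R) = (poly.var (φ.base x) : (poly B.R B.M).R) :=
  poly.lift_var B.cov _ _ x

theorem Hom.cov_gen {B : AlgPair.{u}} (φ : Hom A B) (x : A.M) :
    φ.cov.map (poly.gen x : (poly A.R A.M).M) = (poly.gen (φ.map x) : (poly B.R B.M).M) :=
  poly.lift_gen B.cov _ _ x

theorem covSection_var (x : A.R) : A.covSection.base (poly.var x : (poly A.R A.M).R) =
    (poly.var (poly.var x : (poly A.R A.M).R) : (poly A.cov.R A.cov.M).R) :=
  poly.lift_var A.cov.cov _ _ x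

theorem covSection_gen (x : A.M) : A.covSection.map (poly.gen x : (poly A.R A.M).M) =
    (poly.gen (poly.gen x : (poly A.R A.M).M) : (poly A.cov.R A.cov.M).M) :=
  poly.lift_gen A.cov.cov _ _ x

theorem Hom.comp_covCounit {B : AlgPair.{u}} (φ : Hom A B) :
    φ.comp A.covCounit = B.covCounit.comp φ.cov := by
  refine poly.hom_ext (fun x => ?_) fun x => ?_
  · exact (congrArg φ.base (covCounit_var x)).trans
      ((covCounit_var (φ.base x)).symm.trans (congrArg B.covCounit.base (φ.cov_var x).symm))
  · exact (congrArg φ.map (covCounit_gen x)).trans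
      ((covCounit_gen (φ.map x)).symm.trans (congrArg B.covCounit.map (φ.cov_gen x).symm))

theorem covCounit_comp_covSection : A.cov.covCounit.comp A.covSection = Hom.id A.cov := by
  refine poly.hom_ext (fun x => ?_) fun x => ?_
  · exact (congrArg A.cov.covCounit.base (covSection_var x)).trans (covCounit_var (A := A.cov) _)
  · exact (congrArg A.cov.covCounit.map (covSection_gen x)).trans (covCounit_gen (A := A.cov) _)

theorem cov_covCounit_comp_covSection : A.covCounit.cov.comp A.covSection = Hom.id A.cov := by
  refine poly.hom_ext (fun x => ?_) fun x => ?_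
  · refine (congrArg A.covCounit.cov.base (covSection_var x)).trans ?_
    exact (A.covCounit.cov_var _).trans (congrArg poly.var (covCounit_var x))
  · refine (congrArg A.covCounit.cov.map (covSection_gen x)).trans ?_
    exact (A.covCounit.cov_gen _).trans (congrArg poly.gen (covCounit_gen x))

theorem covCounit_surjective : Function.Surjective A.covCounit.map := fun x =>
  ⟨_, covCounit_gen x⟩

/-- Every element of the kernel of the counit is a difference of values of the two parallel maps. -/
theorem exists_of_covCounit_eq_zero (d : A.cov.M) (hd : A.covCounit.map d = 0) :
    ∃ e, A.cov.covCounit.map e = d ∧ A.covCounit.cov.map e = 0 := by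
  -- With free generators `[d]` and `[0]`, the element `[d] - [0]` is mapped to `d - 0` by the
  -- counit and to `[ε d] - [0] = 0` by the other map.
  refine ⟨(poly.gen d : (poly A.cov.R A.cov.M).M) - (poly.gen 0 : (poly A.cov.R A.cov.M).M), ?_, ?_⟩
  · refine (map_sub A.cov.covCounit.map _ _).trans ?_
    rw [covCounit_gen, covCounit_gen, sub_zero]
  · refine (map_sub A.covCounit.cov.map _ _).trans ?_
    rw [Hom.cov_gen, Hom.cov_gen, hd, map_zero]
    exact sub_self _

variable (A)

/-- The canonical presentation of a commutative pair. -/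
def presentation : Presentation A.cov.cov.toBimod A.cov.toBimod A.toBimod where
  f := A.cov.covCounit.toBimod
  g := A.covCounit.cov.toBimod
  ε := A.covCounit.toBimod
  s := A.covSection.toBimod
  f_s := congrArg Hom.toBimod (covCounit_comp_covSection (A := A))
  g_s := congrArg Hom.toBimod (cov_covCounit_comp_covSection (A := A))
  ε_f := congrArg Hom.toBimod A.covCounit.comp_covCounit
  base_surjective x := ⟨_, covCounit_var x⟩
  map_surjective x := ⟨_, covCounit_gen x⟩
  ker := exists_of_covCounit_eq_zero

theorem Hom.powHom_surjective {A B : AlgPair.{u}} (φ : Hom A B) (h : Function.Surjective φ.map)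
    {k : ℕ} (hk : 0 < k) : Function.Surjective (φ.powHom k) := by
  intro x
  refine mem_of_tprod_mem closure_univ_eq_top hk (φ.powHom k).toAddMonoidHom.range (fun m _ => ?_) x
  choose l hl using fun i => h (m i)
  obtain rfl : (fun i => φ.map (l i)) = m := funext hl
  exact ⟨_, φ.powHom_tprod l⟩

/-- The kernel condition for the tensor power is right exactness of tensor powers, applied to the
presentation of the pair itself. -/
theorem exists_of_powHom_covCounit_eq_zero {k : ℕ} (hk : 0 < k) (d : A.cov.Pow k)
    (hd : A.covCounit.powHom k d = 0) :
    ∃ e, A.cov.covCounit.powHom k e = d ∧ A.covCounit.cov.powHom k e = 0 := by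
  obtain ⟨z, h1, h2⟩ := A.presentation.exists_of_tPow_eq_zero hk (A.cov.toT hk d) (by
    have h := A.covCounit.powHom_fromT hk (A.cov.toT hk d)
    rw [fromT_toT, hd] at h
    have := congrArg (A.toT hk) h
    rw [toT_fromT, map_zero] at this
    exact this.symm)
  refine ⟨A.cov.cov.fromT k z, ?_, ?_⟩
  · refine (A.cov.covCounit.powHom_fromT hk z).trans ?_
    exact (congrArg (A.cov.fromT k) h1).trans (fromT_toT hk d)
  · refine (A.covCounit.cov.powHom_fromT hk z).trans ?_
    exact (congrArg (A.cov.fromT k) h2).trans (map_zero _)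

/-- The presentation of the tensor power of a commutative pair. -/
def tensorPresentation {k : ℕ} (hk : 0 < k) : Presentation (A.cov.cov.tensor k).toBimod
    (A.cov.tensor k).toBimod (A.tensor k).toBimod where
  f := (A.cov.covCounit.tensor k).toBimod
  g := (A.covCounit.cov.tensor k).toBimod
  ε := (A.covCounit.tensor k).toBimod
  s := (A.covSection.tensor k).toBimod
  f_s := congrArg Hom.toBimod ((Hom.tensor_comp _ _ k).symm.trans
    ((congrArg (fun φ => Hom.tensor φ k) (covCounit_comp_covSection (A := A))).trans
      (Hom.tensor_id k)))
  g_s := congrArg Hom.toBimod ((Hom.tensor_comp _ _ k).symm.trans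
    ((congrArg (fun φ => Hom.tensor φ k) (cov_covCounit_comp_covSection (A := A))).trans
      (Hom.tensor_id k)))
  ε_f := congrArg Hom.toBimod ((Hom.tensor_comp _ _ k).symm.trans
    ((congrArg (fun φ => Hom.tensor φ k) A.covCounit.comp_covCounit).trans
      (Hom.tensor_comp _ _ k)))
  base_surjective x := ⟨_, covCounit_var x⟩
  map_surjective := A.covCounit.powHom_surjective covCounit_surjective hk
  ker := A.exists_of_powHom_covCounit_eq_zero hk

/-! ### Natural transformations from ghost components -/

/-- A functor from commutative pairs to sets. -/
structure SetFunctor where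
  obj : AlgPair.{u} → Type u
  map : ∀ {A B : AlgPair.{u}}, Hom A B → obj A → obj B
  map_id : ∀ {A : AlgPair.{u}} (x : obj A), map (Hom.id A) x = x
  map_comp : ∀ {A B C : AlgPair.{u}} (ψ : Hom B C) (φ : Hom A B) (x : obj A),
    map (ψ.comp φ) x = map ψ (map φ x)

/-- A functor is presentable if it turns the canonical presentation of every pair into a
coequalizer. -/
structure SetFunctor.Presentable (S : SetFunctor.{u}) : Prop where
  surjective : ∀ A : AlgPair.{u}, Function.Surjective (S.map A.covCounit)
  eqvGen : ∀ (A : AlgPair.{u}) (x y : S.obj A.cov), S.map A.covCounit x = S.map A.covCounit y →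
    Relation.EqvGen
      (fun u v => ∃ z, S.map A.cov.covCounit z = u ∧ S.map A.covCounit.cov z = v) x y

theorem SetFunctor.map_eq_map {S : SetFunctor.{u}} {A B B' C : AlgPair.{u}} {φ : Hom A B}
    {ψ : Hom B C} {φ' : Hom A B'} {ψ' : Hom B' C} (h : ψ.comp φ = ψ'.comp φ') (x : S.obj A) :
    S.map ψ (S.map φ x) = S.map ψ' (S.map φ' x) := by
  rw [← S.map_comp, h, S.map_comp]

/-- The product of two functors. -/
def SetFunctor.prod (S T : SetFunctor.{u}) : SetFunctor.{u} where
  obj A := S.obj A × T.obj A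
  map φ x := (S.map φ x.1, T.map φ x.2)
  map_id x := by rw [S.map_id, T.map_id]
  map_comp ψ φ x := by rw [S.map_comp, T.map_comp]

theorem eqvGen_map {α β : Type*} {r : α → α → Prop} {s : β → β → Prop} (f : α → β)
    (hf : ∀ a b, r a b → s (f a) (f b)) {a b : α} (h : Relation.EqvGen r a b) :
    Relation.EqvGen s (f a) (f b) := by
  induction h with
  | rel a b h => exact Relation.EqvGen.rel _ _ (hf a b h)
  | refl a => exact Relation.EqvGen.refl _
  | symm a b _ ih => exact Relation.EqvGen.symm _ _ ih
  | trans a b c _ _ ih1 ih2 => exact Relation.EqvGen.trans _ _ _ ih1 ih2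

theorem SetFunctor.map_covSection (S : SetFunctor.{u}) {A : AlgPair.{u}} (x : S.obj A.cov) :
    S.map A.cov.covCounit (S.map A.covSection x) = x ∧
      S.map A.covCounit.cov (S.map A.covSection x) = x := by
  rw [← S.map_comp, ← S.map_comp, covCounit_comp_covSection, cov_covCounit_comp_covSection,
    S.map_id]
  exact ⟨rfl, rfl⟩

theorem SetFunctor.Presentable.prod {S T : SetFunctor.{u}} (hS : S.Presentable)
    (hT : T.Presentable) : (S.prod T).Presentable where
  surjective A x := by
    obtain ⟨y, hy⟩ := hS.surjective A x.1
    obtain ⟨z, hz⟩ := hT.surjective A x.2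
    exact ⟨(y, z), Prod.ext hy hz⟩
  eqvGen A x y h := by
    have h1 := hS.eqvGen A x.1 y.1 (congrArg Prod.fst h)
    have h2 := hT.eqvGen A x.2 y.2 (congrArg Prod.snd h)
    -- The coordinates are moved one after the other. The coordinate at rest is carried along by the
    -- common section, so reflexivity enters here.
    refine Relation.EqvGen.trans _ (y.1, x.2) _ (eqvGen_map (fun a => (a, x.2)) ?_ h1)
      (eqvGen_map (fun a => (y.1, a)) ?_ h2)
    · rintro _ _ ⟨z, rfl, rfl⟩
      exact ⟨(z, T.map A.covSection x.2), Prod.ext rfl (T.map_covSection _).1,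
        Prod.ext rfl (T.map_covSection _).2⟩
    · rintro _ _ ⟨z, rfl, rfl⟩
      exact ⟨(S.map A.covSection y.1, z), Prod.ext (S.map_covSection _).1 rfl,
        Prod.ext (S.map_covSection _).2 rfl⟩

/-- A natural ghost map that is injective on pairs with a multiplicative basis. -/
structure SetFunctor.Ghost (T : SetFunctor.{u}) where
  G : AlgPair.{u} → Type u
  gmap : ∀ {A B : AlgPair.{u}}, Hom A B → G A → G B
  ghost : ∀ {A : AlgPair.{u}}, T.obj A → G A
  natural : ∀ {A B : AlgPair.{u}} (φ : Hom A B) (x : T.obj A),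
    gmap φ (ghost x) = ghost (T.map φ x)
  injective : ∀ {A : AlgPair.{u}}, MulBasis A → Function.Injective (ghost : T.obj A → G A)

/-- A family of maps is natural. -/
def SetFunctor.IsNatural (S T : SetFunctor.{u}) (θ : ∀ A : AlgPair.{u}, S.obj A → T.obj A) : Prop :=
  ∀ (A B : AlgPair.{u}) (φ : Hom A B) (x : S.obj A), T.map φ (θ A x) = θ B (S.map φ x)

/-- Natural transformations are determined by their ghost components. -/
theorem SetFunctor.Ghost.ext {S T : SetFunctor.{u}} (γ : T.Ghost) (hS : S.Presentable)
    {θ θ' : ∀ A : AlgPair.{u}, S.obj A → T.obj A} (hθ : S.IsNatural T θ) (hθ' : S.IsNatural T θ')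
    (h : ∀ A x, γ.ghost (θ A x) = γ.ghost (θ' A x)) : θ = θ' := by
  funext A x
  -- Every element comes from the polynomial cover, where ghost components suffice.
  obtain ⟨y, rfl⟩ := hS.surjective A x
  rw [← hθ, ← hθ', γ.injective A.covBasis (h _ y)]

/-- A natural transformation to ghost components lifts if it lifts on pairs with a multiplicative
basis. -/
theorem SetFunctor.Ghost.exists_lift {S T : SetFunctor.{u}} (γ : T.Ghost) (hS : S.Presentable)
    (Θ : ∀ A : AlgPair.{u}, S.obj A → γ.G A)
    (hΘ : ∀ (A B : AlgPair.{u}) (φ : Hom A B) (x : S.obj A), γ.gmap φ (Θ A x) = Θ B (S.map φ x))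
    (hex : ∀ (A : AlgPair.{u}), MulBasis A → ∀ x : S.obj A, ∃ t, γ.ghost t = Θ A x) :
    ∃ θ : ∀ A : AlgPair.{u}, S.obj A → T.obj A, S.IsNatural T θ ∧
      ∀ A x, γ.ghost (θ A x) = Θ A x := by
  have hnat : ∀ {A B : AlgPair.{u}} (φ : Hom A B) {x : S.obj A} {t : T.obj A},
      γ.ghost t = Θ A x → γ.ghost (T.map φ t) = Θ B (S.map φ x) := fun φ x t h => by
    rw [← γ.natural, h, hΘ]
  -- On the polynomial cover the value is the only one with the right ghost components. What has to
  -- be shown is that its image over `A` depends only on the image of the argument.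
  choose t ht using fun A : AlgPair.{u} => hex A.cov A.covBasis
  have hwd : ∀ A (x y : S.obj A.cov), S.map A.covCounit x = S.map A.covCounit y →
      T.map A.covCounit (t A x) = T.map A.covCounit (t A y) := by
    intro A x y h
    have h' := hS.eqvGen A x y h
    induction h' with
    | rel u v huv =>
      obtain ⟨z, rfl, rfl⟩ := huv
      -- The parallel maps send a value `w` for `z` to the two chosen values, by injectivity of the
      -- ghost map on the cover; and they become equal after the counit.
      obtain ⟨w, hw⟩ := hex A.cov.cov A.cov.covBasis z
      have h1 : t A (S.map A.cov.covCounit z) = T.map A.cov.covCounit w :=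
        γ.injective A.covBasis (by rw [ht, hnat A.cov.covCounit hw])
      have h2 : t A (S.map A.covCounit.cov z) = T.map A.covCounit.cov w :=
        γ.injective A.covBasis (by rw [ht, hnat A.covCounit.cov hw])
      rw [h1, h2]
      exact SetFunctor.map_eq_map A.covCounit.comp_covCounit w
    | refl u => rfl
    | symm u v huv ih => exact (ih h.symm).symm
    | trans u v w huv hvw ih1 ih2 =>
      -- The intermediate point of a chain has the same image as its ends, so the induction
      -- hypotheses apply.
      have key : ∀ {u v : S.obj A.cov}, Relation.EqvGen
          (fun u v => ∃ z, S.map A.cov.covCounit z = u ∧ S.map A.covCounit.cov z = v) u v →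
          S.map A.covCounit u = S.map A.covCounit v := by
        intro u v huv
        induction huv with
        | rel u v huv =>
          obtain ⟨z, rfl, rfl⟩ := huv
          exact SetFunctor.map_eq_map A.covCounit.comp_covCounit z
        | refl u => rfl
        | symm u v _ ih => exact ih.symm
        | trans u v w _ _ ih1 ih2 => exact ih1.trans ih2
      exact (ih1 (key huv)).trans (ih2 (key hvw))
  choose l hl using hS.surjective
  have hθ : ∀ A (y : S.obj A.cov), T.map A.covCounit (t A (l A (S.map A.covCounit y))) =
      T.map A.covCounit (t A y) := fun A y => hwd A _ _ (hl A _)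
  refine ⟨fun A x => T.map A.covCounit (t A (l A x)), fun A B φ x => ?_, fun A x => ?_⟩
  · obtain ⟨y, rfl⟩ := hS.surjective A x
    have h1 := SetFunctor.map_eq_map (S := S) φ.comp_covCounit y
    have h2 : T.map φ.cov (t A y) = t B (S.map φ.cov y) :=
      γ.injective B.covBasis (by rw [ht, hnat φ.cov (ht A y)])
    change T.map φ (T.map A.covCounit (t A (l A (S.map A.covCounit y)))) =
      T.map B.covCounit (t B (l B (S.map φ (S.map A.covCounit y))))
    rw [hθ, h1, hθ, ← h2]
    exact SetFunctor.map_eq_map φ.comp_covCounit _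
  · rw [hnat A.covCounit (ht A _), hl]

/-! ### The functors of Witt vectors -/

section Functors

variable (p n : ℕ) [hp : Fact p.Prime]

/-- The functor `(R; M) ↦ W_{n,p}(R; M)`. -/
def wittFunctor : SetFunctor.{u} where
  obj A := A.W p n
  map φ := φ.W p n
  map_id x := Hom.W_id x
  map_comp ψ φ x := Hom.W_comp ψ φ x

/-- The functor `(R; M) ↦ W_{n,p}(R; M^{⊗_R p})`. -/
def tensorFunctor : SetFunctor.{u} where
  obj A := (A.tensor p).W p n
  map φ := (φ.tensor p).W p n
  map_id x := by rw [Hom.tensor_id, Hom.W_id]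
  map_comp ψ φ x := by rw [Hom.tensor_comp, Hom.W_comp]

theorem wittFunctor_presentable : (wittFunctor.{u} p n).Presentable where
  surjective A := A.presentation.witt_surjective
  eqvGen A := A.presentation.eqvGen_of_witt_eq (A.covBasis.transferExact p n hp.out.pos)

theorem tensorFunctor_presentable : (tensorFunctor.{u} p n).Presentable where
  surjective A := (A.tensorPresentation hp.out.pos).witt_surjective
  eqvGen A := (A.tensorPresentation hp.out.pos).eqvGen_of_witt_eq
    ((A.covBasis.tensor p).transferExact p n hp.out.pos)

/-- The ghost components of `W_{n,p}(R; M)`. -/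
def wittGhost : (wittFunctor.{u} p n).Ghost where
  G A := ∀ j : Fin n, A.Pow (p ^ (j : ℕ))
  gmap φ y j := φ.powHom _ (y j)
  ghost x := ghost x
  natural φ x := funext fun j => φ.powHom_ghost hp.out.pos x j
  injective 𝔟 _ _ h := 𝔟.ghost_injective (congrFun h)

/-- The ghost components of `W_{n,p}(R; M^{⊗_R p})`. -/
def tensorWittGhost : (tensorFunctor.{u} p n).Ghost where
  G A := ∀ j : Fin n, A.Pow (p ^ ((j : ℕ) + 1))
  gmap φ y j := φ.powHom _ (y j)
  ghost x := tensorGhost x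
  natural φ x := funext fun j => φ.powHom_tensorGhost hp.out.pos x j
  injective 𝔟 _ _ h := 𝔟.tensorGhost_injective (congrFun h)

end Functors

end AlgPair

namespace AlgPair

theorem tprod_const_eq {R M : Type*} [CommRing R] [AddCommGroup M] [Module R M] (x : M) :
    PiTensorProduct.tprod R (fun _ : Fin 1 => x) =
      PiTensorProduct.tprod R (Function.update (0 : Fin 1 → M) 0 x) :=
  congrArg _ (funext fun i => by rw [Subsingleton.elim i 0, Function.update_self])

/-- The isomorphism from `M` to its first tensor power. -/
def toPowOne (A : AlgPair.{u}) {k : ℕ} (h : k = 1) : A.M →+ A.Pow k :=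
  AddMonoidHom.mk' (fun x => PiTensorProduct.tprod A.R fun _ => x) fun x y => by
    subst h
    rw [tprod_const_eq, tprod_const_eq x, tprod_const_eq y, MultilinearMap.map_update_add]

theorem toPowOne_apply {A : AlgPair.{u}} {k : ℕ} (h : k = 1) (x : A.M) :
    A.toPowOne h x = PiTensorProduct.tprod A.R fun _ => x := rfl

theorem toPowOne_smul {A : AlgPair.{u}} {k : ℕ} (h : k = 1) (r : A.R) (x : A.M) :
    A.toPowOne h (r • x) = r • A.toPowOne h x := by
  subst h
  rw [toPowOne_apply, toPowOne_apply, tprod_const_eq, tprod_const_eq x,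
    MultilinearMap.map_update_smul]

namespace MulBasis

variable {A : AlgPair.{u}} (𝔟 : MulBasis A) {p : ℕ} [hp : Fact p.Prime]

/-! ### Images of the ghost maps -/

variable (p) in
/-- The Frobenius lift between consecutive targets of the ghost components. -/
def ψ (j : ℕ) : A.Pow (p ^ j) →+* A.Pow (p ^ (j + 1)) := 𝔟.frob (pow_pos hp.out.pos j) p

theorem ψ_rotate (j : ℕ) (x : A.Pow (p ^ j)) :
    𝔟.ψ p j (rotate A.R _ x) = rotate A.R _ (𝔟.ψ p j x) :=
  𝔟.frob_rotate _ p x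

theorem ψ_rotate_iterate (j l : ℕ) (x : A.Pow (p ^ j)) :
    𝔟.ψ p j ((rotate A.R _)^[l] x) = (rotate A.R _)^[l] (𝔟.ψ p j x) :=
  Function.Semiconj.iterate_right (f := 𝔟.ψ p j) (𝔟.ψ_rotate j) l x

/-- The families that are ghost components of elements of `W_{n,p}(R; M)`. -/
structure IsGhost (v : ∀ j : ℕ, A.Pow (p ^ j)) : Prop where
  fixed : ∀ j, rotate A.R _ (v j) = v j
  congr : ∀ j, ∃ y, v (j + 1) - 𝔟.ψ p j (v j) = transfer (rotate A.R _) (p ^ (j + 1)) y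

/-- The families that are ghost components of elements of `W_{n,p}(R; M^{⊗_R p})`. -/
structure IsTensorGhost (v : ∀ j : ℕ, A.Pow (p ^ (j + 1))) : Prop where
  fixed : ∀ j, (rotate A.R _)^[p] (v j) = v j
  congr : ∀ j, ∃ y, v (j + 1) - 𝔟.ψ p (j + 1) (v j) =
    transfer (iter (rotate A.R _) p) (p ^ (j + 1)) y

/-- Representing `x` by an infinite sequence gives a family in all degrees, so that the congruences
need no bound on `j`. -/
theorem exists_isGhost {n : ℕ} (x : A.W p n) :
    ∃ v, 𝔟.IsGhost v ∧ ∀ j : Fin n, ghost x j = v j := by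
  obtain ⟨a, rfl⟩ := exists_eq_mk_trunc x
  refine ⟨fun j => A.fromCyc _ (infGhost a j), ⟨fun j => ?_, fun j => ?_⟩, ghost_mk_trunc a⟩
  · rw [← fromCyc_rotate (pow_pos hp.out.pos j), cycRotate_infGhost hp.out.pos]
  · exact (𝔟.tower p).exists_transfer_infGhost a j

theorem IsGhost.exists_eq {v : ∀ j : ℕ, A.Pow (p ^ j)} (hv : 𝔟.IsGhost v) (n : ℕ) :
    ∃ x : A.W p n, ∀ j : Fin n, ghost x j = v j := by
  obtain ⟨a, ha⟩ := (𝔟.tower p).exists_infGhost_eq v n fun j _ => hv.congr j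
  exact ⟨W.mk (Seq.trunc n a), fun j => (ghost_mk_trunc a j).trans (ha j j.2)⟩

theorem exists_isTensorGhost {n : ℕ} (x : (A.tensor p).W p n) :
    ∃ v, 𝔟.IsTensorGhost v ∧ ∀ j : Fin n, tensorGhost x j = v j := by
  obtain ⟨a, rfl⟩ := exists_eq_mk_trunc x
  refine ⟨fun j => A.assoc p j ((A.tensor p).fromCyc _ (infGhost a j)),
    ⟨fun j => ?_, fun j => ?_⟩, fun j => congrArg (A.assoc p j) (ghost_mk_trunc a j)⟩
  · rw [← iter_apply, ← assoc_rotate hp.out.pos]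
    refine congrArg (A.assoc p j) ?_
    exact (fromCyc_rotate (A := A.tensor p) (pow_pos hp.out.pos j) _).symm.trans
      (congrArg ((A.tensor p).fromCyc _) (cycRotate_infGhost hp.out.pos a j))
  · exact (𝔟.tensorTower p).exists_transfer_infGhost a j

theorem IsTensorGhost.exists_eq {v : ∀ j : ℕ, A.Pow (p ^ (j + 1))} (hv : 𝔟.IsTensorGhost v)
    (n : ℕ) : ∃ x : (A.tensor p).W p n, ∀ j : Fin n, tensorGhost x j = v j := by
  obtain ⟨a, ha⟩ := (𝔟.tensorTower p).exists_infGhost_eq v n fun j _ => hv.congr j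
  exact ⟨W.mk (Seq.trunc n a), fun j =>
    (congrArg (A.assoc p j) (ghost_mk_trunc a j)).trans (ha j j.2)⟩

/-- `v v' - ψ(v) ψ(v') = (v - ψ(v)) v' + (v' - ψ(v')) ψ(v)`, and a transfer times an invariant
element is a transfer. -/
theorem IsGhost.mul {v v' : ∀ j : ℕ, A.Pow (p ^ j)} (hv : 𝔟.IsGhost v) (hv' : 𝔟.IsGhost v') :
    𝔟.IsGhost (v * v') where
  fixed j := by rw [Pi.mul_apply, rotate_mul, hv.fixed, hv'.fixed]
  congr j := by
    obtain ⟨y, hy⟩ := hv.congr j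
    obtain ⟨y', hy'⟩ := hv'.congr j
    refine ⟨y * v' (j + 1) + y' * 𝔟.ψ p j (v j), ?_⟩
    rw [map_add, ← transfer_mul_fixed rotate_mul _ _ (hv'.fixed (j + 1)),
      ← transfer_mul_fixed rotate_mul _ _ (by rw [← ψ_rotate, hv.fixed]), ← hy, ← hy',
      Pi.mul_apply, Pi.mul_apply, map_mul]
    ring

theorem transfer_eq_transfer_iter {P : Type*} [AddCommGroup P] (σ : P →+ P) (k m : ℕ) (y : P) :
    transfer σ (k * m) y = transfer (iter σ k) m (transfer σ k y) := by
  rw [transfer_mul]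
  refine map_transfer (iter σ k) (iter σ k) (transfer σ k) (fun x => ?_) m y
  rw [iter_apply, iter_apply, iterate_transfer]

/-- A transfer from the trivial group factors through the subgroup generated by `σ^p`. -/
theorem IsGhost.frobenius {v : ∀ j : ℕ, A.Pow (p ^ j)} (hv : 𝔟.IsGhost v) :
    𝔟.IsTensorGhost fun j => v (j + 1) where
  fixed j := Function.iterate_fixed (hv.fixed (j + 1)) p
  congr j := by
    obtain ⟨y, hy⟩ := hv.congr (j + 1)
    refine ⟨transfer (rotate A.R _) p y, ?_⟩
    rw [hy, ← transfer_eq_transfer_iter, ← pow_succ']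

theorem IsTensorGhost.weyl {v : ∀ j : ℕ, A.Pow (p ^ (j + 1))} (hv : 𝔟.IsTensorGhost v) :
    𝔟.IsTensorGhost fun j => rotate A.R _ (v j) where
  fixed j := by rw [← Function.iterate_succ_apply, Function.iterate_succ_apply', hv.fixed]
  congr j := by
    obtain ⟨y, hy⟩ := hv.congr j
    refine ⟨rotate A.R _ y, ?_⟩
    rw [ψ_rotate, ← map_sub, hy]
    refine map_transfer _ _ (rotate A.R _) (fun x => ?_) _ y
    rw [iter_apply, iter_apply, ← Function.iterate_succ_apply, Function.iterate_succ_apply']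

/-- The rotations bring every entry to position `i` exactly once: substitute `i - l` for `l`. -/
theorem prod_shift_iterate {X : Type*} [CommMonoid X] {k : ℕ} (m : Fin k → X) (i : Fin k) :
    ∏ l ∈ Finset.range k, (shift k X)^[l] m i = ∏ i, m i := by
  have hk : 0 < k := i.pos
  have : NeZero k := ⟨hk.ne'⟩
  rw [Finset.prod_range]
  rw [← Equiv.prod_comp (Equiv.subLeft i) m]
  refine Finset.prod_congr rfl fun l _ => ?_
  have h := shift_iterate_mod hk m l ((i - l : Fin k) : ℕ)
  have e1 : (⟨((i - l : Fin k) + (l : ℕ)) % k, Nat.mod_lt _ hk⟩ : Fin k) = i := by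
    have : (i - l) + l = i := sub_add_cancel i l
    conv_rhs => rw [← this]
    ext
    rw [Fin.val_add]
  rw [e1] at h
  rw [h]
  congr 1
  ext
  exact Nat.mod_eq_of_lt (i - l).2

theorem rotate_iterate_prime (x : A.Pow (p ^ (0 + 1))) :
    (rotate A.R (p ^ (0 + 1)))^[p] x = x :=
  (congrArg (fun l => (rotate A.R (p ^ (0 + 1)))^[l] x) (pow_one p)).symm.trans
    (rotate_iterate_self (pow_pos hp.out.pos _) x)

/-- Both maps are additive modulo transfers, the norm by `exists_normProd_add`, so it suffices to
compare them on `r • (m_1 ⊗ ... ⊗ m_p)` with monomial entries. Both give `r ^ p` times the tensor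
all of whose factors are `m_1 ... m_p`. -/
theorem exists_normProd_sub (y : A.Pow (p ^ (0 + 1))) : ∃ t,
    normProd (rotate A.R (p ^ (0 + 1))) p y -
      𝔟.ψ p 0 (A.toPowOne (pow_zero p) (A.mulMap _ y)) =
        transfer (rotate A.R (p ^ (0 + 1))) p t := by
  let N : A.Pow (p ^ (0 + 1)) → A.Pow (p ^ (0 + 1)) := normProd (rotate A.R (p ^ (0 + 1))) p
  let D : A.Pow (p ^ (0 + 1)) →+ A.Pow (p ^ (0 + 1)) := (𝔟.ψ p 0).toAddMonoidHom.comp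
    ((A.toPowOne (pow_zero p)).comp (A.mulMap (p ^ (0 + 1))).toAddMonoidHom)
  let I : AddSubgroup (A.Pow (p ^ (0 + 1))) := (transfer (rotate A.R (p ^ (0 + 1))) p).range
  have hadd : ∀ x y, N (x + y) - (N x + N y) ∈ I := fun x y => by
    obtain ⟨t, ht⟩ := exists_normProd_add rotate_mul rotate_one hp.out
      (rotate_iterate_prime (A := A) (p := p)) x y
    exact ⟨t, ht.symm⟩
  have hzero : N 0 = 0 := Finset.prod_eq_zero (Finset.mem_range.2 hp.out.pos) rfl
  -- The elements that satisfy the congruence form a subgroup; for negatives, additivity is applied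
  -- to `x` and `-x`.
  let H : AddSubgroup (A.Pow (p ^ (0 + 1))) :=
    { carrier := {y | N y - D y ∈ I}
      zero_mem' := by
        rw [Set.mem_ofPred_eq, hzero, map_zero, sub_zero]
        exact zero_mem I
      add_mem' := fun {x y} hx hy => by
        have := add_mem (hadd x y) (add_mem hx hy)
        rw [Set.mem_ofPred_eq, map_add]
        convert this using 1
        abel
      neg_mem' := fun {x} hx => by
        have := sub_mem (neg_mem (hadd x (-x))) hx
        rw [add_neg_cancel, hzero] at this
        rw [Set.mem_ofPred_eq, map_neg]
        convert this using 1
        abel }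
  suffices h : y ∈ H by
    obtain ⟨t, ht⟩ := h
    exact ⟨t, ht.symm⟩
  have hy : y ∈ AddSubgroup.closure _ := (𝔟.tensor (p ^ (0 + 1))).closure_mono ▸ AddSubgroup.mem_top y
  refine (AddSubgroup.closure_le H).2 ?_ hy
  rintro _ ⟨(r : A.R), (hr : r ∈ 𝔟.SR), _, ⟨m, hm, rfl⟩, rfl⟩
  have key : N (r • PiTensorProduct.tprod A.R m) = D (r • PiTensorProduct.tprod A.R m) := by
    have h1 : N (r • PiTensorProduct.tprod A.R m) =
        r ^ p • PiTensorProduct.tprod A.R fun _ => ∏ i, m i := by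
      change ∏ l ∈ Finset.range p, _ = _
      simp only [rotate_iterate_smul_tprod, Finset.prod_smul, Finset.prod_const, Finset.card_range]
      congr 1
      change ∏ l ∈ Finset.range p, PiTensorProduct.tprodMonoidHom A.R _ = _
      rw [← map_prod]
      change PiTensorProduct.tprod A.R _ = _
      congr 1
      funext i
      rw [Finset.prod_apply, ← prod_shift_iterate m i]
      exact congrArg (fun q => ∏ l ∈ Finset.range q, (shift _ A.M)^[l] m i) (pow_one p).symm
    have h2 : D (r • PiTensorProduct.tprod A.R m) =
        r ^ p • PiTensorProduct.tprod A.R fun _ => ∏ i, m i := by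
      change 𝔟.ψ p 0 (A.toPowOne (pow_zero p) (A.mulMap _ (r • PiTensorProduct.tprod A.R m))) = _
      rw [map_smul, mulMap_tprod]
      rw [toPowOne_smul, toPowOne_apply]
      exact 𝔟.frob_smul_tprod _ p hr _ fun _ => prod_mem fun i _ => hm i
    rw [h1, h2]
  change N _ - D _ ∈ I
  rw [key, sub_self]
  exact zero_mem I

/-- In positive degrees `v (j+1) = ψ (v j) + tr y`. Modulo transfers from the trivial group the norm
does not see `tr y`, and it commutes with the ring homomorphism `ψ`. The step from degree zero is
`exists_normProd_sub`. -/
theorem IsTensorGhost.norm {v : ∀ j : ℕ, A.Pow (p ^ (j + 1))} (hv : 𝔟.IsTensorGhost v)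
    {w : ∀ j : ℕ, A.Pow (p ^ j)} (h0 : w 0 = A.toPowOne (pow_zero p) (A.mulMap _ (v 0)))
    (h1 : ∀ j, w (j + 1) = normProd (rotate A.R _) p (v j)) : 𝔟.IsGhost w where
  fixed j := by
    cases j with
    | zero =>
      rw [h0]
      exact rotate_tprod A.R _
    | succ j =>
      rw [h1]
      exact normProd_fixed rotate_mul rotate_one (hv.fixed j)
  congr j := by
    cases j with
    | zero =>
      obtain ⟨t, ht⟩ := 𝔟.exists_normProd_sub (v 0)
      refine ⟨t, ?_⟩
      rw [h0, h1, ht]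
      congr 1
      rw [zero_add, pow_one]
    | succ j =>
      obtain ⟨y, hy⟩ := hv.congr j
      obtain ⟨t, ht⟩ := exists_normProd_add_transfer (σ := rotate A.R (p ^ (j + 1 + 1))) (j := j)
        rotate_mul rotate_one hp.out (fun x => by
          rw [← pow_succ']
          exact rotate_iterate_self (pow_pos hp.out.pos _) x)
        (𝔟.ψ p (j + 1) (v j)) y (by rw [← ψ_rotate_iterate, hv.fixed])
      refine ⟨t, ?_⟩
      have h3 : 𝔟.ψ p (j + 1) (normProd (rotate A.R _) p (v j)) =
          normProd (rotate A.R _) p (𝔟.ψ p (j + 1) (v j)) := by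
        rw [normProd, map_prod]
        exact Finset.prod_congr rfl fun l _ => 𝔟.ψ_rotate_iterate _ _ _
      rw [← hy, add_sub_cancel, ← pow_succ'] at ht
      rw [h1, h1, h3, ht]

end MulBasis

/-! ### The operators on Witt vectors -/

section Operators

variable {p n : ℕ} [hp : Fact p.Prime]

variable (p n) in
-- A binary operation is a natural map out of the product functor, which is again presentable.
theorem existsUnique_isProduct : ∃! m, IsProduct.{u} p n m := by
  have hS := (wittFunctor_presentable.{u} p n).prod (wittFunctor_presentable p n)
  obtain ⟨m, hm, hg⟩ := (wittGhost p n).exists_lift hS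
    (fun A x j => ghost x.1 j * ghost x.2 j)
    (fun A B φ x => funext fun j => by
      refine (map_mul (φ.powHom _) _ _).trans ?_
      exact congrArg₂ (· * ·) (φ.powHom_ghost hp.out.pos _ j) (φ.powHom_ghost hp.out.pos _ j))
    (fun A 𝔟 x => by
      obtain ⟨v, hv, h1⟩ := 𝔟.exists_isGhost x.1
      obtain ⟨v', hv', h2⟩ := 𝔟.exists_isGhost x.2
      obtain ⟨t, ht⟩ := (hv.mul 𝔟 hv').exists_eq 𝔟 n
      exact ⟨t, funext fun j => by
        rw [h1, h2]
        exact ht j⟩)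
  refine ⟨fun A x y => m A (x, y), ⟨fun A B φ x y => hm A B φ (x, y),
    fun A x y j => congrFun (hg A (x, y)) j⟩, fun m' hm' => ?_⟩
  have := (wittGhost p n).ext hS (θ := fun A x => m' A x.1 x.2)
    (fun A B φ x => hm'.natural A B φ x.1 x.2) hm fun A x => by
      rw [hg]
      exact funext fun j => hm'.ghost A x.1 x.2 j
  funext A x y
  exact congrFun (congrFun this A) (x, y)

variable (p n) in
theorem existsUnique_isFrobenius : ∃! F, IsFrobenius.{u} p n F := by
  have hS := wittFunctor_presentable.{u} p (n + 1)
  obtain ⟨F, hF, hg⟩ := (tensorWittGhost p n).exists_lift hS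
    (fun A (x : A.W p (n + 1)) j => ghost x j.succ)
    (fun A B φ x => funext fun j => φ.powHom_ghost hp.out.pos x j.succ)
    (fun A 𝔟 x => by
      obtain ⟨v, hv, h1⟩ := 𝔟.exists_isGhost (A := A) x
      obtain ⟨t, ht⟩ := (hv.frobenius 𝔟).exists_eq 𝔟 n
      exact ⟨t, funext fun j => (ht j).trans (h1 j.succ).symm⟩)
  refine ⟨F, ⟨hF, fun A x j => congrFun (hg A x) j⟩, fun F' hF' => ?_⟩
  exact (tensorWittGhost p n).ext hS hF'.natural hF fun A x => by
    rw [hg]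
    exact funext fun j => hF'.ghost A x j

variable (p n) in
theorem existsUnique_isWeyl : ∃! s, IsWeyl.{u} p n s := by
  have hS := tensorFunctor_presentable.{u} p n
  obtain ⟨s, hs, hg⟩ := (tensorWittGhost p n).exists_lift hS
    (fun A (x : (A.tensor p).W p n) j => rotate A.R _ (tensorGhost x j))
    (fun A B φ x => funext fun j => (φ.powHom_rotate _).trans
      (congrArg (rotate B.R _) (φ.powHom_tensorGhost hp.out.pos x j)))
    (fun A 𝔟 x => by
      obtain ⟨v, hv, h1⟩ := 𝔟.exists_isTensorGhost (A := A) x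
      obtain ⟨t, ht⟩ := (hv.weyl 𝔟).exists_eq 𝔟 n
      exact ⟨t, funext fun j => (ht j).trans (congrArg (rotate A.R _) (h1 j).symm)⟩)
  refine ⟨s, ⟨hs, fun A x j => congrFun (hg A x) j⟩, fun s' hs' => ?_⟩
  exact (tensorWittGhost p n).ext hS hs'.natural hs fun A x => by
    rw [hg]
    exact funext fun j => hs'.ghost A x j

omit hp in
theorem normGhost_zero (A : AlgPair.{u}) (y : ∀ j : Fin (n + 1), A.Pow (p ^ ((j : ℕ) + 1))) :
    normGhost p n A y 0 = A.toPowOne (pow_zero p) (A.mulMap _ (y 0)) := rfl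

omit hp in
theorem normGhost_succ (A : AlgPair.{u}) (y : ∀ j : Fin (n + 1), A.Pow (p ^ ((j : ℕ) + 1)))
    (j : Fin (n + 1)) : normGhost p n A y j.succ =
      normProd (P := A.Pow (p ^ ((j : ℕ) + 1))) (rotate A.R _) p (y j) := rfl

theorem Hom.powHom_toPowOne {A B : AlgPair.{u}} (φ : Hom A B) {k : ℕ} (h : k = 1) (x : A.M) :
    φ.powHom k (A.toPowOne h x) = B.toPowOne h (φ.map x) := φ.powHom_tprod _

theorem Hom.powHom_normProd {A B : AlgPair.{u}} (φ : Hom A B) {k : ℕ} (l : ℕ) (x : A.Pow k) :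
    φ.powHom k (normProd (P := A.Pow k) (rotate A.R k) l x) =
      normProd (P := B.Pow k) (rotate B.R k) l (φ.powHom k x) := by
  rw [normProd, map_prod]
  exact Finset.prod_congr rfl fun i _ =>
    Function.Semiconj.iterate_right (f := φ.powHom k) φ.powHom_rotate i x

omit hp in
theorem Hom.powHom_normGhost {A B : AlgPair.{u}} (φ : Hom A B)
    (y : ∀ j : Fin (n + 1), A.Pow (p ^ ((j : ℕ) + 1))) (j : Fin (n + 2)) :
    φ.powHom _ (normGhost p n A y j) = normGhost p n B (fun j => φ.powHom _ (y j)) j := by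
  induction j using Fin.cases with
  | zero =>
    rw [normGhost_zero, normGhost_zero, ← φ.map_mulMap]
    exact φ.powHom_toPowOne _ _
  | succ j => exact φ.powHom_normProd p (y j)

variable (p n) in
theorem existsUnique_isNorm : ∃! N, IsNorm.{u} p n N := by
  have hS := tensorFunctor_presentable.{u} p (n + 1)
  obtain ⟨N, hN, hg⟩ := (wittGhost p (n + 2)).exists_lift hS
    (fun A (x : (A.tensor p).W p (n + 1)) => normGhost p n A (tensorGhost x))
    (fun A B φ x => funext fun j => by
      refine (φ.powHom_normGhost (tensorGhost (A := A) x) j).trans ?_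
      exact congrArg (fun y => normGhost p n B y j)
        (funext fun j => φ.powHom_tensorGhost hp.out.pos x j))
    (fun A 𝔟 x => by
      obtain ⟨v, hv, h1⟩ := 𝔟.exists_isTensorGhost (A := A) x
      -- The components prescribed by `N_w`, continued to all degrees.
      let w : ∀ j : ℕ, A.Pow (p ^ j) := fun j => match j with
        | 0 => A.toPowOne (pow_zero p) (A.mulMap _ (v 0))
        | j + 1 => normProd (P := A.Pow (p ^ (j + 1))) (rotate A.R _) p (v j)
      obtain ⟨t, ht⟩ := (hv.norm 𝔟 (w := w) rfl fun _ => rfl).exists_eq 𝔟 (n + 2)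
      refine ⟨t, funext fun j => (ht j).trans ?_⟩
      have h2 : tensorGhost (A := A) x = fun j : Fin (n + 1) => v j := funext h1
      rw [h2]
      induction j using Fin.cases with
      | zero => rfl
      | succ j => rfl)
  refine ⟨N, ⟨hN, hg⟩, fun N' hN' => ?_⟩
  exact (wittGhost p (n + 2)).ext hS hN'.natural hN fun A x => by
    rw [hg]
    exact hN'.ghost A x

end Operators

end AlgPair

namespace AlgPair

/-! ### Ghost components of scalar tensors -/

section Scalar

variable {A B : AlgPair.{u}}

/-- The multiple `r · 1^{⊗ k}` of the unit tensor. -/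
def scalar (A : AlgPair.{u}) (k : ℕ) (r : A.R) : A.toBimod.TPow k :=
  A.elem fun l : Fin k => if (l : ℕ) = 0 then algebraMap A.R A.M r else 1

theorem fromT_scalar {k : ℕ} (hk : 0 < k) (r : A.R) : A.fromT k (A.scalar k r) = r • 1 := by
  refine (fromT_mkT _).trans ?_
  have : (fun l : Fin k => if (l : ℕ) = 0 then algebraMap A.R A.M r else 1) =
      Function.update (1 : Fin k → A.M) ⟨0, hk⟩ (r • (1 : Fin k → A.M) ⟨0, hk⟩) := by
    funext l
    by_cases hl : l = ⟨0, hk⟩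
    · subst hl
      simp [Algebra.smul_def]
    · rw [Function.update_of_ne hl, if_neg fun h => hl (Fin.ext h), Pi.one_apply]
  refine (congrArg (PiTensorProduct.tprod A.R) this).trans ?_
  rw [MultilinearMap.map_update_smul, Function.update_eq_self]
  rfl

theorem scalar_zero {k : ℕ} (hk : 0 < k) : A.scalar k 0 = 0 :=
  elem_eq_zero _ ⟨0, hk⟩ (by simp)

theorem Hom.tPow_scalar (φ : Hom A B) (k : ℕ) (r : A.R) :
    φ.toBimod.tPow k (A.scalar k r) = B.scalar k (φ.base r) := by
  refine (φ.toBimod.tPow_mkT _).trans (congrArg B.elem (funext fun l => ?_))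
  change φ.map (ite _ _ _) = _
  split_ifs
  · exact φ.comm r
  · exact map_one φ.map

/-- Each of the `N` blocks carries `r` in its first place and units elsewhere; the scalars collect
to `r ^ N`. -/
theorem fromCyc_power_scalar {N k K : ℕ} (hk : 0 < k) (h : N * k = K) (r : A.R) :
    A.fromCyc K (A.toBimod.power h (A.scalar k r)) = r ^ N • 1 := by
  subst h
  refine (congrArg (A.fromCyc _) (power_mkT hk rfl _)).trans ((fromCyc_mkC _).trans ?_)
  have : (interleave (X := A.M) hk rfl fun _ : Fin N => fun l : Fin k =>
      if (l : ℕ) = 0 then algebraMap A.R A.M r else 1) =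
      fun c : Fin (N * k) => (if (c : ℕ) % k = 0 then r else 1) • (1 : A.M) := by
    funext c
    simp only [interleave, Algebra.smul_def, mul_one]
    split_ifs
    · rfl
    · exact (map_one _).symm
  refine (congrArg (PiTensorProduct.tprod A.R) this).trans ?_
  rw [MultilinearMap.map_smul_univ]
  have hprod : ∏ c : Fin (N * k), (if (c : ℕ) % k = 0 then r else 1) = r ^ N := by
    rw [← Equiv.prod_comp finProdFinEquiv, Fintype.prod_prod_type]
    have : ∀ a : Fin N, ∏ b : Fin k, (if (finProdFinEquiv (a, b) : ℕ) % k = 0 then r else 1) = r := by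
      intro a
      rw [Finset.prod_eq_single (⟨0, hk⟩ : Fin k)]
      · simp [finProdFinEquiv]
      · intro b _ hb
        have : ((finProdFinEquiv (a, b) : Fin (N * k)) : ℕ) % k = b := by
          simp [finProdFinEquiv, Nat.mod_eq_of_lt b.2]
        rw [this, if_neg fun h => hb (Fin.ext h)]
      · exact fun h => absurd (Finset.mem_univ _) h
    simp only [this, Finset.prod_const, Finset.card_univ, Fintype.card_fin]
  rw [hprod]
  rfl

variable {p : ℕ}

/-- Rotation fixes scalar multiples of the unit, so the transfer is multiplication by `p ^ i`. The
result is a term of the classical Witt polynomial. -/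
theorem fromCyc_ghostTerm_scalar (hp : 0 < p) {i j : ℕ} (hij : i ≤ j) (r : A.R) :
    A.fromCyc _ (ghostTerm i j (A.scalar (p ^ i) r)) =
      ((p : A.R) ^ i * r ^ p ^ (j - i)) • 1 := by
  rw [ghostTerm, dif_pos hij, map_transfer _ (rotate A.R (p ^ j)) (A.fromCyc _)
    (fromCyc_rotate (pow_pos hp j)), fromCyc_power_scalar (pow_pos hp i), transfer_apply]
  have : ∀ l, (rotate A.R (p ^ j))^[l] ((r ^ p ^ (j - i)) • (1 : A.Pow (p ^ j))) =
      r ^ p ^ (j - i) • 1 := fun l =>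
    Function.iterate_fixed (by rw [rotate_smul, rotate_one]) l
  simp only [this, Finset.sum_const, Finset.card_range]
  rw [mul_smul, ← Nat.cast_pow, Nat.cast_smul_eq_nsmul]

variable [hp : Fact p.Prime] {n : ℕ}

theorem ghostComponent_eq_sum {R : Type*} [CommRing R] (x : WittVector p R) (j : ℕ) :
    WittVector.ghostComponent j x =
      ∑ i ∈ Finset.range (j + 1), (p : R) ^ i * x.coeff i ^ p ^ (j - i) := by
  rw [WittVector.ghostComponent_apply, wittPolynomial_eq_sum_C_mul_X_pow, map_sum]
  refine Finset.sum_congr rfl fun i _ => ?_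
  simp

theorem ghost_ofClassical (a : TruncatedWittVector p n A.R) (j : Fin n) :
    ghost (A.ofClassical p n a) j = WittVector.ghostComponent j a.out • 1 := by
  let b : ∀ i : ℕ, A.toBimod.TPow (p ^ i) := fun i => A.scalar (p ^ i) (a.out.coeff i)
  have h : A.ofClassical p n a = W.mk (Seq.trunc n b) := by
    refine congrArg W.mk (funext fun i => ?_)
    change A.scalar _ _ = A.scalar _ _
    rw [TruncatedWittVector.coeff_out]
  rw [h, ghost_mk_trunc, infGhost, map_sum, ghostComponent_eq_sum, Finset.sum_smul]
  exact Finset.sum_congr rfl fun i hi =>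
    fromCyc_ghostTerm_scalar hp.out.pos (Nat.lt_succ_iff.1 (Finset.mem_range.1 hi)) _

theorem tensorGhost_ofClassical (a : TruncatedWittVector p n A.R) (j : Fin n) :
    tensorGhost ((A.tensor p).ofClassical p n a) j =
      WittVector.ghostComponent j a.out • 1 := by
  refine (congrArg (A.assoc p j) (ghost_ofClassical (A := A.tensor p) a j)).trans ?_
  rw [← assoc_one hp.out.pos, ← assoc_smul]

omit hp in
theorem Hom.W_ofClassical (φ : Hom A B) (a : TruncatedWittVector p n A.R) :
    φ.W p n (A.ofClassical p n a) =
      B.ofClassical p n (TruncatedWittVector.mk p fun i => φ.base (a.coeff i)) :=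
  congrArg W.mk (funext fun i => by
    rw [TruncatedWittVector.coeff_mk]
    exact φ.tPow_scalar _ _)

theorem coeff_truncated_one {R : Type*} [CommRing R] (i : Fin n) :
    (1 : TruncatedWittVector p n R).coeff i = if (i : ℕ) = 0 then 1 else 0 := by
  have : (1 : TruncatedWittVector p n R) = WittVector.truncate n 1 := (map_one _).symm
  rw [this, WittVector.coeff_truncate]
  split_ifs with h
  · rw [h, WittVector.one_coeff_zero]
  · exact WittVector.one_coeff_eq_of_pos _ _ _ (Nat.pos_of_ne_zero h)

theorem wittUnit_eq : wittUnit p n A = A.ofClassical p n 1 := by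
  refine congrArg W.mk (funext fun i => ?_)
  rw [coeff_truncated_one]
  split_ifs with hi
  · refine congrArg A.elem (funext fun l => ?_)
    split_ifs
    · exact (map_one _).symm
    · rfl
  · exact (scalar_zero (pow_pos hp.out.pos _)).symm

theorem ghostComponent_out_one {R : Type*} [CommRing R] (j : Fin n) :
    WittVector.ghostComponent j (1 : TruncatedWittVector p n R).out = 1 := by
  have h0 : ∀ i < n, (1 : TruncatedWittVector p n R).out.coeff i = if i = 0 then 1 else 0 :=
    fun i hi => (TruncatedWittVector.coeff_out _ ⟨i, hi⟩).trans (coeff_truncated_one _)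
  rw [ghostComponent_eq_sum, Finset.sum_eq_single 0]
  · rw [h0 0 j.pos]; simp
  · intro i hi hi0
    rw [h0 i (by have := Finset.mem_range.1 hi; omega), if_neg hi0,
      zero_pow (pow_pos hp.out.pos _).ne', mul_zero]
  · simp

theorem ghost_wittUnit (j : Fin n) : ghost (wittUnit p n A) j = 1 := by
  rw [wittUnit_eq, ghost_ofClassical, ghostComponent_out_one, one_smul]

theorem tensorGhost_wittUnit (j : Fin n) : tensorGhost (wittUnit p n (A.tensor p)) j = 1 := by
  refine (congrArg (A.assoc p j) (ghost_wittUnit (A := A.tensor p) j)).trans ?_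
  exact assoc_one hp.out.pos j

theorem Hom.W_wittUnit (φ : Hom A B) : φ.W p n (wittUnit p n A) = wittUnit p n B := by
  rw [wittUnit_eq, wittUnit_eq, φ.W_ofClassical]
  refine congrArg (B.ofClassical p n) (TruncatedWittVector.ext fun i => ?_)
  rw [TruncatedWittVector.coeff_mk, coeff_truncated_one, coeff_truncated_one]
  split_ifs
  · exact map_one φ.base
  · exact map_zero φ.base

end Scalar

/-! ### The product -/

section Product

variable (p n : ℕ) [hp : Fact p.Prime]

theorem isProduct_wittProduct : IsProduct.{u} p n (wittProduct p n) :=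
  Classical.epsilon_spec (existsUnique_isProduct p n).exists

theorem isFrobenius_wittFrobenius : IsFrobenius.{u} p n (wittFrobenius p n) :=
  Classical.epsilon_spec (existsUnique_isFrobenius p n).exists

theorem isWeyl_wittWeyl : IsWeyl.{u} p n (wittWeyl p n) :=
  Classical.epsilon_spec (existsUnique_isWeyl p n).exists

variable {p n} {A : AlgPair.{u}}

theorem ghost_wittProduct (x y : A.W p n) :
    ghost (wittProduct p n A x y) = ghost x * ghost y :=
  funext fun j => (isProduct_wittProduct p n).ghost A x y j

theorem tensorGhost_wittProduct (x y : (A.tensor p).W p n) :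
    tensorGhost (wittProduct p n (A.tensor p) x y) = tensorGhost x * tensorGhost y :=
  funext fun j => (congrArg (A.assoc p j)
    ((isProduct_wittProduct p n).ghost (A.tensor p) x y j)).trans (assoc_mul hp.out.pos j _ _)

/-- Identities between natural operations follow from those of ghost components. Naturality of both
sides has to be supplied, as injectivity of the ghost map is available on polynomial pairs only. -/
theorem wittProduct_comm (x y : A.W p n) : wittProduct p n A x y = wittProduct p n A y x := by
  have h := isProduct_wittProduct.{u} p n
  have hS := (wittFunctor_presentable.{u} p n).prod (wittFunctor_presentable p n)
  exact congrFun (congrFun ((wittGhost.{u} p n).ext hS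
    (θ := fun A z => wittProduct p n A z.1 z.2) (θ' := fun A z => wittProduct p n A z.2 z.1)
    (fun A B φ z => h.natural A B φ z.1 z.2) (fun A B φ z => h.natural A B φ z.2 z.1)
    fun A z => (ghost_wittProduct z.1 z.2).trans
      ((mul_comm _ _).trans (ghost_wittProduct z.2 z.1).symm)) A) (x, y)

theorem wittProduct_assoc (x y z : A.W p n) :
    wittProduct p n A (wittProduct p n A x y) z =
      wittProduct p n A x (wittProduct p n A y z) := by
  have h := isProduct_wittProduct.{u} p n
  have hS := (wittFunctor_presentable.{u} p n).prod
    ((wittFunctor_presentable p n).prod (wittFunctor_presentable p n))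
  refine congrFun (congrFun ((wittGhost.{u} p n).ext hS
    (θ := fun A w => wittProduct p n A (wittProduct p n A w.1 w.2.1) w.2.2)
    (θ' := fun A w => wittProduct p n A w.1 (wittProduct p n A w.2.1 w.2.2))
    (fun A B φ w => ?_) (fun A B φ w => ?_) fun A w => ?_) A) (x, y, z)
  · exact (h.natural A B φ _ _).trans
      (congrArg (fun v => wittProduct p n B v _) (h.natural A B φ _ _))
  · exact (h.natural A B φ _ _).trans (congrArg (wittProduct p n B _) (h.natural A B φ _ _))
  · refine (ghost_wittProduct _ _).trans ((congrArg (· * _) (ghost_wittProduct _ _)).trans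
      ((mul_assoc _ _ _).trans (Eq.symm ?_)))
    exact (ghost_wittProduct _ _).trans (congrArg (_ * ·) (ghost_wittProduct _ _))

theorem wittUnit_wittProduct (x : A.W p n) : wittProduct p n A (wittUnit p n A) x = x := by
  refine congrFun (congrFun ((wittGhost.{u} p n).ext (wittFunctor_presentable p n)
    (θ := fun A x => wittProduct p n A (wittUnit p n A) x) (θ' := fun A x => x)
    (fun A B φ x => ?_) (fun A B φ x => rfl) fun A x => ?_) A) x
  · exact ((isProduct_wittProduct p n).natural A B φ _ _).trans
      (congrArg (fun v => wittProduct p n B v _) φ.W_wittUnit)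
  · exact (ghost_wittProduct _ _).trans
      ((congrArg (· * _) (funext fun j => ghost_wittUnit j)).trans (one_mul _))

end Product

/-! ### The norm -/

section Norm

variable {p n : ℕ} [hp : Fact p.Prime] {A : AlgPair.{u}}

omit hp in
theorem normGhost_mul (y y' : ∀ j : Fin (n + 1), A.Pow (p ^ ((j : ℕ) + 1))) :
    normGhost p n A (y * y') = normGhost p n A y * normGhost p n A y' := by
  funext j
  refine Fin.cases ?_ (fun j => ?_) j
  · change PiTensorProduct.tprod A.R (fun _ => A.mulMap _ (y 0 * y' 0)) =
      PiTensorProduct.tprod A.R (fun _ => A.mulMap _ (y 0)) *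
        PiTensorProduct.tprod A.R (fun _ => A.mulMap _ (y' 0))
    rw [PiTensorProduct.tprod_mul_tprod, mulMap_mul]
    rfl
  · exact normProd_mul rotate_mul p (y j) (y' j)

omit hp in
theorem normGhost_one : normGhost p n A 1 = 1 := by
  funext j
  refine Fin.cases ?_ (fun j => ?_) j
  · change PiTensorProduct.tprod A.R (fun _ => A.mulMap _ 1) = 1
    rw [mulMap_one]
    rfl
  · exact (normGhost_succ A _ j).trans
      (Finset.prod_eq_one fun l _ => Function.iterate_fixed rotate_one l)

variable (p n) in
/-- The norm `W_{n+1,p}(R; M^{⊗_R p}) → W_{n+2,p}(R; M)`. -/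
def wittNorm : ∀ A : AlgPair.{u}, (A.tensor p).W p (n + 1) → A.W p (n + 2) :=
  (existsUnique_isNorm p n).choose

theorem isNorm_wittNorm : IsNorm.{u} p n (wittNorm p n) :=
  (existsUnique_isNorm p n).choose_spec.1

theorem wittNorm_wittProduct (x y : (A.tensor p).W p (n + 1)) :
    wittNorm p n A (wittProduct p (n + 1) (A.tensor p) x y) =
      wittProduct p (n + 2) A (wittNorm p n A x) (wittNorm p n A y) := by
  have hN := isNorm_wittNorm.{u} (p := p) (n := n)
  have hS := (tensorFunctor_presentable.{u} p (n + 1)).prod (tensorFunctor_presentable p (n + 1))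
  refine congrFun (congrFun ((wittGhost.{u} p (n + 2)).ext hS
    (θ := fun A z => wittNorm p n A (wittProduct p (n + 1) (A.tensor p) z.1 z.2))
    (θ' := fun A z => wittProduct p (n + 2) A (wittNorm p n A z.1) (wittNorm p n A z.2))
    (fun A B φ z => ?_) (fun A B φ z => ?_) fun A z => ?_) A) (x, y)
  · exact (hN.natural A B φ _).trans (congrArg (wittNorm p n B)
      ((isProduct_wittProduct p (n + 1)).natural _ _ (φ.tensor p) _ _))
  · exact ((isProduct_wittProduct p (n + 2)).natural A B φ _ _).trans
      (congrArg₂ (wittProduct p (n + 2) B) (hN.natural A B φ _) (hN.natural A B φ _))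
  · refine (hN.ghost A _).trans ((congrArg _ (tensorGhost_wittProduct _ _)).trans
      ((normGhost_mul _ _).trans (Eq.symm ?_)))
    exact (ghost_wittProduct _ _).trans (congrArg₂ (· * ·) (hN.ghost A _) (hN.ghost A _))

/-- Elements are determined by natural families with equal ghost components. -/
theorem eq_of_natural {s t : ∀ A : AlgPair.{u}, A.W p n}
    (hs : ∀ (A B : AlgPair.{u}) (φ : Hom A B), φ.W p n (s A) = s B)
    (ht : ∀ (A B : AlgPair.{u}) (φ : Hom A B), φ.W p n (t A) = t B)
    (h : ∀ A, ghost (s A) = ghost (t A)) : s A = t A := by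
  rw [← hs _ _ A.covCounit, ← ht _ _ A.covCounit, A.covBasis.ghost_injective (congrFun (h _))]

theorem wittNorm_wittUnit :
    wittNorm p n A (wittUnit p (n + 1) (A.tensor p)) = wittUnit p (n + 2) A := by
  have hN := isNorm_wittNorm.{u} (p := p) (n := n)
  refine eq_of_natural (s := fun A => wittNorm p n A (wittUnit p (n + 1) (A.tensor p)))
    (fun A B φ => ?_) (fun A B φ => φ.W_wittUnit) fun A => ?_
  · exact (hN.natural A B φ _).trans (congrArg (wittNorm p n B) (φ.tensor p).W_wittUnit)
  · refine (hN.ghost A _).trans ((congrArg _ (funext fun j => tensorGhost_wittUnit j)).trans ?_)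
    exact normGhost_one.trans (funext fun j => (ghost_wittUnit j).symm)

omit hp in
theorem Hom.W_restrict {B : AlgPair.{u}} (φ : Hom A B) (x : A.W p (n + 1)) :
    φ.W p n (restrict x) = restrict (φ.W p (n + 1) x) := by
  induction x using Quot.ind
  rfl

omit hp in
theorem ghost_restrict (x : A.W p (n + 1)) (j : Fin n) :
    ghost (restrict x) j = ghost x j.castSucc := by
  induction x using Quot.ind
  rfl

omit hp in
theorem tensorGhost_restrict (x : (A.tensor p).W p (n + 1)) (j : Fin n) :
    tensorGhost (restrict x) j = tensorGhost x j.castSucc :=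
  congrArg (A.assoc p j) (ghost_restrict x j)

omit hp in
theorem normGhost_castSucc (y : ∀ j : Fin (n + 2), A.Pow (p ^ ((j : ℕ) + 1))) (j : Fin (n + 2)) :
    normGhost p (n + 1) A y j.castSucc = normGhost p n A (fun j => y j.castSucc) j := by
  refine Fin.cases ?_ (fun j => ?_) j
  · rfl
  · rfl

theorem restrict_wittNorm (x : (A.tensor p).W p (n + 2)) :
    restrict (wittNorm p (n + 1) A x) = wittNorm p n A (restrict x) := by
  have hN := isNorm_wittNorm.{u} (p := p) (n := n)
  have hN' := isNorm_wittNorm.{u} (p := p) (n := n + 1)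
  refine congrFun (congrFun ((wittGhost.{u} p (n + 2)).ext (tensorFunctor_presentable p (n + 2))
    (θ := fun A x => restrict (wittNorm p (n + 1) A x))
    (θ' := fun A x => wittNorm p n A (restrict x))
    (fun A B φ x => ?_) (fun A B φ x => ?_) fun A x => funext fun j => ?_) A) x
  · exact (φ.W_restrict _).trans (congrArg restrict (hN'.natural A B φ x))
  · exact (hN.natural A B φ _).trans (congrArg (wittNorm p n B) ((φ.tensor p).W_restrict x))
  · refine (ghost_restrict _ j).trans ((congrFun (hN'.ghost A x) j.castSucc).trans
      ((normGhost_castSucc _ j).trans (Eq.symm ?_)))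
    refine (congrFun (hN.ghost A _) j).trans ?_
    exact congrFun (congrArg (normGhost p n A) (funext fun j => tensorGhost_restrict x j)) j

theorem tensorGhost_weyl_iterate (l : ℕ) (x : (A.tensor p).W p n) (j : Fin n) :
    tensorGhost ((wittWeyl p n A)^[l] x) j =
      (rotate A.R (p ^ ((j : ℕ) + 1)))^[l] (tensorGhost x j) := by
  induction l with
  | zero => rfl
  | succ l ih =>
    rw [Function.iterate_succ_apply', Function.iterate_succ_apply',
      (isWeyl_wittWeyl p n).ghost, ih]

theorem Hom.W_weyl_iterate {B : AlgPair.{u}} (φ : Hom A B) (l : ℕ) (x : (A.tensor p).W p n) :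
    (φ.tensor p).W p n ((wittWeyl p n A)^[l] x) =
      (wittWeyl p n B)^[l] ((φ.tensor p).W p n x) := by
  induction l with
  | zero => rfl
  | succ l ih =>
    rw [Function.iterate_succ_apply', Function.iterate_succ_apply',
      (isWeyl_wittWeyl p n).natural, ih]

theorem Hom.W_foldr {B : AlgPair.{u}} (φ : Hom A B) (s : List (A.W p n)) :
    φ.W p n (s.foldr (wittProduct p n A) (wittUnit p n A)) =
      (s.map (φ.W p n)).foldr (wittProduct p n B) (wittUnit p n B) := by
  induction s with
  | nil => exact φ.W_wittUnit
  | cons a s ih =>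
    rw [List.foldr_cons, List.map_cons, List.foldr_cons, (isProduct_wittProduct p n).natural, ih]

theorem tensorGhost_foldr (s : List ((A.tensor p).W p n)) (j : Fin n) :
    tensorGhost (s.foldr (wittProduct p n (A.tensor p)) (wittUnit p n (A.tensor p))) j =
      (s.map fun x => tensorGhost x j).prod := by
  induction s with
  | nil => exact tensorGhost_wittUnit j
  | cons a s ih =>
    rw [List.foldr_cons, List.map_cons, List.prod_cons, tensorGhost_wittProduct, ← ih]
    rfl

theorem Hom.W_weylProduct {B : AlgPair.{u}} (φ : Hom A B) (x : (A.tensor p).W p n) :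
    (φ.tensor p).W p n (weylProduct p n A x) = weylProduct p n B ((φ.tensor p).W p n x) := by
  rw [weylProduct, Hom.W_foldr, List.map_map, weylProduct]
  congr 2
  exact funext fun l => φ.W_weyl_iterate l x

theorem tensorGhost_weylProduct (x : (A.tensor p).W p n) (j : Fin n) :
    tensorGhost (weylProduct p n A x) j =
      normProd (P := A.Pow (p ^ ((j : ℕ) + 1))) (rotate A.R _) p (tensorGhost x j) := by
  rw [weylProduct, tensorGhost_foldr, List.map_map, normProd, ← List.toFinset_range,
    List.prod_toFinset _ List.nodup_range]
  congr 2
  exact funext fun l => tensorGhost_weyl_iterate l x j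

/-- The Frobenius forgets the component that involves `μ`; in ghost degree `j` both sides are then
`∏ σ^l y_j`. -/
theorem wittFrobenius_wittNorm (x : (A.tensor p).W p (n + 1)) :
    wittFrobenius p (n + 1) A (wittNorm p n A x) = weylProduct p (n + 1) A x := by
  have hN := isNorm_wittNorm.{u} (p := p) (n := n)
  have hF := isFrobenius_wittFrobenius.{u} p (n + 1)
  refine congrFun (congrFun ((tensorWittGhost.{u} p (n + 1)).ext
    (tensorFunctor_presentable p (n + 1))
    (θ := fun A x => wittFrobenius p (n + 1) A (wittNorm p n A x))
    (θ' := fun A x => weylProduct p (n + 1) A x)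
    (fun A B φ x => ?_) (fun A B φ x => φ.W_weylProduct x) fun A x => funext fun j => ?_) A) x
  · exact (hF.natural A B φ _).trans (congrArg (wittFrobenius p (n + 1) B) (hN.natural A B φ x))
  · refine (hF.ghost A _ j).trans ((congrFun (hN.ghost A x) j.succ).trans ?_)
    exact (normGhost_succ A _ j).trans (tensorGhost_weylProduct x j).symm

end Norm

end AlgPair

/-! ### Ghost components of classical Witt vectors -/

/-- Ghost component and earlier entries determine `p ^ j` times the `j`-th entry, and `p ^ j` is not
a zero divisor. -/
theorem AlgPair.coeff_eq_of_ghostComponent_eq {p : ℕ} [hp : Fact p.Prime] {n : ℕ} {P : Type*}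
    [CommRing P] [IsDomain P] [CharZero P] {x y : TruncatedWittVector p n P}
    (h : ∀ j < n, WittVector.ghostComponent j x.out = WittVector.ghostComponent j y.out) :
    x = y := by
  suffices H : ∀ j < n, x.out.coeff j = y.out.coeff j by
    ext j
    rw [← TruncatedWittVector.coeff_out, ← TruncatedWittVector.coeff_out, H j j.2]
  intro j
  induction j using Nat.strong_induction_on with
  | _ j ih =>
    intro hj
    have h' := h j hj
    rw [ghostComponent_eq_sum, ghostComponent_eq_sum, Finset.sum_range_succ,
      Finset.sum_range_succ, Finset.sum_congr rfl fun i hi => by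
        rw [ih i (Finset.mem_range.1 hi) ((Finset.mem_range.1 hi).trans hj)]] at h'
    have h0 : (p : P) ^ j ≠ 0 := pow_ne_zero _ (Nat.cast_ne_zero.2 hp.out.ne_zero)
    simpa [h0] using h'

namespace AlgPair

/-! ### Comparison with classical Witt vectors -/

section Scalar

variable {A : AlgPair.{u}} {p n : ℕ}

theorem exists_smul_one_eq (hA : Function.Surjective (algebraMap A.R A.M)) {k : ℕ} (hk : 0 < k)
    (x : A.Pow k) : ∃ r : A.R, r • 1 = x := by
  have : ∀ x, x ∈ ((LinearMap.toSpanSingleton A.R (A.Pow k) 1).toAddMonoidHom).range := by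
    refine mem_of_tprod_mem closure_univ_eq_top hk _ fun m _ => ?_
    choose r hr using fun i => hA (m i)
    refine ⟨∏ i, r i, (?_ : (∏ i, r i) • (1 : A.Pow k) = PiTensorProduct.tprod A.R m)⟩
    obtain rfl : (fun i => r i • (1 : A.M)) = m :=
      funext fun i => (Algebra.algebraMap_eq_smul_one (r i)).symm.trans (hr i)
    exact (MultilinearMap.map_smul_univ _ r fun _ => (1 : A.M)).symm
  exact this x

/-- The multiplication map recovers the image of `r` in `M` from `r • 1`. -/
theorem smul_one_injective (hA : Function.Injective (algebraMap A.R A.M)) (k : ℕ) :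
    Function.Injective fun r : A.R => r • (1 : A.Pow k) := fun r s h => by
  have h' := congrArg (A.mulMap k) h
  simp only [_root_.map_smul, mulMap_one] at h'
  rw [← Algebra.algebraMap_eq_smul_one, ← Algebra.algebraMap_eq_smul_one] at h'
  exact hA h'

theorem bijective_algebraMap_tensor (hA : Function.Bijective (algebraMap A.R A.M)) {k : ℕ}
    (hk : 0 < k) : Function.Bijective (algebraMap (A.tensor k).R (A.tensor k).M) := by
  have h : ∀ r : A.R, algebraMap A.R (A.Pow k) r = r • 1 := Algebra.algebraMap_eq_smul_one
  refine ⟨fun r s hrs => smul_one_injective hA.1 k ?_, fun x => ?_⟩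
  · exact (h r).symm.trans (Eq.trans hrs (h s))
  · obtain ⟨r, hr⟩ := exists_smul_one_eq hA.2 hk x
    exact ⟨r, (h r).trans hr⟩

theorem exists_scalar_eq (hA : Function.Surjective (algebraMap A.R A.M)) {k : ℕ} (hk : 0 < k)
    (x : A.toBimod.TPow k) : ∃ r, A.scalar k r = x := by
  obtain ⟨r, hr⟩ := exists_smul_one_eq hA hk (A.fromT k x)
  refine ⟨r, ?_⟩
  rw [← toT_fromT hk x, ← hr, ← fromT_scalar hk, toT_fromT]

theorem scalar_injective (hA : Function.Injective (algebraMap A.R A.M)) {k : ℕ} (hk : 0 < k) :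
    Function.Injective (A.scalar k) := fun r s h =>
  smul_one_injective hA k (by
    change r • (1 : A.Pow k) = s • (1 : A.Pow k)
    rw [← fromT_scalar hk, h, fromT_scalar hk])

variable (p n) in
/-- The sequence of scalar tensors given by a classical Witt vector. -/
def scalarSeq (A : AlgPair.{u}) (a : TruncatedWittVector p n A.R) : A.toBimod.Seq p n :=
  fun i => A.scalar _ (a.coeff i)

theorem exists_scalarSeq_eq (hA : Function.Surjective (algebraMap A.R A.M)) (hp : 0 < p)
    (x : A.toBimod.Seq p n) : ∃ a, A.scalarSeq p n a = x := by
  choose r hr using fun i => exists_scalar_eq hA (pow_pos hp _) (x i)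
  exact ⟨TruncatedWittVector.mk p r, funext fun i => hr i⟩

theorem scalarSeq_injective (hA : Function.Injective (algebraMap A.R A.M)) (hp : 0 < p) :
    Function.Injective (A.scalarSeq p n) := fun _ _ h =>
  TruncatedWittVector.ext fun i => scalar_injective hA (pow_pos hp _) (congrFun h i)

variable [hp : Fact p.Prime]

/-- For a torsion-free ring the sequence of tensors is determined by the ghost components. -/
theorem eq_of_seqGhost_eq {P : Type u} [CommRing P] [IsDomain P] [CharZero P]
    {q u : (self P).toBimod.Seq p n}
    (h : ∀ j, (self P).toBimod.seqGhost q j = (self P).toBimod.seqGhost u j) : q = u := by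
  have hP : Function.Bijective (algebraMap (self P).R (self P).M) := Function.bijective_id
  obtain ⟨a, rfl⟩ := exists_scalarSeq_eq hP.2 hp.out.pos q
  obtain ⟨b, rfl⟩ := exists_scalarSeq_eq hP.2 hp.out.pos u
  refine congrArg _ (coeff_eq_of_ghostComponent_eq fun j hj => smul_one_injective hP.1 (p ^ j) ?_)
  have h1 := ghost_ofClassical (A := self P) a ⟨j, hj⟩
  have h2 := ghost_ofClassical (A := self P) b ⟨j, hj⟩
  exact h1.symm.trans ((congrArg ((self P).fromCyc _) (h ⟨j, hj⟩)).trans h2)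

variable (A) in
/-- The map from the polynomial ring on the elements of `R` to `(R; M)`. -/
def selfCounit : Hom (self (MvPolynomial A.R ℤ)) A where
  base := MvPolynomial.eval₂Hom (Int.castRingHom A.R) id
  map := (algebraMap A.R A.M).comp (MvPolynomial.eval₂Hom (Int.castRingHom A.R) id)
  comm _ := rfl

/-- If all elements of `M` are scalars, then similar sequences are equal. -/
theorem eq_of_sim (hA : Function.Surjective (algebraMap A.R A.M)) {a b : A.toBimod.Seq p n}
    (h : Sim a b) : a = b := by
  obtain ⟨q, u, rfl, rfl, h⟩ := h
  -- After a choice of scalars `s m`, the counit of the free cover factors through `(P; P)`, with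
  -- `P` the polynomial ring on the elements of `R`. There equal ghost components force equal
  -- sequences, so the two lifts agree already in `(P; P)`.
  choose s hs using hA
  let φ : Bimod.Hom A.toBimod.cover (self (MvPolynomial A.R ℤ)).toBimod :=
    free.lift _ (fun r : A.R => (MvPolynomial.X r : MvPolynomial A.R ℤ))
      fun m : A.M => (MvPolynomial.X (s m) : MvPolynomial A.R ℤ)
  have hφ : A.toBimod.counit = A.selfCounit.toBimod.comp φ := by
    refine free.hom_ext (fun x => ?_) fun x => ?_
    · refine (counit_base (B := A.toBimod) x).trans (Eq.symm ?_)
      refine (congrArg A.selfCounit.base (free.lift_base_var _ _ _ x)).trans ?_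
      exact MvPolynomial.eval₂Hom_X' _ _ x
    · refine (counit_map (B := A.toBimod) x).trans (Eq.symm ?_)
      refine (congrArg A.selfCounit.map (free.lift_map_gen _ _ _ x)).trans ?_
      exact (congrArg (algebraMap A.R A.M) (MvPolynomial.eval₂Hom_X' _ _ (s x))).trans (hs x)
  rw [hφ, Hom.seq_comp, Hom.seq_comp]
  refine congrArg A.selfCounit.toBimod.seq (eq_of_seqGhost_eq fun j => ?_)
  rw [← Hom.cycPow_seqGhost, ← Hom.cycPow_seqGhost, h]

theorem eq_of_mk_eq (hA : Function.Surjective (algebraMap A.R A.M)) {a b : A.toBimod.Seq p n}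
    (h : Witt.mk a = Witt.mk b) : a = b := by
  have h' := eqvGen_sim_of_mk_eq h
  clear h
  induction h' with
  | rel a b h => exact eq_of_sim hA h
  | refl a => rfl
  | symm a b _ ih => exact ih.symm
  | trans a b c _ _ ih1 ih2 => exact ih1.trans ih2

variable (p n) in
/-- If all elements of `M` are scalars in a unique way, the Witt vectors with coefficients in
`(R; M)` are the classical ones of `R`. -/
theorem ofClassical_bijective (hA : Function.Bijective (algebraMap A.R A.M)) :
    Function.Bijective (A.ofClassical p n) := by
  refine ⟨fun a b h => scalarSeq_injective hA.1 hp.out.pos (eq_of_mk_eq hA.2 h), fun x => ?_⟩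
  induction x using Quot.ind with
  | mk x =>
    obtain ⟨a, rfl⟩ := exists_scalarSeq_eq hA.2 hp.out.pos x
    exact ⟨a, rfl⟩

variable (p n) in
theorem ofClassical_self_bijective (R : Type u) [CommRing R] :
    Function.Bijective ((self R).ofClassical p n) :=
  ofClassical_bijective p n Function.bijective_id

end Scalar

/-! ### The norm of classical Witt vectors -/

section ClassicalNorm

variable (p n : ℕ) [hp : Fact p.Prime]

/-- The classical norm is the norm of `(R; R)` transported along the bijections from classical Witt
vectors, with naturality and ghost components inherited from it. -/
theorem existsUnique_isClassicalNorm :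
    (∃! C, IsClassicalNorm.{u} p n C) ∧
    ∀ C : (∀ (R : Type u) [CommRing R],
        TruncatedWittVector p (n + 1) R → TruncatedWittVector p (n + 2) R),
      IsClassicalNorm p n @C → ∀ (R : Type u) [CommRing R] (a : TruncatedWittVector p (n + 1) R),
        wittNorm p n (self R) (((self R).tensor p).ofClassical p (n + 1) a) =
          (self R).ofClassical p (n + 2) (C R a) := by
  have hN := isNorm_wittNorm.{u} (p := p) (n := n)
  have hex : ∀ (R : Type u) [CommRing R] (a : TruncatedWittVector p (n + 1) R),
      ∃ c, (self R).ofClassical p (n + 2) c =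
        wittNorm p n (self R) (((self R).tensor p).ofClassical p (n + 1) a) :=
    fun R _ a => (ofClassical_self_bijective p (n + 2) R).2 _
  choose N hN' using hex
  have hghost : ∀ (R : Type u) [CommRing R] (a : TruncatedWittVector p (n + 1) R) (j : Fin (n + 2)),
      WittVector.ghostComponent j (N R a).out • (1 : (self R).Pow (p ^ (j : ℕ))) =
        normGhost p n (self R)
          (fun j => WittVector.ghostComponent j a.out • (1 : (self R).Pow _)) j := by
    intro R _ a j
    refine (ghost_ofClassical (A := self R) (N R a) j).symm.trans ?_
    rw [hN', hN.ghost]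
    exact congrFun (congrArg (normGhost p n (self R))
      (funext fun j => tensorGhost_ofClassical (A := self R) a j)) j
  have hcl : IsClassicalNorm.{u} p n @N := by
    refine ⟨fun R S _ _ f a => ?_, fun R _ a => ?_, fun R _ a j hj => ?_⟩
    · let φ : Hom (self R) (self S) := ⟨f, f, fun _ => rfl⟩
      refine (ofClassical_self_bijective p (n + 2) S).1 ?_
      refine (φ.W_ofClassical (N R a)).symm.trans ?_
      rw [hN', hN', hN.natural, Hom.W_ofClassical]
      rfl
    · refine smul_one_injective (A := self R) Function.injective_id (p ^ 0) ?_
      refine (hghost R a 0).trans ?_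
      rw [normGhost_zero, _root_.map_smul, mulMap_one, toPowOne_smul]
      rfl
    · refine smul_one_injective (A := self R) Function.injective_id (p ^ (j + 1)) ?_
      refine (hghost R a (Fin.succ ⟨j, by omega⟩)).trans ?_
      -- Rotation fixes scalars, so the product over `l < p` is a `p`-th power.
      have hfix : ∀ l : ℕ, (rotate R (p ^ (j + 1)))^[l]
          (WittVector.ghostComponent j a.out • (1 : (self R).Pow (p ^ (j + 1)))) =
            WittVector.ghostComponent j a.out • 1 := fun l =>
        Function.iterate_fixed ((rotate_smul (A := self R) _ _).trans
          (congrArg _ (rotate_one (A := self R)))) l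
      refine (Finset.prod_congr (s₁ := Finset.range p) rfl fun l _ => hfix l).trans ?_
      rw [Finset.prod_const, Finset.card_range, smul_pow, one_pow]
  have huniq : ∀ C : (∀ (R : Type u) [CommRing R],
      TruncatedWittVector p (n + 1) R → TruncatedWittVector p (n + 2) R),
      IsClassicalNorm p n @C → @C = @N := by
    intro C hC
    funext R _ a
    let f : MvPolynomial R ℤ →+* R := MvPolynomial.eval₂Hom (Int.castRingHom R) id
    -- Uniqueness is tested on the polynomial ring on the elements of `R`: there ghost components
    -- determine a classical Witt vector, and every Witt vector over `R` lifts to it.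
    have key : ∀ a' : TruncatedWittVector p (n + 1) (MvPolynomial R ℤ), C R (TruncatedWittVector.mk p fun i => f (a'.coeff i)) =
        N R (TruncatedWittVector.mk p fun i => f (a'.coeff i)) := fun a' => by
      rw [← hC.natural, ← hcl.natural]
      have : C (MvPolynomial R ℤ) a' = N (MvPolynomial R ℤ) a' := by
        refine coeff_eq_of_ghostComponent_eq fun j hj => ?_
        cases j with
        | zero => rw [hC.ghost_zero, hcl.ghost_zero]
        | succ j => rw [hC.ghost_succ _ _ _ (by omega), hcl.ghost_succ _ _ _ (by omega)]
      rw [this]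
    have ha : (TruncatedWittVector.mk p fun i => f ((TruncatedWittVector.mk p fun i =>
        (MvPolynomial.X (a.coeff i) : MvPolynomial R ℤ)).coeff i)) = a := by
      ext i
      rw [TruncatedWittVector.coeff_mk, TruncatedWittVector.coeff_mk]
      exact MvPolynomial.eval₂Hom_X' _ _ _
    have := key (TruncatedWittVector.mk p fun i => MvPolynomial.X (a.coeff i))
    rwa [ha] at this
  refine ⟨⟨@N, hcl, huniq⟩, fun C hC R _ a => ?_⟩
  rw [huniq C hC, hN']

end ClassicalNorm

end AlgPair

end WittCoeff

end

theorem mainTheorem10 (p : ℕ) [Fact p.Prime] :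
    -- the product, the Frobenius and the Weyl action are well defined
    (∀ n : ℕ,
      (∃! m, IsProduct.{u} p n m) ∧ IsProduct.{u} p n (wittProduct p n) ∧
      (∃! F, IsFrobenius.{u} p n F) ∧ IsFrobenius.{u} p n (wittFrobenius p n) ∧
      (∃! s, IsWeyl.{u} p n s) ∧ IsWeyl.{u} p n (wittWeyl p n)) ∧
    -- the product is commutative and associative with unit `τ(1)`
    (∀ (n : ℕ) (A : AlgPair.{u}) (x y z : A.W p n),
      wittProduct p n A x y = wittProduct p n A y x ∧
      wittProduct p n A (wittProduct p n A x y) z = wittProduct p n A x (wittProduct p n A y z) ∧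
      wittProduct p n A (wittUnit p n A) x = x) ∧
    -- the map `N_w` is multiplicative and unital
    (∀ (n : ℕ) (A : AlgPair.{u}),
      (∀ y y' : (∀ j : Fin (n + 1), A.Pow (p ^ ((j : ℕ) + 1))),
        normGhost p n A (y * y') = normGhost p n A y * normGhost p n A y') ∧
      normGhost p n A 1 = 1) ∧
    ∃ N : ∀ (n : ℕ) (A : AlgPair.{u}), (A.tensor p).W p (n + 1) → A.W p (n + 2),
      -- existence and uniqueness of the norm
      (∀ n, IsNorm p n (N n) ∧ ∀ N', IsNorm p n N' → N' = N n) ∧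
      -- multiplicative and unital
      (∀ (n : ℕ) (A : AlgPair.{u}) (x y : (A.tensor p).W p (n + 1)),
        N n A (wittProduct p (n + 1) (A.tensor p) x y) =
          wittProduct p (n + 2) A (N n A x) (N n A y)) ∧
      (∀ (n : ℕ) (A : AlgPair.{u}), N n A (wittUnit p (n + 1) (A.tensor p)) = wittUnit p (n + 2) A) ∧
      -- `R N = N R`
      (∀ (n : ℕ) (A : AlgPair.{u}) (x : (A.tensor p).W p (n + 2)),
        AlgPair.restrict (N (n + 1) A x) = N n A (AlgPair.restrict x)) ∧
      -- `F N x = ∏_{σ ∈ C_p} σ x`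
      (∀ (n : ℕ) (A : AlgPair.{u}) (x : (A.tensor p).W p (n + 1)),
        wittFrobenius p (n + 1) A (N n A x) = weylProduct p (n + 1) A x) ∧
      -- for `M = R` it is the norm of classical Witt vectors
      (∀ (n : ℕ) (R : Type u) [CommRing R],
        Function.Bijective ((AlgPair.self R).ofClassical p n) ∧
        Function.Bijective (((AlgPair.self R).tensor p).ofClassical p n)) ∧
      (∀ n : ℕ, ∃! C, IsClassicalNorm.{u} p n C) ∧
      (∀ (n : ℕ) (C : ∀ (R : Type u) [CommRing R],
          TruncatedWittVector p (n + 1) R → TruncatedWittVector p (n + 2) R),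
        IsClassicalNorm p n @C → ∀ (R : Type u) [CommRing R] (a : TruncatedWittVector p (n + 1) R),
          N n (AlgPair.self R) (((AlgPair.self R).tensor p).ofClassical p (n + 1) a) =
            (AlgPair.self R).ofClassical p (n + 2) (C R a)) := by
  refine ⟨fun n => ⟨AlgPair.existsUnique_isProduct p n, AlgPair.isProduct_wittProduct p n,
    AlgPair.existsUnique_isFrobenius p n, AlgPair.isFrobenius_wittFrobenius p n,
    AlgPair.existsUnique_isWeyl p n, AlgPair.isWeyl_wittWeyl p n⟩,
    fun n A x y z => ⟨AlgPair.wittProduct_comm x y, AlgPair.wittProduct_assoc x y z,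
      AlgPair.wittUnit_wittProduct x⟩,
    fun n A => ⟨AlgPair.normGhost_mul, AlgPair.normGhost_one⟩,
    fun n => AlgPair.wittNorm p n, fun n => ⟨AlgPair.isNorm_wittNorm, fun N' hN' =>
      (AlgPair.existsUnique_isNorm p n).unique hN' AlgPair.isNorm_wittNorm⟩,
    fun n A => AlgPair.wittNorm_wittProduct, fun n A => AlgPair.wittNorm_wittUnit,
    fun n A => AlgPair.restrict_wittNorm, fun n A => AlgPair.wittFrobenius_wittNorm,
    fun n R _ => ⟨AlgPair.ofClassical_self_bijective p n R, ?_⟩,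
    fun n => (AlgPair.existsUnique_isClassicalNorm p n).1,
    fun n => (AlgPair.existsUnique_isClassicalNorm p n).2⟩
  -- The structure map `R → R^{⊗ p}` is bijective too, so the comparison also applies to the tensor
  -- power.
  exact AlgPair.ofClassical_bijective p n
    (AlgPair.bijective_algebraMap_tensor Function.bijective_id (Nat.Prime.pos Fact.out))
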